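/- Let $D$ be the closed unit disk in the plane and fix $A\in(0,\pi)$. The perimeter of a convex set with nonempty interior is the length of its boundary (a segment has perimeter twice its length). Consider two problems: (i) maximize $\operatorname{Per}(\Omega)$ among convex sets $\Omega\subset D$ with area $|\Omega|=A$; (ii) for an integer $n\ge 3$, maximize $\operatorname{Per}(P)$ among convex polygons $P\subset D$ with at most $n$ vertices and area $|P|\le A$. The central angles of a convex polygon inscribed in the unit circle are the positive angles, with sum $2\pi$, between the polar angles of consecutive vertices. 1. For every $n\ge 3$ problem (ii) has a solution, every solution is inscribed in the unit circle, and the solutions are determined by $n$ and $A$ up to a permutation of the sides and a rotation: there is a multiset $\Theta$ of central angles, depending only on $n$ and $A$, such that $P$ solves (ii) if and only if $P$ is a convex polygon inscribed in the unit circle whose central angles, in some order, are $\Theta$. 2. There is a unique integer $m\ge 2$ with $$(m-1)\sin\frac{2\pi}{m-1}<2A\le m\sin\frac{2\pi}{m},$$ and $m\ge 3$. There is a unique $\theta_1\in\left(0,\frac{2\pi}{m}\right]$ with $$\sin\theta_1+(m-1)\sin\frac{2\pi-\theta_1}{m-1}=2A.$$ Put $\theta_2=\dots=\theta_m=\frac{2\pi-\theta_1}{m-1}$;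 then $0<\theta_1\le\theta_2$. 3. For every $n\ge m$, a set $P$ solves (ii) if and only if $P$ is a convex $m$-gon inscribed in the unit circle with central angles $\theta_1,\theta_2,\dots,\theta_m$ in some order. In particular, the solution does not depend on $n\ge m$, up to a permutation of the sides (and a rotation). 4. Problem (i) has a solution, and a convex set $\Omega$ solves (i) if and only if its closure is a convex $m$-gon inscribed in the unit circle with central angles $\theta_1,\theta_2,\dots,\theta_m$ in some order. -/

import Mathlib

open MeasureTheory

noncomputable section

/-- The Euclidean plane. -/
abbrev Plane : Type := EuclideanSpace ℝ (Fin 2)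

/-- The (closed) unit disk `D`. -/
def unitDisk : Set Plane := Metric.closedBall 0 1

open Classical in
/-- The perimeter of a convex subset of the plane: the length (one-dimensional Hausdorff measure)
of its boundary. A convex set without interior lies on a line and is its own boundary, up to
closure; such a degenerate set is counted with both of its sides, as is usual for convex sets, so
that a segment has perimeter twice its length. -/
def perimeter (Ω : Set Plane) : ENNReal :=
  if (interior Ω).Nonempty then Measure.hausdorffMeasure 1 (frontier Ω)
  else 2 * Measure.hausdorffMeasure 1 (frontier Ω)

/-- The convex subsets of the unit disk that have area `A`. -/
def convexClass (A : ℝ) : Set (Set Plane) :=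
  {Ω | Convex ℝ Ω ∧ Ω ⊆ unitDisk ∧ volume Ω = ENNReal.ofReal A}

/-- `Ω` has maximal perimeter among the convex subsets of the unit disk that have area `A`. -/
def IsConvexMaximizer (A : ℝ) (Ω : Set Plane) : Prop :=
  Ω ∈ convexClass A ∧ ∀ Ω' ∈ convexClass A, perimeter Ω' ≤ perimeter Ω

/-- The convex polygons (as filled regions) with at most `n` vertices that are contained in the
unit disk and have area at most `A`. Degenerate polygons are included. -/
def polygonClass (n : ℕ) (A : ℝ) : Set (Set Plane) :=
  {P | (∃ V : Finset Plane, V.Nonempty ∧ V.card ≤ n ∧ P = convexHull ℝ (V : Set Plane)) ∧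
    P ⊆ unitDisk ∧ volume P ≤ ENNReal.ofReal A}

/-- `P` has maximal perimeter among the convex polygons with at most `n` vertices that are
contained in the unit disk and have area at most `A`. -/
def IsPolygonMaximizer (n : ℕ) (A : ℝ) (P : Set Plane) : Prop :=
  P ∈ polygonClass n A ∧ ∀ Q ∈ polygonClass n A, perimeter Q ≤ perimeter P

/-- The point of the unit circle with polar angle `t`. -/
def circlePoint (t : ℝ) : Plane := !₂[Real.cos t, Real.sin t]

/-- `P` is a convex `k`-gon inscribed in the unit circle, and `θ 0, …, θ (k - 1)` are, in
counterclockwise order, the positive angles at the centre between consecutive vertices: the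
vertices have the polar angles `φ, φ + θ 0, φ + θ 0 + θ 1, …` for some `φ`. -/
def IsInscribedPolygon {k : ℕ} (θ : Fin k → ℝ) (P : Set Plane) : Prop :=
  3 ≤ k ∧ (∀ i, 0 < θ i) ∧ ∑ i, θ i = 2 * Real.pi ∧
    ∃ φ : ℝ, P = convexHull ℝ
      (Set.range fun i : Fin k => circlePoint (φ + ∑ j ∈ Finset.Iio i, θ j))

/-- `P` is a convex polygon inscribed in the unit circle whose sides have, in some order, the
central angles in the multiset `Θ` (so the number of sides is the cardinality of `Θ`). -/
def HasCentralAngles (P : Set Plane) (Θ : Multiset ℝ) : Prop :=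
  ∃ (k : ℕ) (θ : Fin k → ℝ), IsInscribedPolygon θ P ∧ Finset.univ.val.map θ = Θ

/-- The condition `(m - 1) sin (2π / (m - 1)) < 2 A ≤ m sin (2π / m)` on the number of sides. -/
def SideCountCondition (A : ℝ) (m : ℕ) : Prop :=
  ((m : ℝ) - 1) * Real.sin (2 * Real.pi / ((m : ℝ) - 1)) < 2 * A ∧
    2 * A ≤ (m : ℝ) * Real.sin (2 * Real.pi / (m : ℝ))

/-- `t ∈ (0, 2π / m]` solves `sin t + (m - 1) sin ((2π - t) / (m - 1)) = 2 A`. -/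
def SmallAngleCondition (A : ℝ) (m : ℕ) (t : ℝ) : Prop :=
  0 < t ∧ t ≤ 2 * Real.pi / (m : ℝ) ∧
    Real.sin t + ((m : ℝ) - 1) * Real.sin ((2 * Real.pi - t) / ((m : ℝ) - 1)) = 2 * A

end

/-- Twice the area of the circular cap with central angle `x` is `x - sin x`. -/
noncomputable def capArea (x : ℝ) : ℝ := (x - Real.sin x) / 2

/-- The difference of an arc with central angle `x` and its chord. -/
noncomputable def capExcess (x : ℝ) : ℝ := x - 2 * Real.sin (x / 2)

/-! ### The number m of sides and the small angle θ₁ -/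

/-- Strict concavity of the sine, compared with its chord from 0: sin u / u is strictly decreasing
on (0, π]. -/
lemma mul_sin_lt_mul_sin {x y : ℝ} (hx : 0 < x) (hxy : x < y) (hy : y ≤ Real.pi) :
    x * Real.sin y < y * Real.sin x := by
  have h := strictConcaveOn_sin_Icc.2 (show (0 : ℝ) ∈ Set.Icc 0 Real.pi from ⟨le_rfl, Real.pi_pos.le⟩)
    (show y ∈ Set.Icc 0 Real.pi from ⟨by linarith, hy⟩) (by linarith)
    (show 0 < 1 - x / y by rw [sub_pos, div_lt_one (by linarith)]; exact hxy)
    (show 0 < x / y from div_pos hx (by linarith)) (by ring)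
  have hy0 : 0 < y := by linarith
  simp only [Real.sin_zero, smul_eq_mul, mul_zero, zero_add] at h
  rw [div_mul_cancel₀ _ hy0.ne', div_mul_eq_mul_div, div_lt_iff₀ hy0] at h
  linarith

/-- The decrease of sin u / u at u = 2π/x. The variable is real so that m − 1 can be inserted
without subtraction of natural numbers. -/
lemma regular_area_strictMono {x y : ℝ} (hx : 2 ≤ x) (hxy : x < y) :
    x * Real.sin (2 * Real.pi / x) < y * Real.sin (2 * Real.pi / y) := by
  have hπ := Real.pi_pos
  have hx0 : 0 < x := by linarith
  have hy0 : 0 < y := by linarith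
  have h := mul_sin_lt_mul_sin (x := 2 * Real.pi / y) (y := 2 * Real.pi / x)
    (by positivity) (by gcongr) (by rw [div_le_iff₀ (by linarith)]; nlinarith)
  rw [div_mul_eq_mul_div, div_mul_eq_mul_div, div_lt_div_iff₀ hy0 hx0] at h
  have h2 : 0 < 2 * Real.pi := by positivity
  nlinarith

lemma regular_area_mono {x y : ℝ} (hx : 2 ≤ x) (hxy : x ≤ y) :
    x * Real.sin (2 * Real.pi / x) ≤ y * Real.sin (2 * Real.pi / y) := by
  rcases hxy.eq_or_lt with rfl | h
  · rfl
  · exact (regular_area_strictMono hx h).le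

lemma tendsto_regular_area :
    Filter.Tendsto (fun k : ℕ => (k : ℝ) * Real.sin (2 * Real.pi / k)) Filter.atTop
      (nhds (2 * Real.pi)) := by
  have h := (Real.hasDerivAt_sin 0).tendsto_slope_zero
  simp only [Real.cos_zero, zero_add, Real.sin_zero, sub_zero, smul_eq_mul] at h
  have h1 : Filter.Tendsto (fun k : ℕ => 2 * Real.pi / (k : ℝ)) Filter.atTop
      (nhdsWithin 0 {0}ᶜ) := by
    refine tendsto_nhdsWithin_iff.2 ⟨tendsto_const_div_atTop_nhds_zero_nat _, ?_⟩
    filter_upwards [Filter.eventually_gt_atTop 0] with k hk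
    have : (0 : ℝ) < k := by exact_mod_cast hk
    have := Real.pi_pos
    simp only [Set.mem_compl_iff, Set.mem_singleton_iff]
    positivity
  have h2 := (h.comp h1).const_mul (2 * Real.pi)
  rw [mul_one] at h2
  refine h2.congr' ?_
  filter_upwards [Filter.eventually_gt_atTop 0] with k hk
  have : (0 : ℝ) < k := by exact_mod_cast hk
  have := Real.pi_pos
  simp only [Function.comp]
  field_simp

/-- The half-open intervals between consecutive values of k sin(2π/k), k ≥ 1, that contain 2A are
indexed by their right end; by monotonicity from k = 2 on, two of them with different indices from k
= 2 upwards are disjoint. -/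
lemma sideCountCondition_unique {A : ℝ} {k m : ℕ} (hk : 2 ≤ k) (hm : 2 ≤ m)
    (h : SideCountCondition A k) (h' : SideCountCondition A m) : k = m := by
  have key : ∀ {k m : ℕ}, 2 ≤ k → 2 ≤ m → SideCountCondition A k → SideCountCondition A m →
      ¬ k < m := by
    intro k m hk hm h h' hlt
    have h3 : (2 : ℝ) ≤ k := by exact_mod_cast hk
    have h4 : (k : ℝ) ≤ m - 1 := by
      have : ((k + 1 : ℕ) : ℝ) ≤ m := by exact_mod_cast hlt
      push_cast at this
      linarith
    have := regular_area_mono h3 h4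
    linarith [h.2, h'.1]
  exact le_antisymm (not_lt.1 (key hm hk h' h)) (not_lt.1 (key hk hm h h'))

lemma exists_sideCountCondition {A : ℝ} (hA : 0 < A) (hAπ : A < Real.pi) :
    ∃ m : ℕ, 3 ≤ m ∧ SideCountCondition A m := by
  classical
  have hex : ∃ m : ℕ, 2 ≤ m ∧ 2 * A ≤ (m : ℝ) * Real.sin (2 * Real.pi / (m : ℝ)) := by
    have h := tendsto_regular_area.eventually (lt_mem_nhds (show 2 * A < 2 * Real.pi by linarith))
    obtain ⟨m, hm, hm2⟩ := (h.and (Filter.eventually_ge_atTop 2)).exists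
    exact ⟨m, hm2, hm.le⟩
  have hs := Nat.find_spec hex
  set m := Nat.find hex with hmdef
  -- At m = 2 the right side is 2 sin π = 0 < 2A. Hence m − 1 ≥ 2, and minimality of m can be
  -- applied to m − 1.
  have h2 : m ≠ 2 := by
    intro h
    have := hs.2
    rw [h] at this
    norm_num at this
    linarith
  have h3 : 3 ≤ m := by have := hs.1; omega
  refine ⟨m, h3, ?_, hs.2⟩
  have hmin := Nat.find_min hex (show m - 1 < Nat.find hex by omega)
  have hc : ((m - 1 : ℕ) : ℝ) = (m : ℝ) - 1 := by
    rw [Nat.cast_sub (by omega)]; simp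
  by_contra hcon
  exact hmin ⟨by omega, by rw [hc]; linarith⟩

/-- The derivative is cos t − cos((2π − t)/(m − 1)), which is positive while t is smaller than the
common value of the other angles, that is, for t < 2π/m. -/
lemma smallAngle_strictMonoOn {m : ℕ} (hm : 3 ≤ m) :
    StrictMonoOn (fun t : ℝ => Real.sin t +
      ((m : ℝ) - 1) * Real.sin ((2 * Real.pi - t) / ((m : ℝ) - 1)))
      (Set.Icc 0 (2 * Real.pi / m)) := by
  have hπ := Real.pi_pos
  have hm3 : (3 : ℝ) ≤ m := by exact_mod_cast hm
  have hm1 : (0 : ℝ) < (m : ℝ) - 1 := by linarith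
  refine strictMonoOn_of_deriv_pos (convex_Icc _ _) (by fun_prop) ?_
  intro t ht
  rw [interior_Icc] at ht
  have hd : HasDerivAt (fun t : ℝ => Real.sin t +
      ((m : ℝ) - 1) * Real.sin ((2 * Real.pi - t) / ((m : ℝ) - 1)))
      (Real.cos t - Real.cos ((2 * Real.pi - t) / ((m : ℝ) - 1))) t := by
    have h1 : HasDerivAt (fun t : ℝ => (2 * Real.pi - t) / ((m : ℝ) - 1))
        ((-1) / ((m : ℝ) - 1)) t := ((hasDerivAt_id t).const_sub _).div_const _
    refine ((Real.hasDerivAt_sin t).add (h1.sin.const_mul ((m : ℝ) - 1))).congr_deriv ?_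
    field_simp
    ring
  rw [hd.deriv, sub_pos]
  refine Real.cos_lt_cos_of_nonneg_of_le_pi ht.1.le ?_ ?_
  · rw [div_le_iff₀ hm1]; nlinarith [ht.1]
  · rw [lt_div_iff₀ hm1]
    have := ht.2
    rw [lt_div_iff₀ (by linarith)] at this
    linarith

lemma smallAngleCondition_unique {A : ℝ} {m : ℕ} (hm : 3 ≤ m) {s t : ℝ}
    (hs : SmallAngleCondition A m s) (ht : SmallAngleCondition A m t) : s = t :=
  (smallAngle_strictMonoOn hm).injOn ⟨hs.1.le, hs.2.1⟩ ⟨ht.1.le, ht.2.1⟩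
    (hs.2.2.trans ht.2.2.symm)

lemma exists_smallAngleCondition {A : ℝ} {m : ℕ} (hm : 3 ≤ m) (h : SideCountCondition A m) :
    ∃ t, SmallAngleCondition A m t := by
  have hπ := Real.pi_pos
  have hm3 : (3 : ℝ) ≤ m := by exact_mod_cast hm
  have hm1 : (0 : ℝ) < (m : ℝ) - 1 := by linarith
  -- The values at the two ends of the interval are the two bounds of `SideCountCondition`;
  -- strictness of the lower bound excludes t = 0.
  have hiv := intermediate_value_Icc (a := 0) (b := 2 * Real.pi / m) (by positivity)
    (f := fun t : ℝ => Real.sin t +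
      ((m : ℝ) - 1) * Real.sin ((2 * Real.pi - t) / ((m : ℝ) - 1))) (by fun_prop)
  have he : (2 * Real.pi - 2 * Real.pi / m) / ((m : ℝ) - 1) = 2 * Real.pi / m := by
    field_simp
  obtain ⟨t, ht, hte⟩ := hiv (show 2 * A ∈ _ by
    refine ⟨?_, ?_⟩
    · simpa using h.1.le
    · simp only [he]
      have := h.2
      linarith)
  refine ⟨t, lt_of_le_of_ne ht.1 ?_, ht.2, hte⟩
  rintro rfl
  simp only [Real.sin_zero, zero_add, sub_zero] at hte
  linarith [h.1]

/-! ### Properties of `capArea` and `capExcess` -/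

lemma hasDerivAt_capArea (x : ℝ) : HasDerivAt capArea ((1 - Real.cos x) / 2) x :=
  ((hasDerivAt_id x).sub (Real.hasDerivAt_sin x)).div_const 2

lemma continuous_capArea : Continuous capArea := by unfold capArea; fun_prop

lemma hasDerivAt_capExcess (x : ℝ) : HasDerivAt capExcess (1 - Real.cos (x / 2)) x := by
  have h1 : HasDerivAt (fun t : ℝ => t / 2) (1 / 2) x := (hasDerivAt_id x).div_const _
  refine ((hasDerivAt_id x).sub (h1.sin.const_mul 2)).congr_deriv ?_
  ring

lemma capArea_zero : capArea 0 = 0 := by simp [capArea]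

lemma capArea_pos {x : ℝ} (hx : 0 < x) : 0 < capArea x := by
  have := Real.sin_lt hx
  unfold capArea
  linarith

lemma capExcess_nonneg {x : ℝ} (hx : 0 ≤ x) : 0 ≤ capExcess x := by
  have := Real.sin_le (show 0 ≤ x / 2 by linarith)
  unfold capExcess
  linarith

lemma capExcess_le {x : ℝ} (hx : 0 ≤ x) (hx2 : x ≤ 2 * Real.pi) : capExcess x ≤ x := by
  have := Real.sin_nonneg_of_nonneg_of_le_pi (show 0 ≤ x / 2 by linarith) (by linarith)
  unfold capExcess
  linarith

lemma capArea_strictMonoOn : StrictMonoOn capArea (Set.Icc 0 (2 * Real.pi)) := by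
  refine strictMonoOn_of_deriv_pos (convex_Icc _ _) continuous_capArea.continuousOn ?_
  intro x hx
  rw [interior_Icc] at hx
  rw [(hasDerivAt_capArea x).deriv]
  have h : Real.cos x ≠ 1 := by
    intro h
    rw [Real.cos_eq_one_iff_of_lt_of_lt (by linarith [hx.1, Real.pi_pos]) hx.2] at h
    linarith [hx.1]
  have := lt_of_le_of_ne (Real.cos_le_one x) h
  linarith

/-- `capArea x / x` is nondecreasing on `(0, π]`. -/
lemma capArea_mul_le {x y : ℝ} (hx : 0 ≤ x) (hxy : x ≤ y) (hy : y ≤ Real.pi) :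
    capArea x * y ≤ x * capArea y := by
  unfold capArea
  suffices h : x * Real.sin y ≤ y * Real.sin x by linarith
  rcases hx.eq_or_lt with rfl | hx
  · simp
  rcases hxy.eq_or_lt with rfl | hxy
  · rfl
  exact (mul_sin_lt_mul_sin hx hxy hy).le

/-- `capExcess x / capArea x` is increasing. -/
lemma capExcess_mul_capArea_lt {x y : ℝ} (hx : 0 < x) (hxy : x < y) (hy : y ≤ 2 * Real.pi) :
    capExcess x * capArea y < capExcess y * capArea x := by
  have hcA : ∀ t, 0 < t → capArea t ≠ 0 := fun t ht => (capArea_pos ht).ne'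
  have hm : StrictMonoOn (fun t => capExcess t / capArea t) (Set.Ioc 0 (2 * Real.pi)) := by
    have hcE : Continuous capExcess := by unfold capExcess; fun_prop
    refine strictMonoOn_of_deriv_pos (convex_Ioc _ _)
      (hcE.continuousOn.div continuous_capArea.continuousOn fun t ht => hcA t ht.1) ?_
    intro t ht
    rw [interior_Ioc] at ht
    rw [((hasDerivAt_capExcess t).fun_div (hasDerivAt_capArea t) (hcA t ht.1)).deriv]
    have hcp := capArea_pos ht.1
    refine div_pos ?_ (by positivity)
    obtain ⟨h, rfl⟩ : ∃ h, t = 2 * h := ⟨t / 2, by ring⟩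
    have hh0 : 0 < h := by linarith [ht.1]
    have hhπ : h < Real.pi := by linarith [ht.2]
    have hc1 : Real.cos h < 1 := by
      have := Real.cos_lt_cos_of_nonneg_of_le_pi le_rfl hhπ.le hh0
      rwa [Real.cos_zero] at this
    -- This is the numerator of the derivative of the quotient after division by 1 − cos h, with t =
    -- 2h. It vanishes at 0, and its own derivative is 2 sin u (u − sin u).
    have hq : 0 < 2 * Real.sin h + Real.sin h * Real.cos h - h - 2 * h * Real.cos h := by
      have hmq : StrictMonoOn (fun u : ℝ => 2 * Real.sin u + Real.sin u * Real.cos u - u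
          - 2 * u * Real.cos u) (Set.Icc 0 Real.pi) := by
        refine strictMonoOn_of_deriv_pos (convex_Icc _ _) (by fun_prop) ?_
        intro u hu
        rw [interior_Icc] at hu
        have hd : HasDerivAt (fun u : ℝ => 2 * Real.sin u + Real.sin u * Real.cos u - u
          - 2 * u * Real.cos u) (2 * Real.sin u * (u - Real.sin u)) u := by
          refine (((((Real.hasDerivAt_sin u).const_mul 2).add
            ((Real.hasDerivAt_sin u).mul (Real.hasDerivAt_cos u))).sub (hasDerivAt_id u)).sub
            (((hasDerivAt_id u).const_mul 2).mul (Real.hasDerivAt_cos u))).congr_deriv ?_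
          have := Real.sin_sq_add_cos_sq u
          simp only [id]
          linear_combination this
        rw [hd.deriv]
        have := Real.sin_pos_of_pos_of_lt_pi hu.1 hu.2
        have := Real.sin_lt hu.1
        have : 0 < u - Real.sin u := by linarith
        positivity
      have := hmq ⟨le_rfl, Real.pi_pos.le⟩ ⟨hh0.le, hhπ.le⟩ hh0
      simpa using this
    have he : (1 - Real.cos (2 * h / 2)) * capArea (2 * h)
        - capExcess (2 * h) * ((1 - Real.cos (2 * h)) / 2)
        = (1 - Real.cos h) *
          (2 * Real.sin h + Real.sin h * Real.cos h - h - 2 * h * Real.cos h) := by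
      unfold capArea capExcess
      rw [mul_div_cancel_left₀ _ two_ne_zero, Real.cos_two_mul, Real.sin_two_mul]
      ring
    rw [he]
    exact mul_pos (by linarith) hq
  have h := hm ⟨hx, by linarith⟩ ⟨by linarith, hy⟩ hxy
  simp only at h
  rw [div_lt_div_iff₀ (capArea_pos hx) (capArea_pos (by linarith))] at h
  exact h

/-! ### Improving two or three central angles -/

/-- A function with positive derivative at `0` is positive just to the right, if it vanishes at `0`. -/
lemma eventually_pos_of_hasDerivAt {f : ℝ → ℝ} {f' : ℝ} (hf : HasDerivAt f f' 0) (h0 : f 0 = 0)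
    (hf' : 0 < f') : ∀ᶠ t in nhdsWithin 0 (Set.Ioi 0), 0 < f t := by
  have h := hf.tendsto_slope_zero_right
  filter_upwards [h.eventually (lt_mem_nhds hf'), self_mem_nhdsWithin] with t ht ht0
  simp only [zero_add, h0, sub_zero, smul_eq_mul] at ht
  exact (pos_iff_pos_of_mul_pos ht).1 (inv_pos.2 ht0)

lemma cos_half_lt {a b : ℝ} (ha : 0 ≤ a) (hab : a < b) (hb : b ≤ 2 * Real.pi) :
    Real.cos (b / 2) < Real.cos (a / 2) :=
  Real.cos_lt_cos_of_nonneg_of_le_pi (by linarith) (by linarith) (by linarith)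

/-- Since a/2 < π − b/2, the cosine of a/2 exceeds −cos(b/2). -/
lemma cos_half_add_pos {a b : ℝ} (ha : 0 ≤ a) (hb : 0 ≤ b) (hab : a + b < 2 * Real.pi) :
    0 < Real.cos (a / 2) + Real.cos (b / 2) := by
  have h := Real.cos_lt_cos_of_nonneg_of_le_pi (x := a / 2) (y := Real.pi - b / 2) (by linarith)
    (by linarith) (by linarith)
  rw [Real.cos_pi_sub] at h
  linarith

/-- Two different angles can be made more equal: the chords get longer in total. -/
lemma exists_better_pair {a b ε : ℝ} (ha : 0 ≤ a) (hab : a < b) (hb : a + b ≤ 2 * Real.pi)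
    (hε : 0 < ε) : ∃ a' b', 0 ≤ a' ∧ 0 ≤ b' ∧ a' + b' = a + b ∧
      Real.sin a' + Real.sin b' < Real.sin a + Real.sin b + ε ∧
      Real.sin (a / 2) + Real.sin (b / 2) < Real.sin (a' / 2) + Real.sin (b' / 2) := by
  have h1 : ∀ᶠ t : ℝ in nhdsWithin 0 (Set.Ioi 0), t < b :=
    Filter.Eventually.filter_mono nhdsWithin_le_nhds (gt_mem_nhds (by linarith))
  have h2 : ∀ᶠ t : ℝ in nhdsWithin 0 (Set.Ioi 0),
      Real.sin (a + t) + Real.sin (b - t) < Real.sin a + Real.sin b + ε := by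
    refine Filter.Eventually.filter_mono nhdsWithin_le_nhds ?_
    have hc : ContinuousAt (fun t : ℝ => Real.sin (a + t) + Real.sin (b - t)) 0 := by fun_prop
    refine hc.eventually_lt continuousAt_const ?_
    simp only [add_zero, sub_zero]
    linarith
  have h3 : ∀ᶠ t : ℝ in nhdsWithin 0 (Set.Ioi 0),
      0 < Real.sin ((a + t) / 2) + Real.sin ((b - t) / 2)
        - (Real.sin (a / 2) + Real.sin (b / 2)) := by
    have d1 : HasDerivAt (fun t : ℝ => (a + t) / 2) (1 / 2) 0 :=
      ((hasDerivAt_id (0 : ℝ)).const_add a).div_const 2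
    have d2 : HasDerivAt (fun t : ℝ => (b - t) / 2) (-1 / 2) 0 :=
      ((hasDerivAt_id (0 : ℝ)).const_sub b).div_const 2
    refine eventually_pos_of_hasDerivAt ((d1.sin.add d2.sin).sub_const _) (by simp) ?_
    have := cos_half_lt ha hab (by linarith)
    simp only [add_zero, sub_zero]
    linarith
  obtain ⟨t, ht1, ht2, ht3, ht0⟩ := (h1.and (h2.and (h3.and self_mem_nhdsWithin))).exists
  have ht0 : 0 < t := ht0
  exact ⟨a + t, b - t, by linarith, by linarith, by ring, ht2, by linarith⟩

/-- Three positive angles, of which the largest is strictly larger than the other two, are not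
optimal: the chords can be made longer in total while the area does not grow. -/
lemma exists_better_triple {a b c : ℝ} (ha : 0 < a) (hab : a ≤ b) (hbc : b < c)
    (hs : a + b + c ≤ 2 * Real.pi) : ∃ a' b' c', 0 < a' ∧ 0 < b' ∧ 0 < c' ∧
      a' + b' + c' = a + b + c ∧
      Real.sin a' + Real.sin b' + Real.sin c' ≤ Real.sin a + Real.sin b + Real.sin c ∧
      Real.sin (a / 2) + Real.sin (b / 2) + Real.sin (c / 2) <
        Real.sin (a' / 2) + Real.sin (b' / 2) + Real.sin (c' / 2) := by
  have hcos : ∀ u : ℝ, Real.cos u = 2 * Real.cos (u / 2) ^ 2 - 1 := fun u => by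
    rw [← Real.cos_two_mul]; ring_nf
  -- a curve of triples along which the area decreases and the perimeter increases
  suffices h : ∃ p q r : ℝ → ℝ, p 0 = a ∧ q 0 = b ∧ r 0 = c ∧
      ContinuousAt p 0 ∧ ContinuousAt q 0 ∧ ContinuousAt r 0 ∧
      (∀ᶠ t in nhdsWithin 0 (Set.Ioi 0), p t + q t + r t = a + b + c) ∧
      (∀ᶠ t in nhdsWithin 0 (Set.Ioi 0), 0 < Real.sin a + Real.sin b + Real.sin c -
        (Real.sin (p t) + Real.sin (q t) + Real.sin (r t))) ∧
      (∀ᶠ t in nhdsWithin 0 (Set.Ioi 0), 0 <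
        Real.sin (p t / 2) + Real.sin (q t / 2) + Real.sin (r t / 2) -
        (Real.sin (a / 2) + Real.sin (b / 2) + Real.sin (c / 2))) by
    obtain ⟨p, q, r, rfl, rfl, rfl, hp, hq, hr, h1, h2, h3⟩ := h
    have hp := (hp.eventually (lt_mem_nhds ha)).filter_mono
      (nhdsWithin_le_nhds (s := Set.Ioi (0 : ℝ)))
    have hq := (hq.eventually (lt_mem_nhds (ha.trans_le hab))).filter_mono
      (nhdsWithin_le_nhds (s := Set.Ioi (0 : ℝ)))
    have hr := (hr.eventually (lt_mem_nhds (ha.trans_le (hab.trans hbc.le)))).filter_mono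
      (nhdsWithin_le_nhds (s := Set.Ioi (0 : ℝ)))
    obtain ⟨t, h1, h2, h3, h4, h5, h6⟩ :=
      (h1.and (h2.and (h3.and (hp.and (hq.and hr))))).exists
    exact ⟨p t, q t, r t, h4, h5, h6, h1, by linarith, by linarith⟩
  rcases hab.eq_or_lt with rfl | hab
  · -- two equal angles
    set x := Real.cos (a / 2) with hx
    set z := Real.cos (c / 2) with hz
    have hxz : z < x := cos_half_lt ha.le hbc (by linarith)
    have hxz' : 0 < x + z := cos_half_add_pos ha.le (by linarith) (by linarith)
    have hx0 : 0 < x := by linarith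
    set s := Real.sin (a / 2) with hsdef
    have hs0 : 0 < s := Real.sin_pos_of_pos_of_lt_pi (by linarith) (by linarith)
    have hsin : Real.sin a = 2 * s * x := by
      rw [hsdef, hx, ← Real.sin_two_mul]; ring_nf
    -- The step (τ, τ, −2τ) lengthens the chords but enlarges the area. Splitting the two equal
    -- angles by ±T with 1 − cos T = kτ reduces both sums, also at order τ. The area decreases if k
    -- exceeds the left side, and the chords still grow if k is below the right side; there is room
    -- between because x + z < 2x.
    have hlt : (x - z) * (x + z) / (s * x) < 2 * (x - z) / s := by
      rw [div_lt_div_iff₀ (by positivity) hs0]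
      have : 0 < (x - z) * s := mul_pos (by linarith) hs0
      nlinarith
    obtain ⟨k, hk1, hk2⟩ := exists_between hlt
    rw [div_lt_iff₀ (by positivity)] at hk1
    rw [lt_div_iff₀ hs0] at hk2
    have hk0 : 0 < k := by
      have : 0 < (x - z) * (x + z) := mul_pos (by linarith) hxz'
      by_contra hneg
      have : k * (s * x) ≤ 0 := mul_nonpos_of_nonpos_of_nonneg (not_lt.1 hneg) (by positivity)
      linarith
    -- T is of order √τ and not differentiable at 0, but the sums of sines involve it only through
    -- cos T = 1 − kτ and cos(T/2) = √(1 − kτ/2), which are differentiable.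
    let T : ℝ → ℝ := fun τ => Real.arccos (1 - k * τ)
    have hT0 : T 0 = 0 := by simp [T]
    have hTc : Continuous T := Real.continuous_arccos.comp (by fun_prop)
    have hsmall : ∀ᶠ τ : ℝ in nhdsWithin 0 (Set.Ioi 0), 0 < τ ∧ k * τ < 2 := by
      refine Filter.Eventually.and self_mem_nhdsWithin ?_
      refine Filter.Eventually.filter_mono nhdsWithin_le_nhds ?_
      have : ContinuousAt (fun τ : ℝ => k * τ) 0 := by fun_prop
      exact this.eventually_lt continuousAt_const (by simp)
    have hcosT : ∀ᶠ τ : ℝ in nhdsWithin 0 (Set.Ioi 0), Real.cos (T τ) = 1 - k * τ ∧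
        Real.cos (T τ / 2) = Real.sqrt (1 - k / 2 * τ) := by
      filter_upwards [hsmall] with τ hτ
      have h0 : 0 < k * τ := mul_pos hk0 hτ.1
      have h1 : Real.cos (T τ) = 1 - k * τ :=
        Real.cos_arccos (by linarith [hτ.2]) (by linarith)
      refine ⟨h1, ?_⟩
      have h2 : 0 ≤ T τ := Real.arccos_nonneg _
      have h3 : T τ ≤ Real.pi := Real.arccos_le_pi _
      rw [Real.cos_half (by linarith) h3, h1]
      congr 1
      ring
    refine ⟨fun τ => a + τ - T τ, fun τ => a + τ + T τ, fun τ => c - 2 * τ,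
      by simp [hT0], by simp [hT0], by simp, by fun_prop, by fun_prop, by fun_prop,
      Filter.Eventually.of_forall fun τ => by ring, ?_, ?_⟩
    · have hd : HasDerivAt (fun τ : ℝ => Real.sin a + Real.sin a + Real.sin c -
          (2 * Real.sin (a + τ) * (1 - k * τ) + Real.sin (c - 2 * τ)))
          (-(2 * Real.cos a - 2 * k * Real.sin a - 2 * Real.cos c)) 0 := by
        have d1 : HasDerivAt (fun τ : ℝ => a + τ) 1 0 := (hasDerivAt_id (0 : ℝ)).const_add a
        have d2 : HasDerivAt (fun τ : ℝ => 1 - k * τ) (-(k * 1)) 0 :=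
          ((hasDerivAt_id (0 : ℝ)).const_mul k).const_sub 1
        have d3 : HasDerivAt (fun τ : ℝ => c - 2 * τ) (-(2 * 1)) 0 :=
          ((hasDerivAt_id (0 : ℝ)).const_mul 2).const_sub c
        refine ((((d1.sin.const_mul 2).mul d2).add d3.sin).const_sub _).congr_deriv ?_
        simp only [add_zero, mul_zero, sub_zero]
        ring
      have hpos : 0 < -(2 * Real.cos a - 2 * k * Real.sin a - 2 * Real.cos c) := by
        rw [hcos a, hcos c, hsin, ← hx, ← hz]
        nlinarith
      filter_upwards [eventually_pos_of_hasDerivAt hd (by simp; ring) hpos, hcosT] with τ h1 h2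
      have e : Real.sin (a + τ - T τ) + Real.sin (a + τ + T τ) =
          2 * Real.sin (a + τ) * (1 - k * τ) := by
        rw [Real.sin_sub (a + τ), Real.sin_add (a + τ), h2.1]; ring
      rw [e]
      exact h1
    · have hd : HasDerivAt (fun τ : ℝ => 2 * Real.sin ((a + τ) / 2) * Real.sqrt (1 - k / 2 * τ)
          + Real.sin ((c - 2 * τ) / 2) -
          (Real.sin (a / 2) + Real.sin (a / 2) + Real.sin (c / 2)))
          (x - k / 2 * s - z) 0 := by
        have d1 : HasDerivAt (fun τ : ℝ => (a + τ) / 2) (1 / 2) 0 :=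
          ((hasDerivAt_id (0 : ℝ)).const_add a).div_const 2
        have d2 : HasDerivAt (fun τ : ℝ => 1 - k / 2 * τ) (-(k / 2 * 1)) 0 :=
          ((hasDerivAt_id (0 : ℝ)).const_mul (k / 2)).const_sub 1
        have d3 : HasDerivAt (fun τ : ℝ => (c - 2 * τ) / 2) (-(2 * 1) / 2) 0 :=
          (((hasDerivAt_id (0 : ℝ)).const_mul 2).const_sub c).div_const 2
        refine ((((d1.sin.const_mul 2).mul (d2.sqrt (by simp))).add d3.sin).sub_const
          _).congr_deriv ?_
        simp only [add_zero, mul_zero, sub_zero, Real.sqrt_one, ← hx, ← hz, ← hsdef]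
        ring
      have hpos : 0 < x - k / 2 * s - z := by linarith
      filter_upwards [eventually_pos_of_hasDerivAt hd (by simp; ring) hpos, hcosT] with τ h1 h2
      have e : Real.sin ((a + τ - T τ) / 2) + Real.sin ((a + τ + T τ) / 2) =
          2 * Real.sin ((a + τ) / 2) * Real.sqrt (1 - k / 2 * τ) := by
        rw [sub_div, add_div (a + τ), Real.sin_sub, Real.sin_add, h2.2]; ring
      rw [e]
      exact h1
  · -- three different angles
    set x := Real.cos (a / 2) with hx
    set y := Real.cos (b / 2) with hy
    set z := Real.cos (c / 2) with hz
    have hxy : y < x := cos_half_lt ha.le hab (by linarith)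
    have hyz : z < y := cos_half_lt (by linarith) hbc (by linarith)
    have hxz' : 0 < x + z := cos_half_add_pos ha.le (by linarith) (by linarith)
    have hP : 0 < (x - y) * (y - z) * (x - z) :=
      mul_pos (mul_pos (by linarith) (by linarith)) (by linarith)
    -- The direction (z² − y², x² − z², y² − x²) preserves the sum of the angles and, to first
    -- order, the area, while Σ sin(·/2) grows at half the rate (x − y)(y − z)(x − z). The
    -- correction ε(−1, 0, 1) makes the area strictly decrease; this ε spends half of the gain.
    set ε := (x - y) * (y - z) / 2 with hε
    have hε0 : 0 < ε := by
      have : 0 < (x - y) * (y - z) := mul_pos (by linarith) (by linarith)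
      positivity
    have dl : ∀ u v : ℝ, HasDerivAt (fun t : ℝ => u + v * t) v 0 := fun u v => by
      have := ((hasDerivAt_id (0 : ℝ)).const_mul v).const_add u
      simpa using this
    refine ⟨fun t => a + (z ^ 2 - y ^ 2 - ε) * t, fun t => b + (x ^ 2 - z ^ 2) * t,
      fun t => c + (y ^ 2 - x ^ 2 + ε) * t, by simp, by simp, by simp,
      by fun_prop, by fun_prop, by fun_prop, Filter.Eventually.of_forall fun τ => by ring,
      ?_, ?_⟩
    · refine eventually_pos_of_hasDerivAt
        (((((dl _ _).sin.add (dl _ _).sin).add (dl _ _).sin)).const_sub _) (by simp) ?_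
      simp only [mul_zero, add_zero]
      rw [hcos a, hcos b, hcos c, ← hx, ← hy, ← hz]
      have : 0 < ε * ((x - z) * (x + z)) := by
        have : 0 < x - z := by linarith
        positivity
      nlinarith
    · refine eventually_pos_of_hasDerivAt
        ((((((dl _ _).div_const 2).sin.add ((dl _ _).div_const 2).sin).add
        ((dl _ _).div_const 2).sin)).sub_const _) (by simp) ?_
      simp only [mul_zero, add_zero]
      rw [← hx, ← hy, ← hz]
      have e : ε * (x - z) = (x - y) * (y - z) * (x - z) / 2 := by rw [hε]; ring
      nlinarith

section replacement
variable {ι : Type*} [Fintype ι] [DecidableEq ι]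

lemma sum_update_update (f : ℝ → ℝ) (θ : ι → ℝ) {i j : ι} (hij : i ≠ j) (a b : ℝ) :
    ∑ x, f (Function.update (Function.update θ i a) j b x) =
      ∑ x, f (θ x) + (f a + f b - f (θ i) - f (θ j)) := by
  have h : ∀ x, f (Function.update (Function.update θ i a) j b x) = f (θ x) +
      ((if x = i then f a - f (θ i) else 0) + (if x = j then f b - f (θ j) else 0)) := by
    intro x
    by_cases hj : x = j
    · subst hj
      simp [hij.symm]
    · by_cases hi : x = i
      · subst hi
        simp [hj]
      · simp [hi, hj]
  simp_rw [h, Finset.sum_add_distrib, Finset.sum_ite_eq', Finset.mem_univ, if_true]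
  ring

lemma sum_update_update_update (f : ℝ → ℝ) (θ : ι → ℝ) {i j k : ι} (hij : i ≠ j) (hik : i ≠ k)
    (hjk : j ≠ k) (a b c : ℝ) :
    ∑ x, f (Function.update (Function.update (Function.update θ i a) j b) k c x) =
      ∑ x, f (θ x) + (f a + f b + f c - f (θ i) - f (θ j) - f (θ k)) := by
  have h : ∀ x, f (Function.update (Function.update (Function.update θ i a) j b) k c x) = f (θ x) +
      ((if x = i then f a - f (θ i) else 0) + (if x = j then f b - f (θ j) else 0) +
      (if x = k then f c - f (θ k) else 0)) := by
    intro x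
    by_cases hk : x = k
    · subst hk
      simp [hik.symm, hjk.symm]
    by_cases hj : x = j
    · subst hj
      simp [hij.symm, hk]
    · by_cases hi : x = i
      · subst hi
        simp [hj, hk]
      · simp [hi, hj, hk]
  simp_rw [h, Finset.sum_add_distrib, Finset.sum_ite_eq', Finset.mem_univ, if_true]
  ring

end replacement

/-! ### Optimal angles among finitely many -/

/-- The tuples of nonnegative central angles of inscribed polygons of area at most `A`. -/
def angleClass (ι : Type*) [Fintype ι] (A : ℝ) : Set (ι → ℝ) :=
  {θ | (∀ i, 0 ≤ θ i) ∧ ∑ i, θ i = 2 * Real.pi ∧ ∑ i, Real.sin (θ i) ≤ 2 * A}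

/-- Zero angles are admitted for the sake of this compactness; polygons with fewer sides appear
padded with zeros. -/
lemma isCompact_angleClass (ι : Type*) [Fintype ι] (A : ℝ) : IsCompact (angleClass ι A) := by
  refine (isCompact_univ_pi fun _ : ι => isCompact_Icc (a := (0 : ℝ)) (b := 2 * Real.pi)).of_isClosed_subset
    ?_ ?_
  · have h1 : IsClosed {θ : ι → ℝ | ∀ i, 0 ≤ θ i} := by
      simp only [Set.ofPred_forall]
      exact isClosed_iInter fun i => isClosed_le continuous_const (continuous_apply i)
    exact h1.inter ((isClosed_eq (f := fun θ : ι → ℝ => ∑ i, θ i) (by fun_prop) continuous_const).inter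
      (isClosed_le (f := fun θ : ι → ℝ => ∑ i, Real.sin (θ i)) (by fun_prop) continuous_const))
  · intro θ hθ i _
    exact ⟨hθ.1 i, hθ.2.1 ▸ Finset.single_le_sum (fun j _ => hθ.1 j) (Finset.mem_univ i)⟩

section structure_of_maximizers
variable {ι : Type*} [Fintype ι] {A : ℝ} {θ : ι → ℝ}

lemma add_le_of_mem_angleClass (hθ : θ ∈ angleClass ι A) {i j : ι} (hij : i ≠ j) :
    θ i + θ j ≤ 2 * Real.pi := by
  classical
  rw [← hθ.2.1, ← Finset.sum_pair hij]
  exact Finset.sum_le_sum_of_subset_of_nonneg (Finset.subset_univ _) fun x _ _ => hθ.1 x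

lemma add_add_le_of_mem_angleClass (hθ : θ ∈ angleClass ι A) {i j k : ι} (hij : i ≠ j)
    (hik : i ≠ k) (hjk : j ≠ k) : θ i + θ j + θ k ≤ 2 * Real.pi := by
  classical
  have : ∑ x ∈ {i, j, k}, θ x = θ i + θ j + θ k := by
    rw [Finset.sum_insert (by simp [hij, hik]), Finset.sum_pair hjk, add_assoc]
  rw [← hθ.2.1, ← this]
  exact Finset.sum_le_sum_of_subset_of_nonneg (Finset.subset_univ _) fun x _ _ => hθ.1 x

/-- A slack area bound leaves room for the equalizing move, which changes the area by as little as
desired. -/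
lemma eq_of_isMaxOn_of_lt (hθ : θ ∈ angleClass ι A)
    (hmax : IsMaxOn (fun θ : ι → ℝ => ∑ i, Real.sin (θ i / 2)) (angleClass ι A) θ)
    (hlt : ∑ i, Real.sin (θ i) < 2 * A) (i j : ι) : θ i = θ j := by
  classical
  have key : ∀ i j, ¬ θ i < θ j := by
    intro i j hlt'
    have hij : i ≠ j := by rintro rfl; exact lt_irrefl _ hlt'
    obtain ⟨a, b, ha, hb, hab, h1, h2⟩ := exists_better_pair (hθ.1 i) hlt'
      (add_le_of_mem_angleClass hθ hij) (sub_pos.2 hlt)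
    have hmem : Function.update (Function.update θ i a) j b ∈ angleClass ι A := by
      refine ⟨fun x => ?_, ?_, ?_⟩
      · by_cases hj : x = j
        · subst hj; simpa using hb
        · by_cases hi : x = i
          · subst hi; simpa [hj] using ha
          · simpa [hi, hj] using hθ.1 x
      · rw [sum_update_update (fun x => x) θ hij, hθ.2.1]; linarith
      · rw [sum_update_update Real.sin θ hij]; linarith
    have := hmax hmem
    simp only [Set.mem_ofPred_eq] at this
    rw [sum_update_update (fun x => Real.sin (x / 2)) θ hij] at this
    linarith
  exact le_antisymm (not_lt.1 (key j i)) (not_lt.1 (key i j))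

/-- Otherwise the triple move would apply. The smallest angle has to be positive because the move
may shrink it. -/
lemma not_lt_of_isMaxOn (hθ : θ ∈ angleClass ι A)
    (hmax : IsMaxOn (fun θ : ι → ℝ => ∑ i, Real.sin (θ i / 2)) (angleClass ι A) θ)
    {i j k : ι} (hij : i ≠ j) (hi : 0 < θ i) (hle : θ i ≤ θ j) : ¬ θ j < θ k := by
  classical
  intro hlt
  have hjk : j ≠ k := by rintro rfl; exact lt_irrefl _ hlt
  have hik : i ≠ k := by rintro rfl; exact (hle.trans_lt hlt).false
  obtain ⟨a, b, c, ha, hb, hc, habc, h1, h2⟩ := exists_better_triple hi hle hlt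
    (add_add_le_of_mem_angleClass hθ hij hik hjk)
  have hmem : Function.update (Function.update (Function.update θ i a) j b) k c ∈
      angleClass ι A := by
    refine ⟨fun x => ?_, ?_, ?_⟩
    · by_cases hk : x = k
      · subst hk; simpa using hc.le
      · by_cases hj : x = j
        · subst hj; simpa [hk] using hb.le
        · by_cases hi : x = i
          · subst hi; simpa [hj, hk] using ha.le
          · simpa [hi, hj, hk] using hθ.1 x
    · rw [sum_update_update_update (fun x => x) θ hij hik hjk, hθ.2.1]; linarith
    · rw [sum_update_update_update Real.sin θ hij hik hjk]; linarith [hθ.2.2]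
  have := hmax hmem
  simp only [Set.mem_ofPred_eq] at this
  rw [sum_update_update_update (fun x => Real.sin (x / 2)) θ hij hik hjk] at this
  linarith

end structure_of_maximizers

/-- For b > 0 the inequality b < 2π/(q + 1) places 2A strictly between the extreme values of the
area of (q + 1)-gons of this shape, which forces q + 1 = m. The value b = 0 stands for an absent
angle: the polygon is the regular q-gon, 2A is the upper bound for q sides, and θ₁ = c is the
boundary case 2π/m. -/
lemma eq_of_replicate_area {A : ℝ} (hA : 0 < A) {m : ℕ} (hm : 3 ≤ m)
    (hs : SideCountCondition A m) {q : ℕ} {b c : ℝ} (hb : 0 ≤ b) (hbc : b < c)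
    (hsum : b + q * c = 2 * Real.pi) (hsin : Real.sin b + q * Real.sin c = 2 * A) :
    (0 < b ∧ q + 1 = m ∧ SmallAngleCondition A m b) ∨
      (b = 0 ∧ q = m ∧ SmallAngleCondition A m c) := by
  have hπ := Real.pi_pos
  -- With q = 0 the only angle is 2π, with q = 1 the two sines cancel; both contradict A > 0.
  have hq2 : 2 ≤ q := by
    by_contra hlt
    have : q = 0 ∨ q = 1 := by omega
    rcases this with rfl | rfl
    · have : b = 2 * Real.pi := by simpa using hsum
      rw [this] at hsin
      norm_num at hsin
      linarith
    · have : c = 2 * Real.pi - b := by push_cast at hsum; linarith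
      rw [this, Real.sin_two_pi_sub] at hsin
      push_cast at hsin
      linarith
  have hqR : (2 : ℝ) ≤ q := by exact_mod_cast hq2
  have hc : c = (2 * Real.pi - b) / q := by field_simp; linarith
  rcases hb.eq_or_lt with rfl | hb
  · right
    have hc' : c = 2 * Real.pi / q := by rw [hc, sub_zero]
    have hq3 : 3 ≤ q := by
      by_contra hlt
      obtain rfl : q = 2 := by omega
      rw [hc'] at hsin
      norm_num at hsin
      linarith
    have hq3R : (3 : ℝ) ≤ q := by exact_mod_cast hq3
    have hsc : SideCountCondition A q := by
      rw [Real.sin_zero, zero_add, hc'] at hsin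
      refine ⟨?_, hsin.ge⟩
      rw [← hsin]
      exact regular_area_strictMono (by linarith) (by linarith)
    obtain rfl := sideCountCondition_unique (by omega) (by omega) hsc hs
    refine ⟨rfl, rfl, by linarith, hc'.le, ?_⟩
    have h1 : (2 * Real.pi - c) / ((q : ℝ) - 1) = c := by
      have : (q : ℝ) - 1 ≠ 0 := by linarith
      field_simp
      linarith
    rw [h1, ← hsin, Real.sin_zero]
    ring
  · left
    have hb1 : b < 2 * Real.pi / ((q + 1 : ℕ) : ℝ) := by
      push_cast
      rw [lt_div_iff₀ (by linarith)]
      nlinarith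
    have hF : Real.sin b + (((q + 1 : ℕ) : ℝ) - 1) *
        Real.sin ((2 * Real.pi - b) / (((q + 1 : ℕ) : ℝ) - 1)) = 2 * A := by
      push_cast
      rw [add_sub_cancel_right, ← hc, hsin]
    have hmono := smallAngle_strictMonoOn (m := q + 1) (by omega)
    have hsc : SideCountCondition A (q + 1) := by
      constructor
      · rw [← hF]
        have := hmono (a := 0) ⟨le_rfl, by positivity⟩ ⟨hb.le, hb1.le⟩ hb
        simpa using this
      · rw [← hF]
        have h := hmono ⟨hb.le, hb1.le⟩ ⟨by positivity, le_rfl⟩ hb1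
        refine h.le.trans_eq ?_
        have h1 : (2 * Real.pi - 2 * Real.pi / ((q + 1 : ℕ) : ℝ)) / (((q + 1 : ℕ) : ℝ) - 1) =
            2 * Real.pi / ((q + 1 : ℕ) : ℝ) := by
          push_cast
          rw [add_sub_cancel_right]
          field_simp
          ring
        simp only [h1]
        push_cast
        ring
    obtain rfl := sideCountCondition_unique (by omega) (by omega) hsc hs
    exact ⟨hb, rfl, hb, hb1.le, hF⟩

section finite_problem
variable {A θ₁ θ₂ : ℝ} {m : ℕ}

/-- Discarding the zeros makes the answer independent of how many angles are available. With at
least m of them, equal angles would give area at least A, so the area bound cannot be slack. The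
nonzero angles are then the set `Q` of largest ones and, by the triple move, a set `R` of at most
one smaller angle. -/
lemma filter_eq_of_isMaxOn (hA : 0 < A) (hm : 3 ≤ m) (hs : SideCountCondition A m)
    (h1 : SmallAngleCondition A m θ₁) (h2 : θ₁ + ((m : ℝ) - 1) * θ₂ = 2 * Real.pi)
    {ι : Type*} [Fintype ι] (hι : m ≤ Fintype.card ι) {θ : ι → ℝ} (hθ : θ ∈ angleClass ι A)
    (hmax : IsMaxOn (fun θ : ι → ℝ => ∑ i, Real.sin (θ i / 2)) (angleClass ι A) θ) :
    (Finset.univ.val.map θ).filter (· ≠ 0) = θ₁ ::ₘ Multiset.replicate (m - 1) θ₂ := by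
  classical
  have hπ := Real.pi_pos
  have hm3 : (3 : ℝ) ≤ m := by exact_mod_cast hm
  have hne : Nonempty ι := Fintype.card_pos_iff.1 (by omega)
  -- the area constraint is active
  have harea : ∑ i, Real.sin (θ i) = 2 * A := by
    refine le_antisymm hθ.2.2 (not_lt.1 fun hlt => ?_)
    have heq := eq_of_isMaxOn_of_lt hθ hmax hlt
    obtain ⟨i₀⟩ := hne
    have h3 : ∀ i, θ i = θ i₀ := fun i => heq i i₀
    have hsum := hθ.2.1
    simp_rw [h3, Finset.sum_const, nsmul_eq_mul, Finset.card_univ] at hsum hlt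
    have hN : (m : ℝ) ≤ Fintype.card ι := by exact_mod_cast hι
    have h4 : θ i₀ = 2 * Real.pi / Fintype.card ι := by
      have : (Fintype.card ι : ℝ) ≠ 0 := by linarith
      field_simp
      linarith
    rw [h4] at hlt
    have := regular_area_mono (by linarith) hN
    linarith [hs.2]
  -- the largest angle
  obtain ⟨k, hk⟩ := Finite.exists_max θ
  set c := θ k with hc
  have hc0 : 0 < c := by
    by_contra hneg
    have : ∀ i, θ i = 0 := fun i => le_antisymm ((hk i).trans (not_lt.1 hneg)) (hθ.1 i)
    have h0 := hθ.2.1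
    simp [this] at h0
  have hone : ∀ i j, 0 < θ i → θ i < c → 0 < θ j → θ j < c → i = j := by
    intro i j hi hic hj hjc
    by_contra hij
    rcases le_total (θ i) (θ j) with h | h
    · exact not_lt_of_isMaxOn hθ hmax hij hi h hjc
    · exact not_lt_of_isMaxOn hθ hmax (Ne.symm hij) hj h hic
  set Q := Finset.univ.filter fun i => θ i = c with hQ
  set R := Finset.univ.filter fun i => θ i ≠ c ∧ θ i ≠ 0 with hR
  have hRc : R.card ≤ 1 := by
    rw [Finset.card_le_one]
    intro i hi j hj
    simp only [hR, Finset.mem_filter, Finset.mem_univ, true_and] at hi hj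
    exact hone i j (lt_of_le_of_ne (hθ.1 i) hi.2.symm) (lt_of_le_of_ne (hk i) hi.1)
      (lt_of_le_of_ne (hθ.1 j) hj.2.symm) (lt_of_le_of_ne (hk j) hj.1)
  have hfilter : (Finset.univ.filter fun i => θ i ≠ 0) = R ∪ Q := by
    ext i
    simp only [hR, hQ, Finset.mem_filter, Finset.mem_univ, true_and, Finset.mem_union]
    constructor
    · intro h
      by_cases h' : θ i = c
      · exact Or.inr h'
      · exact Or.inl ⟨h', h⟩
    · rintro (h | h)
      · exact h.2
      · rw [h]; exact hc0.ne'
  have hdisj : Disjoint R Q := by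
    rw [Finset.disjoint_left]
    intro i hi hi'
    simp only [hR, hQ, Finset.mem_filter, Finset.mem_univ, true_and] at hi hi'
    exact hi.1 hi'
  have hsumf : ∀ f : ℝ → ℝ, f 0 = 0 → ∑ i, f (θ i) = ∑ i ∈ R, f (θ i) + Q.card * f c := by
    intro f hf
    have e : ∑ i, f (θ i) = ∑ i ∈ Finset.univ.filter (fun i => θ i ≠ 0), f (θ i) := by
      refine (Finset.sum_subset (Finset.filter_subset _ _) fun i _ hi => ?_).symm
      have : θ i = 0 := by simpa using hi
      rw [this, hf]
    rw [e, hfilter, Finset.sum_union hdisj]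
    congr 1
    rw [Finset.sum_congr rfl (g := fun _ => f c), Finset.sum_const, nsmul_eq_mul]
    intro i hi
    simp only [hQ, Finset.mem_filter] at hi
    rw [hi.2]
  have hmultiset : (Finset.univ.val.map θ).filter (· ≠ 0) =
      R.val.map θ + Multiset.replicate Q.card c := by
    rw [Multiset.filter_map]
    have : Multiset.filter ((fun x => x ≠ 0) ∘ θ) Finset.univ.val = (R ∪ Q).val := by
      rw [← hfilter]; rfl
    rw [this, ← Finset.disjUnion_eq_union _ _ hdisj]
    change Multiset.map θ (R.val + Q.val) = _
    rw [Multiset.map_add]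
    congr 1
    rw [Multiset.eq_replicate]
    refine ⟨by simp, fun x hx => ?_⟩
    obtain ⟨i, hi, rfl⟩ := Multiset.mem_map.1 hx
    have hi' : i ∈ Q := hi
    simp only [hQ, Finset.mem_filter] at hi'
    exact hi'.2
  have hs1 := hsumf (fun x => x) rfl
  have hs2 := hsumf Real.sin Real.sin_zero
  rw [hθ.2.1] at hs1
  rw [harea] at hs2
  have hm1 : (m : ℝ) - 1 ≠ 0 := by linarith
  have hθ₂ : θ₂ = (2 * Real.pi - θ₁) / ((m : ℝ) - 1) := by field_simp; linarith
  rw [hmultiset]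
  rcases Nat.le_one_iff_eq_zero_or_eq_one.1 hRc with h0 | h0
  · have hRe : R = ∅ := Finset.card_eq_zero.1 h0
    rw [hRe, Finset.sum_empty] at hs1 hs2
    rcases eq_of_replicate_area hA hm hs le_rfl hc0 hs1.symm
      (by rw [Real.sin_zero]; exact hs2.symm) with h | ⟨_, hq, hsm⟩
    · exact absurd h.1 (lt_irrefl _)
    · have e1 : c = θ₁ := smallAngleCondition_unique hm hsm h1
      have e2 : θ₂ = c := by
        rw [hθ₂, ← e1]
        rw [hq] at hs1
        field_simp
        linarith
      rw [hRe, e2, ← e1, ← Multiset.replicate_succ, hq]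
      simp only [Finset.empty_val, Multiset.map_zero, zero_add]
      congr 1
      omega
  · obtain ⟨i, hi⟩ := Finset.card_eq_one.1 h0
    rw [hi, Finset.sum_singleton] at hs1 hs2
    have hiR : i ∈ R := by rw [hi]; simp
    simp only [hR, Finset.mem_filter, Finset.mem_univ, true_and] at hiR
    have hi0 : 0 < θ i := lt_of_le_of_ne (hθ.1 i) hiR.2.symm
    rcases eq_of_replicate_area hA hm hs hi0.le (lt_of_le_of_ne (hk i) hiR.1) hs1.symm
      hs2.symm with ⟨_, hq, hsm⟩ | h
    · have e1 : θ i = θ₁ := smallAngleCondition_unique hm hsm h1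
      have hqR : (Q.card : ℝ) = (m : ℝ) - 1 := by rw [← hq]; push_cast; ring
      have e2 : c = θ₂ := by
        rw [hθ₂, ← e1]
        rw [hqR] at hs1
        field_simp
        linarith
      have e3 : Q.card = m - 1 := by omega
      rw [hi, e3, e2, ← e1]
      simp
    · exact absurd h.1 hi0.ne'

lemma sum_map_filter_ne_zero {ι : Type*} [Fintype ι] (θ : ι → ℝ) {f : ℝ → ℝ} (hf : f 0 = 0) :
    (((Finset.univ.val.map θ).filter (· ≠ 0)).map f).sum = ∑ i, f (θ i) := by
  classical
  have h : ∀ s : Multiset ℝ, ((s.filter (· ≠ 0)).map f).sum = (s.map f).sum := by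
    intro s
    induction s using Multiset.induction with
    | empty => simp
    | cons a s ih =>
      by_cases ha : a = 0
      · subst ha
        rw [Multiset.filter_cons_of_neg _ (by simp), ih]
        simp [hf]
      · rw [Multiset.filter_cons_of_pos (p := fun x : ℝ => x ≠ 0) _ ha]
        simp [ih]
  rw [h, Multiset.map_map]
  rfl

/-- Among the inscribed polygons of area at most `A`, the one with angles `θ₁, θ₂, …, θ₂` has the
largest perimeter. -/
lemma sum_sin_half_le (hA : 0 < A) (hm : 3 ≤ m) (hs : SideCountCondition A m)
    (h1 : SmallAngleCondition A m θ₁) (h2 : θ₁ + ((m : ℝ) - 1) * θ₂ = 2 * Real.pi)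
    {ι : Type*} [Fintype ι] {θ : ι → ℝ} (hθ : θ ∈ angleClass ι A) :
    ∑ i, Real.sin (θ i / 2) ≤ Real.sin (θ₁ / 2) + ((m : ℝ) - 1) * Real.sin (θ₂ / 2) ∧
    (∑ i, Real.sin (θ i / 2) = Real.sin (θ₁ / 2) + ((m : ℝ) - 1) * Real.sin (θ₂ / 2) →
      (Finset.univ.val.map θ).filter (· ≠ 0) = θ₁ ::ₘ Multiset.replicate (m - 1) θ₂) := by
  classical
  -- Padding by m zeros guarantees enough room for m sides and changes neither the sums nor the
  -- nonzero angles.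
  let η : ι ⊕ Fin m → ℝ := Sum.elim θ fun _ => 0
  have hsum : ∀ f : ℝ → ℝ, f 0 = 0 → ∑ i, f (η i) = ∑ i, f (θ i) := by
    intro f hf
    simp [η, hf]
  have hη : η ∈ angleClass (ι ⊕ Fin m) A := by
    refine ⟨?_, by rw [hsum (fun x => x) rfl, hθ.2.1],
      by rw [hsum _ Real.sin_zero]; exact hθ.2.2⟩
    rintro (i | i)
    · exact hθ.1 i
    · exact le_rfl
  have hcard : m ≤ Fintype.card (ι ⊕ Fin m) := by simp
  have hfη : (Finset.univ.val.map η).filter (· ≠ 0) = (Finset.univ.val.map θ).filter (· ≠ 0) := by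
    have : (Finset.univ : Finset (ι ⊕ Fin m)).val.map η =
        (Finset.univ : Finset ι).val.map θ + Multiset.replicate m 0 := by
      rw [← Finset.univ_disjSum_univ, Finset.val_disjSum, Multiset.disjSum, Multiset.map_add]
      simp [η, Multiset.map_map, Function.comp_def, Multiset.coe_replicate]
    rw [this, Multiset.filter_add]
    simp [Multiset.filter_eq_nil, Multiset.mem_replicate]
  obtain ⟨θs, hθs, hmax⟩ := (isCompact_angleClass (ι ⊕ Fin m) A).exists_isMaxOn ⟨η, hη⟩
    (f := fun θ : ι ⊕ Fin m → ℝ => ∑ i, Real.sin (θ i / 2)) (by fun_prop)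
  have hval : ∑ i, Real.sin (θs i / 2) =
      Real.sin (θ₁ / 2) + ((m : ℝ) - 1) * Real.sin (θ₂ / 2) := by
    have h := filter_eq_of_isMaxOn hA hm hs h1 h2 hcard hθs hmax
    rw [← sum_map_filter_ne_zero θs (f := fun x => Real.sin (x / 2)) (by simp), h]
    simp only [Multiset.map_cons, Multiset.map_replicate, Multiset.sum_cons,
      Multiset.sum_replicate, nsmul_eq_mul]
    rw [Nat.cast_sub (by omega), Nat.cast_one]
  have e := hsum (fun x => Real.sin (x / 2)) (by simp)
  constructor
  · rw [← hval, ← e]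
    exact hmax hη
  · intro heq
    rw [← hfη]
    refine filter_eq_of_isMaxOn hA hm hs h1 h2 hcard hη fun x hx => ?_
    simp only [Set.mem_ofPred_eq]
    rw [e, heq, ← hval]
    exact hmax hx

end finite_problem

/-- Among the inscribed polygons with at most `n` sides the regular `n`-gon has the largest
perimeter. -/
lemma sum_sin_half_le_regular {n : ℕ} (hn : 3 ≤ n) {k : ℕ} (hk : 1 ≤ k) (hkn : k ≤ n)
    {θ : Fin k → ℝ} (h0 : ∀ i, 0 ≤ θ i) (hsum : ∑ i, θ i = 2 * Real.pi) :
    ∑ i, Real.sin (θ i / 2) ≤ n * Real.sin (Real.pi / n) ∧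
    (∑ i, Real.sin (θ i / 2) = n * Real.sin (Real.pi / n) →
      Finset.univ.val.map θ = Multiset.replicate n (2 * Real.pi / n)) := by
  have hπ := Real.pi_pos
  have hkR : (1 : ℝ) ≤ k := by exact_mod_cast hk
  have hw : ∑ _i : Fin k, (1 / (k : ℝ)) = 1 := by simp; field_simp
  have hmem : ∀ i ∈ (Finset.univ : Finset (Fin k)), θ i / 2 ∈ Set.Icc 0 Real.pi := fun i _ =>
    ⟨by linarith [h0 i], by
      have := Finset.single_le_sum (fun j _ => h0 j) (Finset.mem_univ i)
      linarith⟩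
  -- Jensen for the sine at the half angles, which lie in [0, π]; strict concavity yields the
  -- equality case.
  have hJ := strictConcaveOn_sin_Icc.concaveOn.le_map_sum (t := Finset.univ)
    (w := fun _ => 1 / (k : ℝ)) (p := fun i => θ i / 2) (fun _ _ => by positivity) hw hmem
  have he := strictConcaveOn_sin_Icc.map_sum_eq_iff (t := Finset.univ)
    (w := fun _ => 1 / (k : ℝ)) (p := fun i => θ i / 2) (fun _ _ => by positivity) hw hmem
  simp only [smul_eq_mul, ← Finset.mul_sum, ← Finset.sum_div] at hJ he
  have hpk : 1 / (k : ℝ) * ((∑ i, θ i) / 2) = Real.pi / k := by rw [hsum]; field_simp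
  rw [hpk] at hJ he
  have h1 : ∑ i, Real.sin (θ i / 2) ≤ k * Real.sin (Real.pi / k) := by
    rw [one_div_mul_eq_div, div_le_iff₀ (by linarith)] at hJ
    linarith
  -- Because k sin(π/k) increases strictly with k, a polygon with fewer than n sides never attains
  -- equality.
  have h2 : k < n → k * Real.sin (Real.pi / k) < n * Real.sin (Real.pi / n) := by
    intro hlt
    have hltR : (k : ℝ) < n := by exact_mod_cast hlt
    have h := mul_sin_lt_mul_sin (x := Real.pi / n) (y := Real.pi / k) (by positivity)
      (by gcongr) (div_le_self hπ.le hkR)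
    have hk0 : (0 : ℝ) < k := by linarith
    have hn0 : (0 : ℝ) < n := by linarith
    rw [div_mul_eq_mul_div, div_mul_eq_mul_div, div_lt_div_iff₀ hn0 hk0] at h
    nlinarith
  rcases hkn.lt_or_eq with hlt | rfl
  · exact ⟨(h1.trans_lt (h2 hlt)).le, fun h => absurd h (h1.trans_lt (h2 hlt)).ne⟩
  · refine ⟨h1, fun h => ?_⟩
    rw [Multiset.eq_replicate]
    refine ⟨by simp, fun x hx => ?_⟩
    obtain ⟨i, _, rfl⟩ := Multiset.mem_map.1 hx
    have hk0 : (k : ℝ) ≠ 0 := by linarith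
    have := he.1 (by rw [h]; field_simp) i (Finset.mem_univ i)
    field_simp at this ⊢
    linarith

/-! ### Disks with infinitely many caps removed -/

/-- Only the order matters: an arc of length r cut into n equal pieces has total excess at most
r³/n². -/
lemma capExcess_le_cube {x : ℝ} (hx : 0 ≤ x) : capExcess x ≤ x ^ 3 := by
  rcases hx.eq_or_lt with rfl | hx
  · simp [capExcess]
  have := Real.sin_gt_sub_cube (x := x / 2) (by linarith)
  unfold capExcess
  have h3 : 0 < x ^ 3 := by positivity
  nlinarith

lemma capArea_le {x : ℝ} (hx : 0 ≤ x) : capArea x ≤ x := by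
  have := neg_le_of_abs_le ((Real.abs_sin_le_abs (x := x)).trans_eq (abs_of_nonneg hx))
  unfold capArea
  linarith

section infinite_problem
variable {A θ₁ θ₂ : ℝ} {m : ℕ}

lemma summable_capArea {ι : Type*} {g : ι → ℝ} (hg : ∀ i, 0 ≤ g i) (hs : Summable g) :
    Summable fun i => capArea (g i) :=
  Summable.of_nonneg_of_le (fun i => by
    rcases (hg i).eq_or_lt with h | h
    · rw [← h, capArea_zero]
    · exact (capArea_pos h).le) (fun i => capArea_le (hg i)) hs

lemma summable_capExcess {ι : Type*} {g : ι → ℝ} (hg : ∀ i, 0 ≤ g i) (hs : Summable g)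
    (ht : ∑' i, g i ≤ 2 * Real.pi) : Summable fun i => capExcess (g i) :=
  Summable.of_nonneg_of_le (fun i => capExcess_nonneg (hg i))
    (fun i => capExcess_le (hg i) ((hs.le_tsum i fun j _ => hg j).trans ht)) hs

/-- The sets that are obtained from the disk by cutting off (possibly infinitely many) caps do not
have larger perimeter than the optimal polygon. -/
lemma two_pi_sub_tsum_capExcess_le (hA : 0 < A) (hm : 3 ≤ m) (hs : SideCountCondition A m)
    (h1 : SmallAngleCondition A m θ₁) (h2 : θ₁ + ((m : ℝ) - 1) * θ₂ = 2 * Real.pi)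
    {ι : Type*} {g : ι → ℝ} (hg : ∀ i, 0 ≤ g i) (hsum : Summable g)
    (htot : ∑' i, g i ≤ 2 * Real.pi) (harea : Real.pi - A ≤ ∑' i, capArea (g i)) :
    2 * Real.pi - ∑' i, capExcess (g i) ≤
      2 * (Real.sin (θ₁ / 2) + ((m : ℝ) - 1) * Real.sin (θ₂ / 2)) := by
  classical
  have hπ := Real.pi_pos
  have hca : ∀ x, 0 ≤ x → 0 ≤ capArea x := fun x hx => by
    rcases hx.eq_or_lt with h | h
    · rw [← h, capArea_zero]
    · exact (capArea_pos h).le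
  refine le_of_forall_pos_le_add fun ε hε => ?_
  set r := 2 * Real.pi - ∑' i, g i with hr
  have hr0 : 0 ≤ r := by linarith
  -- The tail beyond `s` gets length τ at most ε/2, which bounds its excess, and at most π, where
  -- capArea x / x is monotone.
  obtain ⟨s, hsε⟩ : ∃ s : Finset ι, ∑' i, g i - ∑ i ∈ s, g i < min (ε / 2) Real.pi := by
    have h := hsum.hasSum.eventually (lt_mem_nhds
      (show ∑' i, g i - min (ε / 2) Real.pi < ∑' i, g i by
        have : 0 < min (ε / 2) Real.pi := lt_min (by linarith) hπ
        linarith))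
    obtain ⟨s, hs⟩ := h.exists
    exact ⟨s, by linarith⟩
  set τ := ∑' i, g i - ∑ i ∈ s, g i with hτ
  have hτ0 : 0 ≤ τ := sub_nonneg.2 (hsum.sum_le_tsum s fun i _ => hg i)
  have hτπ : τ ≤ Real.pi := (hsε.trans_le (min_le_right _ _)).le
  have hτε : τ ≤ ε / 2 := (hsε.trans_le (min_le_left _ _)).le
  obtain ⟨n, hn1, hnε⟩ : ∃ n : ℕ, 1 ≤ n ∧ r ^ 3 / n ≤ ε / 2 := by
    obtain ⟨n, hn⟩ := exists_nat_ge (max 1 (r ^ 3 / (ε / 2)))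
    have e1 : (1 : ℝ) ≤ n := (le_max_left _ _).trans hn
    have e3 : r ^ 3 / (ε / 2) ≤ n := (le_max_right _ _).trans hn
    refine ⟨n, by exact_mod_cast e1, ?_⟩
    rw [div_le_iff₀ (by linarith)] at e3 ⊢
    linarith
  have hnR : (1 : ℝ) ≤ n := by exact_mod_cast hn1
  -- A finite competitor: the gaps in `s`, one angle τ for the whole tail, and the uncovered part r
  -- of the circle cut into n equal angles. It is admissible for `sum_sin_half_le` and loses at most
  -- ε of the length.
  let η : s ⊕ (Unit ⊕ Fin n) → ℝ :=
    Sum.elim (fun i => g i) (Sum.elim (fun _ => τ) fun _ => r / n)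
  have hη : ∀ f : ℝ → ℝ, ∑ i, f (η i) = ∑ i ∈ s, f (g i) + (f τ + n * f (r / n)) := by
    intro f
    simp only [η, Fintype.sum_sum_type, Sum.elim_inl, Sum.elim_inr, Finset.sum_const,
      Finset.card_univ, Fintype.card_fin, nsmul_eq_mul, Fintype.card_unit, one_smul]
    rw [← Finset.sum_coe_sort s fun i => f (g i)]
  have hηsum : ∑ i, η i = 2 * Real.pi := by
    rw [hη fun x => x, hτ, hr]
    field_simp
    ring
  -- Lumping the tail into one angle does not decrease the removed area: capArea x / x is
  -- nondecreasing, so `capArea` is superadditive here.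
  have htail : ∑' i, capArea (g i) ≤ ∑ i ∈ s, capArea (g i) + capArea τ := by
    refine (summable_capArea hg hsum).tsum_le_of_sum_le fun t => ?_
    have e1 : ∑ i ∈ t, capArea (g i) ≤
        ∑ i ∈ s, capArea (g i) + ∑ i ∈ t \ s, capArea (g i) := by
      rw [← Finset.sum_union Finset.disjoint_sdiff, Finset.union_sdiff_self_eq_union]
      exact Finset.sum_le_sum_of_subset_of_nonneg Finset.subset_union_right
        fun i _ _ => hca _ (hg i)
    have e2 : ∑ i ∈ t \ s, g i ≤ τ := by
      have := hsum.sum_le_tsum (s ∪ t \ s) fun i _ => hg i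
      rw [Finset.sum_union Finset.disjoint_sdiff] at this
      linarith
    have e3 : ∑ i ∈ t \ s, capArea (g i) ≤ capArea τ := by
      rcases hτ0.eq_or_lt with h | h
      · rw [← h] at e2 ⊢
        have e4 : ∀ i ∈ t \ s, g i = 0 := (Finset.sum_eq_zero_iff_of_nonneg fun i _ => hg i).1
          (le_antisymm e2 (Finset.sum_nonneg fun i _ => hg i))
        rw [capArea_zero, Finset.sum_congr rfl fun i hi => by rw [e4 i hi, capArea_zero]]
        simp
      · refine le_of_mul_le_mul_right ?_ h
        rw [Finset.sum_mul]
        calc ∑ i ∈ t \ s, capArea (g i) * τ ≤ ∑ i ∈ t \ s, g i * capArea τ :=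
              Finset.sum_le_sum fun i hi => capArea_mul_le (hg i)
                ((Finset.single_le_sum (fun j _ => hg j) hi).trans e2) hτπ
          _ = (∑ i ∈ t \ s, g i) * capArea τ := by rw [Finset.sum_mul]
          _ ≤ τ * capArea τ := mul_le_mul_of_nonneg_right e2 (hca _ hτ0)
          _ = capArea τ * τ := mul_comm _ _
    linarith
  have hmem : η ∈ angleClass (s ⊕ (Unit ⊕ Fin n)) A := by
    refine ⟨?_, hηsum, ?_⟩
    · rintro (i | i | i)
      · exact hg i
      · exact hτ0
      · exact div_nonneg hr0 (Nat.cast_nonneg _)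
    · have e1 : ∀ x, Real.sin x = x - 2 * capArea x := fun x => by unfold capArea; ring
      rw [Finset.sum_congr rfl fun i _ => e1 (η i), Finset.sum_sub_distrib, hηsum,
        ← Finset.mul_sum, hη]
      have : 0 ≤ n * capArea (r / n) :=
        mul_nonneg (Nat.cast_nonneg _) (hca _ (div_nonneg hr0 (Nat.cast_nonneg _)))
      linarith
  have hle := (sum_sin_half_le hA hm hs h1 h2 hmem).1
  have e1 : ∀ x, Real.sin (x / 2) = (x - capExcess x) / 2 := fun x => by unfold capExcess; ring
  rw [Finset.sum_congr rfl fun i _ => e1 (η i), ← Finset.sum_div, Finset.sum_sub_distrib, hηsum,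
    hη] at hle
  have e2 : ∑ i ∈ s, capExcess (g i) ≤ ∑' i, capExcess (g i) :=
    (summable_capExcess hg hsum htot).sum_le_tsum s fun i _ => capExcess_nonneg (hg i)
  have e3 : capExcess τ ≤ ε / 2 := (capExcess_le hτ0 (by linarith)).trans hτε
  have e4 : n * capExcess (r / n) ≤ ε / 2 := by
    have hn0 : (0 : ℝ) < n := by linarith
    have h := capExcess_le_cube (x := r / n) (by positivity)
    calc n * capExcess (r / n) ≤ n * (r / n) ^ 3 := mul_le_mul_of_nonneg_left h hn0.le
      _ = r ^ 3 / n / n := by field_simp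
      _ ≤ r ^ 3 / n := div_le_self (by positivity) hnR
      _ ≤ ε / 2 := hnε
  linarith

lemma hasSum_comp_update {ι : Type*} [DecidableEq ι] {f : ℝ → ℝ} {g : ι → ℝ} {S : ℝ}
    (h : HasSum (fun i => f (g i)) S) (i : ι) (a : ℝ) :
    HasSum (fun j => f (Function.update g i a j)) (f a - f (g i) + S) := by
  have := h.update i (f a)
  rwa [show Function.update (fun i => f (g i)) i (f a) =
    fun j => f (Function.update g i a j) from (Function.comp_update f g i a).symm] at this

/-- If infinitely many caps are cut off from the disk, or only arcs of total length less than `2π`,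
then the perimeter is smaller than that of the optimal polygon. -/
lemma finite_of_le_two_pi_sub_tsum (hA : 0 < A) (hAπ : A < Real.pi) (hm : 3 ≤ m)
    (hs : SideCountCondition A m)
    (h1 : SmallAngleCondition A m θ₁) (h2 : θ₁ + ((m : ℝ) - 1) * θ₂ = 2 * Real.pi)
    {ι : Type*} {g : ι → ℝ} (hg : ∀ i, 0 < g i) (hsum : Summable g)
    (htot : ∑' i, g i ≤ 2 * Real.pi) (harea : Real.pi - A ≤ ∑' i, capArea (g i))
    (hper : 2 * (Real.sin (θ₁ / 2) + ((m : ℝ) - 1) * Real.sin (θ₂ / 2)) ≤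
      2 * Real.pi - ∑' i, capExcess (g i)) :
    Finite ι ∧ ∑' i, g i = 2 * Real.pi := by
  classical
  have hg0 : ∀ i, 0 ≤ g i := fun i => (hg i).le
  have hsA := summable_capArea hg0 hsum
  have hsE := summable_capExcess hg0 hsum htot
  have hne : Nonempty ι := by
    by_contra hemp
    rw [not_nonempty_iff] at hemp
    simp only [tsum_empty] at harea
    linarith
  -- Among infinitely many gaps all but finitely many are shorter than `g k`. Two of these together
  -- with `k` form a triple that can be improved, and the result violates the bound of
  -- `two_pi_sub_tsum_capExcess_le`.
  have hfin : Finite ι := by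
    by_contra hinf
    rw [not_finite_iff_infinite] at hinf
    obtain ⟨k⟩ := hne
    have hev := hsum.tendsto_cofinite_zero.eventually (gt_mem_nhds (hg k))
    have hinfset : {i | g i < g k}.Infinite := by
      rw [Filter.eventually_cofinite] at hev
      exact Set.infinite_of_finite_compl hev
    obtain ⟨i, hi, j, hj, hij⟩ := hinfset.nontrivial
    wlog hle : g i ≤ g j generalizing i j
    · exact this j hj i hi hij.symm (le_of_not_ge hle)
    have hi : g i < g k := hi
    have hj : g j < g k := hj
    have hik : i ≠ k := by rintro rfl; exact lt_irrefl _ hi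
    have hjk : j ≠ k := by rintro rfl; exact lt_irrefl _ hj
    have h3 : g i + g j + g k ≤ 2 * Real.pi := by
      have := hsum.sum_le_tsum {i, j, k} fun i _ => hg0 i
      rw [Finset.sum_insert (by simp [hij, hik]), Finset.sum_pair hjk] at this
      linarith
    obtain ⟨a, b, c, ha, hb, hc, habc, hsin, hhalf⟩ := exists_better_triple (hg i) hle hj h3
    set g' := Function.update (Function.update (Function.update g i a) j b) k c with hg'
    have hup : ∀ {f : ℝ → ℝ} {S : ℝ}, HasSum (fun i => f (g i)) S →
        HasSum (fun x => f (g' x)) (f c - f (g k) + (f b - f (g j) + (f a - f (g i) + S))) := by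
      intro f S h
      have := hasSum_comp_update (hasSum_comp_update (hasSum_comp_update h i a) j b) k c
      simpa [hij, hik, hjk, hij.symm, hik.symm, hjk.symm] using this
    have u1 := hup (f := fun x => x) hsum.hasSum
    have u2 := hup hsA.hasSum
    have u3 := hup hsE.hasSum
    have hg'0 : ∀ x, 0 ≤ g' x := by
      intro x
      by_cases hk : x = k
      · subst hk; simpa [hg'] using hc.le
      · by_cases hj : x = j
        · subst hj; simpa [hg', hk] using hb.le
        · by_cases hi : x = i
          · subst hi; simpa [hg', hj, hk] using ha.le
          · simpa [hg', hi, hj, hk] using hg0 x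
    have := two_pi_sub_tsum_capExcess_le hA hm hs h1 h2 hg'0 u1.summable
      (by rw [u1.tsum_eq]; linarith)
      (by rw [u2.tsum_eq]; unfold capArea at harea ⊢; linarith)
    rw [u3.tsum_eq] at this
    have e : ∀ x, capExcess x = x - 2 * Real.sin (x / 2) := fun x => rfl
    simp only [e] at this hper
    linarith
  refine ⟨hfin, le_antisymm htot (not_lt.1 fun hlt => ?_)⟩
  have := Fintype.ofFinite ι
  obtain ⟨k⟩ := hne
  simp only [tsum_fintype] at *
  set r := 2 * Real.pi - ∑ i, g i with hr
  have hr0 : 0 < r := by linarith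
  set c := g k with hc
  have hcpos : 0 < c := hg k
  have hc2π : c ≤ 2 * Real.pi :=
    (Finset.single_le_sum (fun j _ => hg0 j) (Finset.mem_univ k)).trans htot
  -- A part r of the circle is uncovered. Some removed area is transferred from the cap of angle c
  -- to a new cap of angle β, leaving an angle y with the same total cap area. The minimum ensures
  -- that β fits into r and is smaller than c; the position of the arcs plays no role here.
  set β := min r c / 2 with hβ
  have hmin : 0 < min r c := lt_min hr0 hcpos
  have hβ0 : 0 < β := by positivity
  have hβr : β < r := by have := min_le_left r c; linarith
  have hβc : β < c := by have := min_le_right r c; linarith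
  have hcaβ : capArea β < capArea c :=
    capArea_strictMonoOn ⟨hβ0.le, by linarith⟩ ⟨hcpos.le, hc2π⟩ hβc
  obtain ⟨y, hy, hyA⟩ := intermediate_value_Icc hcpos.le continuous_capArea.continuousOn
    (show capArea c - capArea β ∈ Set.Icc (capArea 0) (capArea c) by
      rw [capArea_zero]
      have := capArea_pos hβ0
      constructor <;> linarith)
  have hy0 : 0 < y := by
    refine lt_of_le_of_ne hy.1 ?_
    rintro rfl
    rw [capArea_zero] at hyA
    linarith
  have hyc : y < c := by
    refine lt_of_le_of_ne hy.2 ?_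
    rintro h
    rw [h] at hyA
    have := capArea_pos hβ0
    linarith
  -- The excess per unit of cap area increases with the angle, so two smaller caps of the same total
  -- area have less excess.
  have hE : capExcess β + capExcess y < capExcess c := by
    have r1 := capExcess_mul_capArea_lt hβ0 hβc hc2π
    have r2 := capExcess_mul_capArea_lt hy0 hyc hc2π
    have hcA := capArea_pos hcpos
    refine lt_of_mul_lt_mul_right ?_ hcA.le
    have : capArea c = capArea y + capArea β := by linarith
    calc (capExcess β + capExcess y) * capArea c
        = capExcess β * capArea c + capExcess y * capArea c := by ring
      _ < capExcess c * capArea β + capExcess c * capArea y := by linarith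
      _ = capExcess c * capArea c := by rw [this]; ring
  let g' : Option ι → ℝ := fun o => o.elim β (Function.update g k y)
  have hup : ∀ f : ℝ → ℝ, ∑ o, f (g' o) = f β + (f y - f c + ∑ i, f (g i)) := by
    intro f
    rw [Fintype.sum_option]
    have := (hasSum_comp_update (hasSum_fintype fun i => f (g i)) k y).tsum_eq
    rw [tsum_fintype] at this
    simp only [g', Option.elim]
    rw [this]
  have hg'0 : ∀ o, 0 ≤ g' o := by
    rintro (_ | i)
    · exact hβ0.le
    · by_cases hi : i = k
      · subst hi; simpa [g'] using hy0.le
      · simpa [g', hi] using hg0 i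
  have := two_pi_sub_tsum_capExcess_le hA hm hs h1 h2 hg'0 (hasSum_fintype g').summable
    (by rw [tsum_fintype, hup fun x => x]; linarith)
    (by rw [tsum_fintype, hup capArea]; linarith)
  rw [tsum_fintype, hup capExcess] at this
  linarith

end infinite_problem

/-! ### The length of the boundary of a planar convex set -/

/-- The length of the boundary. -/
noncomputable def boundaryLength (K : Set Plane) : ENNReal := Measure.hausdorffMeasure 1 (frontier K)

lemma perimeter_eq_boundaryLength {K : Set Plane} (h : (interior K).Nonempty) :
    perimeter K = boundaryLength K := by
  rw [perimeter, if_pos h, boundaryLength]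

lemma exists_support {K : Set Plane} (hc : Convex ℝ K) (hi : (interior K).Nonempty) {x : Plane}
    (hx : x ∉ interior K) : ∃ f : Plane →L[ℝ] ℝ, (∀ z ∈ K, f z ≤ f x) ∧
      ∀ z ∈ interior K, f z < f x := by
  obtain ⟨f, hf⟩ := geometric_hahn_banach_open_point hc.interior isOpen_interior hx
  refine ⟨f, fun z hz => ?_, hf⟩
  have hz' : z ∈ closure (interior K) := by
    rw [hc.closure_interior_eq_closure_of_nonempty_interior hi]
    exact subset_closure hz
  exact closure_minimal (fun w hw => (hf w hw).le) (isClosed_le f.continuous continuous_const) hz'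

/-- The boundary of a convex body is a contraction of every set enclosing it. -/
lemma boundaryLength_mono {K L : Set Plane} (hK : IsCompact K) (hKc : Convex ℝ K)
    (hi : (interior K).Nonempty) (hL : IsCompact L) (hKL : K ⊆ L) :
    boundaryLength K ≤ boundaryLength L := by
  have hne : K.Nonempty := hi.mono interior_subset
  -- Nearest points in K, described by the variational inequality.
  have hproj : ∀ u : Plane, ∃ v ∈ K, ∀ w ∈ K, inner ℝ (u - v) (w - v) ≤ 0 := by
    intro u
    obtain ⟨v, hv, hv'⟩ := exists_norm_eq_iInf_of_complete_convex hne hK.isComplete hKc u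
    exact ⟨v, hv, (norm_eq_iInf_iff_real_inner_le_zero hKc hv).1 hv'⟩
  choose P hPK hP using hproj
  have hPL : LipschitzWith 1 P := by
    refine LipschitzWith.of_dist_le_mul fun u v => ?_
    rw [NNReal.coe_one, one_mul, dist_eq_norm, dist_eq_norm]
    have h1 := hP u (P v) (hPK v)
    have h2 := hP v (P u) (hPK u)
    -- The sum of the two variational inequalities; with Cauchy–Schwarz it shows that the projection
    -- is 1-Lipschitz.
    have h3 : ‖P u - P v‖ * ‖P u - P v‖ ≤ inner ℝ (u - v) (P u - P v) := by
      rw [← real_inner_self_eq_norm_mul_norm]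
      have e1 : inner ℝ (u - P u) (P v - P u) = - inner ℝ (u - P u) (P u - P v) := by
        rw [← inner_neg_right, neg_sub]
      have e2 : inner ℝ (u - v) (P u - P v) = inner ℝ (u - P u) (P u - P v)
          - inner ℝ (v - P v) (P u - P v) + inner ℝ (P u - P v) (P u - P v) := by
        rw [← inner_sub_left, ← inner_add_left]
        congr 1
        abel
      linarith
    have h4 := h3.trans (real_inner_le_norm _ _)
    rcases (norm_nonneg (P u - P v)).eq_or_lt with h | h
    · rw [← h]; exact norm_nonneg _
    · exact le_of_mul_le_mul_right h4 h
  -- From a boundary point x of K one follows the outward normal u to the last point that belongs to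
  -- L. This point is on the boundary of L and is projected back to x.
  have hsub : frontier K ⊆ P '' frontier L := by
    intro x hx
    have hxK : x ∈ K := hK.isClosed.frontier_subset hx
    obtain ⟨f, hf, hf'⟩ := exists_support hKc hi hx.2
    set u := (InnerProductSpace.toDual ℝ Plane).symm f with hu
    have hfu : ∀ z, f z = inner ℝ u z := fun z => by
      rw [hu, InnerProductSpace.toDual_symm_apply]
    have hu0 : u ≠ 0 := by
      intro h0
      obtain ⟨z, hz⟩ := hi
      have := hf' z hz
      rw [hfu, hfu, h0, inner_zero_left, inner_zero_left] at this
      exact lt_irrefl _ this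
    have hcpt : IsCompact {t : ℝ | 0 ≤ t ∧ x + t • u ∈ L} := by
      obtain ⟨R, hR⟩ := hL.isBounded.subset_closedBall 0
      refine (isCompact_Icc (a := (0 : ℝ)) (b := (R + ‖x‖) / ‖u‖)).of_isClosed_subset
        (isClosed_Ici.inter (hL.isClosed.preimage (by fun_prop))) ?_
      rintro t ⟨ht, htL⟩
      refine ⟨ht, ?_⟩
      have h1 := hR htL
      rw [mem_closedBall_zero_iff] at h1
      rw [le_div_iff₀ (norm_pos_iff.2 hu0)]
      have h2 : ‖t • u‖ ≤ ‖x + t • u‖ + ‖x‖ := by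
        have := norm_sub_le (x + t • u) x
        rwa [add_sub_cancel_left] at this
      rw [norm_smul, Real.norm_of_nonneg ht] at h2
      linarith
    obtain ⟨t, ⟨ht0, htL⟩, htmax⟩ := hcpt.exists_isGreatest
      ⟨0, le_rfl, by simpa using hKL hxK⟩
    refine ⟨x + t • u, ⟨subset_closure htL, fun hint => ?_⟩, ?_⟩
    · have hcont : ContinuousAt (fun s : ℝ => x + s • u) t := by fun_prop
      have hev := (hcont.eventually (isOpen_interior.mem_nhds hint)).filter_mono
        (nhdsWithin_le_nhds (s := Set.Ioi t))
      obtain ⟨s, hs, hts⟩ := (hev.and self_mem_nhdsWithin).exists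
      have hts : t < s := hts
      exact absurd (htmax ⟨ht0.trans hts.le, interior_subset hs⟩) (not_le.2 hts)
    · have h1 := hP (x + t • u) x hxK
      have h2 : inner ℝ (x + t • u - x) (P (x + t • u) - x) ≤ 0 := by
        rw [add_sub_cancel_left, inner_smul_left, inner_sub_right, ← hfu, ← hfu]
        have := hf _ (hPK (x + t • u))
        simp only [conj_trivial]
        nlinarith
      have h3 : inner ℝ (P (x + t • u) - x) (P (x + t • u) - x) ≤ 0 := by
        have e : inner ℝ (P (x + t • u) - x) (P (x + t • u) - x) =
            inner ℝ (x + t • u - x) (P (x + t • u) - x) +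
            inner ℝ (x + t • u - P (x + t • u)) (x - P (x + t • u)) := by
          have : x - P (x + t • u) = -(P (x + t • u) - x) := by abel
          rw [this, inner_neg_right, ← sub_eq_add_neg, ← inner_sub_left]
          congr 1
          abel
        linarith
      rw [real_inner_self_nonpos, sub_eq_zero] at h3
      exact h3
  calc boundaryLength K ≤ Measure.hausdorffMeasure 1 (P '' frontier L) := measure_mono hsub
    _ ≤ _ := by
        have := hPL.hausdorffMeasure_image_le zero_le_one (frontier L)
        simpa [boundaryLength] using this

lemma boundaryLength_homothety (K : Set Plane) (p : Plane) {t : ℝ} (ht : 0 < t) :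
    boundaryLength (AffineMap.homothety p t '' K) = ENNReal.ofReal t * boundaryLength K := by
  have h : frontier (AffineMap.homothety p t '' K) = AffineMap.homothety p t '' frontier K := by
    have e : (AffineMap.homothety p t : Plane → Plane) =
        (IsometryEquiv.vaddConst p).toHomeomorph ∘ (Homeomorph.smulOfNeZero t ht.ne') ∘
          (IsometryEquiv.vaddConst p).symm.toHomeomorph := by
      ext x
      simp [AffineMap.homothety_apply]
    rw [e]
    simp only [Set.image_comp, Homeomorph.image_frontier]
  rw [boundaryLength, h, hausdorffMeasure_homothety_image zero_le_one _ ht.ne', boundaryLength,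
    NNReal.rpow_one]
  rw [ENNReal.smul_def, smul_eq_mul]
  congr 1
  rw [ENNReal.ofReal, Real.toNNReal_eq_nnnorm_of_nonneg ht.le]

lemma volume_homothety (K : Set Plane) (p : Plane) (t : ℝ) :
    volume (AffineMap.homothety p t '' K) = ENNReal.ofReal (t ^ 2) * volume K := by
  rw [Measure.addHaar_image_homothety]
  simp

/-- Shrinking K towards p by the factor 1/t moves it into the interior of K, where a compact convex
set can be enclosed in the hull of finitely many points of K. Blowing up again gives the last
inclusion. -/
lemma exists_polygon_between {K : Set Plane} (hK : IsCompact K) (hc : Convex ℝ K) {p : Plane}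
    (hp : p ∈ interior K) {t : ℝ} (ht : 1 < t) {X : Finset Plane} (hX : (X : Set Plane) ⊆ K) :
    ∃ V : Finset Plane, X ⊆ V ∧ (V : Set Plane) ⊆ K ∧ p ∈ interior (convexHull ℝ (V : Set Plane)) ∧
      K ⊆ AffineMap.homothety p t '' convexHull ℝ (V : Set Plane) := by
  classical
  have ht0 : 0 < t := by linarith
  set s := AffineMap.homothety p t⁻¹ '' K with hs
  have hsc : Convex ℝ s := hc.affine_image _
  have hscpt : IsCompact s := hK.image (AffineMap.homothety_continuous p t⁻¹)
  have hcancel : ∀ x, AffineMap.homothety p t (AffineMap.homothety p t⁻¹ x) = x := fun x => by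
    rw [← AffineMap.homothety_mul_apply, mul_inv_cancel₀ ht0.ne', AffineMap.homothety_one]
    rfl
  have hcancel' : ∀ x, AffineMap.homothety p t⁻¹ (AffineMap.homothety p t x) = x := fun x => by
    rw [← AffineMap.homothety_mul_apply, inv_mul_cancel₀ ht0.ne', AffineMap.homothety_one]
    rfl
  have hsub : s ⊆ interior K := by
    rintro _ ⟨x, hx, rfl⟩
    obtain ⟨y, hy, rfl⟩ := hc.closure_subset_image_homothety_interior_of_one_lt hp t ht
      (subset_closure hx)
    rwa [hcancel']
  obtain ⟨u, hu1, hu2⟩ := hsc.exists_subset_interior_convexHull_finset_of_isCompact hscpt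
    (t := K) (by
      rw [← subset_interior_iff_mem_nhdsSet]
      exact hsub)
  have hmono : convexHull ℝ (u : Set Plane) ⊆ convexHull ℝ ((X ∪ u : Finset Plane) : Set Plane) :=
    convexHull_mono (by simp)
  refine ⟨X ∪ u, Finset.subset_union_left, ?_, ?_, ?_⟩
  · rw [Finset.coe_union]
    exact Set.union_subset hX ((subset_convexHull ℝ _).trans hu2)
  · refine interior_mono hmono (hu1 ⟨p, interior_subset hp, ?_⟩)
    exact AffineMap.homothety_apply_same _ _
  · intro x hx
    exact ⟨AffineMap.homothety p t⁻¹ x, hmono (interior_subset (hu1 ⟨x, hx, rfl⟩)), hcancel x⟩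

/-! ### Cutting a convex set along a line -/

section cut
variable {K : Set Plane} {f : Plane →L[ℝ] ℝ} {c : ℝ}

lemma interior_le_of_ne_zero (hf : f ≠ 0) : interior {x | c ≤ f x} = {x | c < f x} := by
  have h := (f.isOpenMap_of_ne_zero hf).preimage_interior_eq_interior_preimage f.continuous
    (Set.Ici c)
  rw [interior_Ici] at h
  exact h.symm

lemma frontier_cut (hK : IsClosed K) (hf : f ≠ 0) :
    frontier (K ∩ {x | c ≤ f x}) = (frontier K ∩ {x | c < f x}) ∪ (K ∩ {x | f x = c}) := by
  have hcl : IsClosed (K ∩ {x | c ≤ f x}) := hK.inter (isClosed_le continuous_const f.continuous)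
  rw [hcl.frontier_eq, interior_inter, interior_le_of_ne_zero hf, hK.frontier_eq]
  ext x
  simp only [Set.mem_sdiff, Set.mem_inter_iff, Set.mem_ofPred_eq, Set.mem_union, not_and, not_lt]
  constructor
  · rintro ⟨⟨h1, h2⟩, h3⟩
    rcases h2.eq_or_lt with h | h
    · exact Or.inr ⟨h1, h.symm⟩
    · exact Or.inl ⟨⟨h1, fun h4 => absurd (h3 h4) (not_le.2 h)⟩, h⟩
  · rintro (⟨⟨h1, h2⟩, h3⟩ | ⟨h1, h2⟩)
    · exact ⟨⟨h1, h3.le⟩, fun h => absurd h h2⟩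
    · exact ⟨⟨h1, h2.ge⟩, fun _ => h2.le⟩

/-- The cut replaces the boundary on the discarded side by the chord; the two remaining pieces are
disjoint because the first lies in the open half-plane. -/
lemma boundaryLength_cut (hK : IsClosed K) (hf : f ≠ 0) {a b : Plane}
    (hab : K ∩ {x | f x = c} = segment ℝ a b) :
    boundaryLength (K ∩ {x | c ≤ f x}) =
      Measure.hausdorffMeasure 1 (frontier K ∩ {x | c < f x}) + edist a b := by
  rw [boundaryLength, frontier_cut hK hf, measure_union, hab, hausdorffMeasure_segment]
  · rw [Set.disjoint_left]
    rintro x ⟨_, h⟩ ⟨_, h'⟩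
    have h : c < f x := h
    have h' : f x = c := h'
    exact h.ne' h'
  · exact hK.measurableSet.inter (measurableSet_eq_fun f.continuous.measurable measurable_const)

/-- The interior is dense in K, so p and q may be replaced by interior points on the same sides. -/
lemma exists_mem_interior_on_line (hc : Convex ℝ K) (hi : (interior K).Nonempty) {p q : Plane}
    (hp : p ∈ K) (hpc : f p < c) (hq : q ∈ K) (hqc : c < f q) : ∃ r ∈ interior K, f r = c := by
  have hdense : ∀ {U : Set Plane}, IsOpen U → (K ∩ U).Nonempty → (interior K ∩ U).Nonempty := by
    rintro U hU ⟨x, hx, hxU⟩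
    have hx' : x ∈ closure (interior K) := by
      rw [hc.closure_interior_eq_closure_of_nonempty_interior hi]
      exact subset_closure hx
    rw [Set.inter_comm]
    exact mem_closure_iff.1 hx' U hU hxU
  obtain ⟨p, hp, hpc : f p < c⟩ := hdense (isOpen_lt f.continuous continuous_const) ⟨p, hp, hpc⟩
  obtain ⟨q, hq, hqc : c < f q⟩ := hdense (isOpen_lt continuous_const f.continuous) ⟨q, hq, hqc⟩
  have hpq : 0 < f q - f p := by linarith
  refine ⟨((f q - c) / (f q - f p)) • p + ((c - f p) / (f q - f p)) • q,
    hc.interior hp hq (div_nonneg (by linarith) hpq.le) (div_nonneg (by linarith) hpq.le)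
      (by field_simp; ring), ?_⟩
  simp only [map_add, map_smul, smul_eq_mul]
  field_simp
  ring

/-- The line carries no boundary length: a point of the chord other than its ends and the interior
point r lies strictly between r and an end, hence is itself interior. Only the two ends can be
boundary points. -/
lemma boundaryLength_split (hK : IsClosed K) (hc : Convex ℝ K) (hi : (interior K).Nonempty)
    {a b : Plane} (hab : K ∩ {x | f x = c} = segment ℝ a b) {p q : Plane} (hp : p ∈ K)
    (hpc : f p < c) (hq : q ∈ K) (hqc : c < f q) :
    boundaryLength K = Measure.hausdorffMeasure 1 (frontier K ∩ {x | f x < c}) +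
      Measure.hausdorffMeasure 1 (frontier K ∩ {x | c < f x}) := by
  obtain ⟨r, hr, hrc⟩ := exists_mem_interior_on_line hc hi hp hpc hq hqc
  have := Measure.nullSingletonClass_hausdorff Plane (zero_lt_one' ℝ)
  have hnull : Measure.hausdorffMeasure 1 (frontier K ∩ {x | f x = c}) = 0 := by
    refine measure_mono_null (t := {a, b}) ?_ (Set.Finite.measure_zero (by simp) _)
    rintro x ⟨hx, hxc⟩
    have hxK : x ∈ K := hK.frontier_subset hx
    have hxab : x ∈ segment ℝ a b := hab ▸ ⟨hxK, hxc⟩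
    have hrab : r ∈ segment ℝ a b := hab ▸ ⟨interior_subset hr, hrc⟩
    have ha : a ∈ K := (hab.symm ▸ left_mem_segment ℝ a b : a ∈ K ∩ _).1
    have hb : b ∈ K := (hab.symm ▸ right_mem_segment ℝ a b : b ∈ K ∩ _).1
    have key : ∀ z ∈ K, x ∉ openSegment ℝ r z := fun z hz hxz =>
      hx.2 (hc.openSegment_interior_self_subset_interior hr hz hxz)
    have hxr : x ≠ r := by rintro rfl; exact hx.2 hr
    simp only [Set.mem_insert_iff, Set.mem_singleton_iff]
    by_contra hcon
    push Not at hcon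
    rw [segment_eq_image_lineMap] at hxab hrab
    obtain ⟨s, hs, rfl⟩ := hxab
    obtain ⟨t, ht, rfl⟩ := hrab
    have hs0 : 0 < s := lt_of_le_of_ne hs.1 (by rintro rfl; exact hcon.1 (by simp))
    have hs1 : s < 1 := lt_of_le_of_ne hs.2 (by rintro rfl; exact hcon.2 (by simp))
    have hst : s ≠ t := by rintro rfl; exact hxr rfl
    rcases hst.lt_or_gt with h | h
    · refine key a ha ?_
      rw [openSegment_symm, openSegment_eq_image_lineMap]
      refine ⟨s / t, ⟨div_pos hs0 (by linarith), by rw [div_lt_one (by linarith)]; exact h⟩, ?_⟩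
      have ht0 : t ≠ 0 := by linarith
      ext i
      simp [AffineMap.lineMap_apply]
      field_simp
    · refine key b hb ?_
      rw [openSegment_eq_image_lineMap]
      have ht1 : 0 < 1 - t := by linarith
      refine ⟨(s - t) / (1 - t), ⟨div_pos (by linarith) ht1, by
        rw [div_lt_one ht1]; linarith⟩, ?_⟩
      ext i
      simp [AffineMap.lineMap_apply]
      field_simp
      ring
  have e : frontier K = (frontier K ∩ {x | f x < c}) ∪ ((frontier K ∩ {x | c < f x}) ∪
      (frontier K ∩ {x | f x = c})) := by
    ext x
    simp only [Set.mem_inter_iff, Set.mem_ofPred_eq, Set.mem_union]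
    rcases lt_trichotomy (f x) c with h | h | h 
    · simp [h, h.not_gt, h.ne]
    · simp [h]
    · simp [h, h.not_gt, h.ne']
  have hm := isClosed_frontier (X := Plane) (s := K)
  have m1 : MeasurableSet (frontier K ∩ {x | c < f x}) :=
    hm.measurableSet.inter (measurableSet_lt measurable_const f.continuous.measurable)
  have m2 : MeasurableSet (frontier K ∩ {x | f x = c}) :=
    hm.measurableSet.inter (measurableSet_eq_fun f.continuous.measurable measurable_const)
  rw [boundaryLength]
  conv_lhs => rw [e]
  rw [measure_union _ (m1.union m2), measure_union _ m2, hnull, add_zero]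
  · rw [Set.disjoint_left]
    rintro x ⟨_, h⟩ ⟨_, h'⟩
    have h : c < f x := h
    have h' : f x = c := h'
    exact h.ne' h'
  · rw [Set.disjoint_left]
    rintro x ⟨_, h⟩ (⟨_, h'⟩ | ⟨_, h'⟩)
    · exact lt_asymm (show f x < c from h) h'
    · have h : f x < c := h
      have h' : f x = c := h'
      exact h.ne h'

lemma volume_line (hf : f ≠ 0) (c : ℝ) : volume {x : Plane | f x = c} = 0 := by
  have h1 : {x : Plane | f x = c} ⊆ frontier {x | c ≤ f x} := by
    rw [(isClosed_le continuous_const f.continuous).frontier_eq, interior_le_of_ne_zero hf]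
    intro x hx
    have hx : f x = c := hx
    exact ⟨hx.ge, by simp [hx]⟩
  refine measure_mono_null h1 (Convex.addHaar_frontier volume ?_)
  exact convex_halfSpace_ge f.isLinear c

lemma volume_cut (K : Set Plane) (hf : f ≠ 0) (c : ℝ) :
    volume K = volume (K ∩ {x | f x ≤ c}) + volume (K ∩ {x | c ≤ f x}) := by
  have h1 := measure_inter_add_sdiff (μ := volume) K
    (isClosed_le f.continuous (continuous_const (y := c))).measurableSet
  rw [← h1]
  congr 1
  refine le_antisymm (measure_mono ?_) ?_
  · rintro x ⟨hx, hx'⟩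
    exact ⟨hx, (not_le.1 (show ¬ f x ≤ c from hx')).le⟩
  · calc volume (K ∩ {x | c ≤ f x}) ≤ volume ((K \ {x | f x ≤ c}) ∪ {x | f x = c}) := by
          refine measure_mono ?_
          rintro x ⟨hx, hx'⟩
          rcases (show c ≤ f x from hx').eq_or_lt with h | h
          · exact Or.inr h.symm
          · exact Or.inl ⟨hx, not_le.2 h⟩
      _ ≤ _ := (measure_union_le _ _).trans_eq (by rw [volume_line hf, add_zero])

end cut

/-! ### The unit circle -/

lemma circlePoint_zero_apply (t : ℝ) : circlePoint t 0 = Real.cos t := rfl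

lemma circlePoint_one_apply (t : ℝ) : circlePoint t 1 = Real.sin t := rfl

lemma plane_inner_eq (x y : Plane) : inner ℝ x y = x 0 * y 0 + x 1 * y 1 := by
  simp [PiLp.inner_apply, Fin.sum_univ_two, mul_comm]

lemma inner_circlePoint (s t : ℝ) : inner ℝ (circlePoint s) (circlePoint t) = Real.cos (s - t) := by
  rw [plane_inner_eq]
  simp only [circlePoint_zero_apply, circlePoint_one_apply, Real.cos_sub]

lemma norm_circlePoint (t : ℝ) : ‖circlePoint t‖ = 1 := by
  have h : ‖circlePoint t‖ * ‖circlePoint t‖ = 1 := by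
    rw [← real_inner_self_eq_norm_mul_norm, inner_circlePoint, sub_self, Real.cos_zero]
  nlinarith [norm_nonneg (circlePoint t)]

lemma circlePoint_mem_unitDisk (t : ℝ) : circlePoint t ∈ unitDisk := by
  rw [unitDisk, mem_closedBall_zero_iff, norm_circlePoint]

lemma continuous_circlePoint : Continuous circlePoint := by
  unfold circlePoint
  fun_prop

lemma circlePoint_add_two_pi (t : ℝ) : circlePoint (t + 2 * Real.pi) = circlePoint t := by
  unfold circlePoint
  rw [Real.cos_add_two_pi, Real.sin_add_two_pi]

lemma dist_circlePoint (s t : ℝ) :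
    dist (circlePoint s) (circlePoint t) = 2 * |Real.sin ((s - t) / 2)| := by
  rw [dist_eq_norm]
  have h : ‖circlePoint s - circlePoint t‖ ^ 2 = (2 * |Real.sin ((s - t) / 2)|) ^ 2 := by
    rw [@norm_sub_sq_real, norm_circlePoint, norm_circlePoint, inner_circlePoint, mul_pow, sq_abs,
      Real.sin_sq_eq_half_sub]
    rw [show 2 * ((s - t) / 2) = s - t by ring]
    ring
  exact (pow_left_inj₀ (norm_nonneg _) (by positivity) two_ne_zero).1 h

lemma edist_circlePoint {s t : ℝ} (hst : s ≤ t) (hts : t ≤ s + 2 * Real.pi) :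
    edist (circlePoint s) (circlePoint t) = ENNReal.ofReal (2 * Real.sin ((t - s) / 2)) := by
  rw [edist_dist, dist_comm, dist_circlePoint, abs_of_nonneg]
  exact Real.sin_nonneg_of_nonneg_of_le_pi (by linarith) (by linarith)

lemma lipschitz_circlePoint : LipschitzWith 1 circlePoint := by
  refine LipschitzWith.of_dist_le_mul fun s t => ?_
  rw [dist_circlePoint, NNReal.coe_one, one_mul, Real.dist_eq]
  have := Real.abs_sin_le_abs (x := (s - t) / 2)
  rw [abs_div, abs_two] at this
  linarith

lemma exists_circlePoint_eq {x : Plane} (hx : ‖x‖ = 1) (φ : ℝ) :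
    ∃ t ∈ Set.Ico φ (φ + 2 * Real.pi), circlePoint t = x := by
  have hz : ‖(⟨x 0, x 1⟩ : ℂ)‖ = 1 := by
    rw [← hx, EuclideanSpace.norm_eq, Complex.norm_def, Complex.normSq_mk, Fin.sum_univ_two]
    simp [sq]
  set a := Complex.arg ⟨x 0, x 1⟩ with ha
  have hne : (⟨x 0, x 1⟩ : ℂ) ≠ 0 := by
    rw [← norm_pos_iff, hz]; exact one_pos
  have h0 : Real.cos a = x 0 := by rw [ha, Complex.cos_arg hne, hz, div_one]
  have h1 : Real.sin a = x 1 := by rw [ha, Complex.sin_arg, hz, div_one]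
  obtain ⟨n, hn, -⟩ := existsUnique_add_zsmul_mem_Ico Real.two_pi_pos a φ
  refine ⟨a + n • (2 * Real.pi), hn, ?_⟩
  ext i
  rw [zsmul_eq_mul]
  fin_cases i
  · change Real.cos _ = x 0
    rw [Real.cos_add_int_mul_two_pi, h0]
  · change Real.sin _ = x 1
    rw [Real.sin_add_int_mul_two_pi, h1]

lemma circlePoint_injOn (φ : ℝ) : Set.InjOn circlePoint (Set.Ico φ (φ + 2 * Real.pi)) := by
  intro s hs t ht hst
  have h := dist_circlePoint s t
  rw [hst, dist_self] at h
  have h0 : Real.sin ((s - t) / 2) = 0 := by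
    have : |Real.sin ((s - t) / 2)| = 0 := by linarith
    exact abs_eq_zero.1 this
  rw [Real.sin_eq_zero_iff_of_lt_of_lt (by linarith [hs.1, hs.2, ht.1, ht.2])
    (by linarith [hs.1, hs.2, ht.1, ht.2])] at h0
  linarith

/-- The linear functional given by the inner product with the point of the circle at `τ`. -/
noncomputable def arcFun (τ : ℝ) : Plane →L[ℝ] ℝ := innerSL ℝ (circlePoint τ)

lemma arcFun_apply (τ : ℝ) (x : Plane) : arcFun τ x = inner ℝ (circlePoint τ) x := rfl

lemma arcFun_circlePoint (τ t : ℝ) : arcFun τ (circlePoint t) = Real.cos (τ - t) :=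
  inner_circlePoint τ t

lemma arcFun_ne_zero (τ : ℝ) : arcFun τ ≠ 0 := by
  intro h
  have := arcFun_circlePoint τ τ
  rw [h, sub_self, Real.cos_zero] at this
  simp at this

lemma arcFun_eq (τ : ℝ) (x : Plane) : arcFun τ x = Real.cos τ * x 0 + Real.sin τ * x 1 := by
  rw [arcFun_apply, plane_inner_eq]
  rfl

lemma norm_sq_eq_arcFun (τ : ℝ) (x : Plane) :
    ‖x‖ ^ 2 = arcFun τ x ^ 2 + arcFun (τ + Real.pi / 2) x ^ 2 := by
  rw [arcFun_eq, arcFun_eq, Real.cos_add_pi_div_two, Real.sin_add_pi_div_two,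
    EuclideanSpace.norm_sq_eq, Fin.sum_univ_two, Real.norm_eq_abs, Real.norm_eq_abs, sq_abs, sq_abs]
  have := Real.sin_sq_add_cos_sq τ
  linear_combination (-(x 0 ^ 2) - x 1 ^ 2) * this

lemma eq_of_arcFun_eq {τ : ℝ} {x y : Plane} (h1 : arcFun τ x = arcFun τ y)
    (h2 : arcFun (τ + Real.pi / 2) x = arcFun (τ + Real.pi / 2) y) : x = y := by
  have h := norm_sq_eq_arcFun τ (x - y)
  rw [map_sub, map_sub, h1, h2, sub_self, sub_self] at h
  have : ‖x - y‖ = 0 := by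
    have : ‖x - y‖ ^ 2 = 0 := by rw [h]; ring
    exact pow_eq_zero_iff two_ne_zero |>.1 this
  rwa [norm_eq_zero, sub_eq_zero] at this

lemma convex_unitDisk : Convex ℝ unitDisk := convex_closedBall _ _

lemma isCompact_unitDisk : IsCompact unitDisk := isCompact_closedBall _ _

/-- A chord of the unit disk. -/
lemma unitDisk_inter_arcFun_eq (τ : ℝ) {h : ℝ} (h0 : 0 ≤ h) (hπ : h ≤ Real.pi) :
    unitDisk ∩ {x | arcFun τ x = Real.cos h} =
      segment ℝ (circlePoint (τ - h)) (circlePoint (τ + h)) := by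
  have hs : 0 ≤ Real.sin h := Real.sin_nonneg_of_nonneg_of_le_pi h0 hπ
  have e1 : arcFun τ (circlePoint (τ - h)) = Real.cos h := by
    rw [arcFun_circlePoint]; congr 1; ring
  have e2 : arcFun τ (circlePoint (τ + h)) = Real.cos h := by
    rw [arcFun_circlePoint, ← Real.cos_neg]; congr 1; ring
  have e3 : arcFun (τ + Real.pi / 2) (circlePoint (τ - h)) = - Real.sin h := by
    rw [arcFun_circlePoint, ← Real.cos_add_pi_div_two]; congr 1; ring
  have e4 : arcFun (τ + Real.pi / 2) (circlePoint (τ + h)) = Real.sin h := by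
    rw [arcFun_circlePoint, ← Real.cos_pi_div_two_sub]; congr 1; ring
  apply Set.Subset.antisymm
  · rintro x ⟨hx, hxc : arcFun τ x = Real.cos h⟩
    rw [unitDisk, mem_closedBall_zero_iff] at hx
    have hn := norm_sq_eq_arcFun τ x
    set y := arcFun (τ + Real.pi / 2) x with hy
    have hy2 : y ^ 2 ≤ Real.sin h ^ 2 := by
      have := Real.sin_sq_add_cos_sq h
      have : ‖x‖ ^ 2 ≤ 1 := pow_le_one₀ (norm_nonneg _) hx
      rw [hxc] at hn
      linarith
    have hya := abs_le_of_sq_le_sq' hy2 hs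
    rcases hs.eq_or_lt with hs0 | hs0
    · have : x = circlePoint (τ - h) := by
        refine eq_of_arcFun_eq (τ := τ) (hxc.trans e1.symm) ?_
        rw [e3, ← hy]
        linarith [hya.1, hya.2]
      rw [this]
      exact left_mem_segment ℝ _ _
    · rw [segment_eq_image]
      refine ⟨(y + Real.sin h) / (2 * Real.sin h), ⟨div_nonneg (by linarith [hya.1]) (by linarith),
        by rw [div_le_one (by linarith)]; linarith [hya.2]⟩, ?_⟩
      refine eq_of_arcFun_eq (τ := τ) ?_ ?_
      · simp only [map_add, map_smul, e1, e2, hxc, smul_eq_mul]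
        ring
      · simp only [map_add, map_smul, e3, e4, ← hy, smul_eq_mul]
        field_simp
        ring
  · refine (convex_unitDisk.inter (convex_hyperplane (arcFun τ).isLinear _)).segment_subset
      ⟨circlePoint_mem_unitDisk _, e1⟩ ⟨circlePoint_mem_unitDisk _, e2⟩

/-- A point of the disk beyond a chord lies on a parallel chord. -/
lemma exists_chord_of_cos_le {τ h : ℝ} (h0 : 0 ≤ h) (hπ : h ≤ Real.pi) {x : Plane}
    (hx : x ∈ unitDisk) (hxh : Real.cos h ≤ arcFun τ x) :
    ∃ h', 0 ≤ h' ∧ h' ≤ h ∧ arcFun τ x = Real.cos h' ∧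
      x ∈ segment ℝ (circlePoint (τ - h')) (circlePoint (τ + h')) := by
  have h1 : arcFun τ x ≤ 1 := by
    rw [arcFun_apply]
    refine (real_inner_le_norm _ _).trans ?_
    rw [norm_circlePoint, one_mul]
    rwa [unitDisk, mem_closedBall_zero_iff] at hx
  have hcos : Real.cos (Real.arccos (arcFun τ x)) = arcFun τ x :=
    Real.cos_arccos ((Real.neg_one_le_cos h).trans hxh) h1
  refine ⟨Real.arccos (arcFun τ x), Real.arccos_nonneg _, ?_, hcos.symm, ?_⟩
  · have := Real.arccos_le_arccos hxh
    rwa [Real.arccos_cos h0 hπ] at this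
  · rw [← unitDisk_inter_arcFun_eq τ (Real.arccos_nonneg _) (Real.arccos_le_pi _)]
    exact ⟨hx, hcos.symm⟩

/-- Inclusion of caps. -/
lemma cos_lt_arcFun_of_subset {τ h σ H : ℝ} (h0 : 0 ≤ h) (hH : H ≤ Real.pi)
    (h1 : σ - H ≤ τ - h) (h2 : τ + h ≤ σ + H) {x : Plane} (hx : x ∈ unitDisk)
    (hxh : Real.cos h < arcFun τ x) : Real.cos H < arcFun σ x := by
  -- The point lies on a parallel chord with ends in the smaller arc, so by convexity of half-planes
  -- the inclusion need only be checked on the circle.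
  obtain ⟨h', hh0, hh', he, hseg⟩ := exists_chord_of_cos_le h0 (by linarith) hx hxh.le
  have hlt : h' < h := lt_of_le_of_ne hh' (by rintro rfl; exact hxh.ne he.symm)
  refine (convex_halfSpace_gt (arcFun σ).isLinear (Real.cos H)).segment_subset ?_ ?_ hseg
  · change Real.cos H < arcFun σ _
    rw [arcFun_circlePoint, ← Real.cos_abs (σ - _)]
    refine Real.cos_lt_cos_of_nonneg_of_le_pi (abs_nonneg _) hH ?_
    rw [abs_lt]
    constructor <;> linarith
  · change Real.cos H < arcFun σ _
    rw [arcFun_circlePoint, ← Real.cos_abs (σ - _)]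
    refine Real.cos_lt_cos_of_nonneg_of_le_pi (abs_nonneg _) hH ?_
    rw [abs_lt]
    constructor <;> linarith

/-- Caps over disjoint arcs do not overlap. -/
lemma arcFun_le_cos_of_disjoint {φ s t s' t' : ℝ} (hs : φ ≤ s) (hst : s < t)
    (ht : t ≤ φ + 2 * Real.pi) (hs' : φ ≤ s') (hst' : s' < t') (ht' : t' ≤ φ + 2 * Real.pi)
    (hd : t ≤ s' ∨ t' ≤ s) {x : Plane} (hx : x ∈ unitDisk)
    (hxc : Real.cos ((t - s) / 2) ≤ arcFun ((s + t) / 2) x) :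
    arcFun ((s' + t') / 2) x ≤ Real.cos ((t' - s') / 2) := by
  obtain ⟨h', hh0, hh', he, hseg⟩ := exists_chord_of_cos_le (by linarith) (by linarith) hx hxc
  have key : ∀ σ ∈ Set.Icc s t, arcFun ((s' + t') / 2) (circlePoint σ) ≤
      Real.cos ((t' - s') / 2) := by
    intro σ hσ
    rw [arcFun_circlePoint]
    have hc : ∀ u, (t' - s') / 2 ≤ u → u ≤ 2 * Real.pi - (t' - s') / 2 →
        Real.cos u ≤ Real.cos ((t' - s') / 2) := by
      intro u hu1 hu2
      rcases le_total u Real.pi with hu | hu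
      · exact Real.cos_le_cos_of_nonneg_of_le_pi (by linarith) hu hu1
      · rw [← Real.cos_two_pi_sub u]
        exact Real.cos_le_cos_of_nonneg_of_le_pi (by linarith) (by linarith) (by linarith)
    rcases hd with hd | hd
    · exact hc _ (by linarith [hσ.2]) (by linarith [hσ.1])
    · rw [← Real.cos_neg]
      exact hc _ (by linarith [hσ.1]) (by linarith [hσ.2])
  exact (convex_halfSpace_le (arcFun ((s' + t') / 2)).isLinear _).segment_subset
    (key _ ⟨by linarith, by linarith⟩) (key _ ⟨by linarith, by linarith⟩) hseg

/-- An open arc is the part of the circle beyond its chord. -/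
lemma sphere_inter_cos_lt {τ h : ℝ} (h0 : 0 ≤ h) (hπ : h ≤ Real.pi) :
    Metric.sphere (0 : Plane) 1 ∩ {x | Real.cos h < arcFun τ x} =
      circlePoint '' Set.Ioo (τ - h) (τ + h) := by
  apply Set.Subset.antisymm
  · rintro x ⟨hx, hxc : Real.cos h < arcFun τ x⟩
    obtain ⟨t, ht, rfl⟩ := exists_circlePoint_eq (mem_sphere_zero_iff_norm.1 hx) (τ - Real.pi)
    refine ⟨t, ?_, rfl⟩
    rw [arcFun_circlePoint, ← Real.cos_abs (τ - t)] at hxc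
    have h1 : |τ - t| ≤ Real.pi := by
      rw [abs_le]
      constructor <;> linarith [ht.1, ht.2]
    have h2 : |τ - t| < h := by
      by_contra hcon
      exact absurd hxc (not_lt.2 (Real.cos_le_cos_of_nonneg_of_le_pi h0 h1 (not_lt.1 hcon)))
    rw [abs_lt] at h2
    constructor <;> linarith [h2.1, h2.2]
  · rintro _ ⟨t, ht, rfl⟩
    refine ⟨mem_sphere_zero_iff_norm.2 (norm_circlePoint t), ?_⟩
    change Real.cos h < arcFun τ _
    rw [arcFun_circlePoint, ← Real.cos_abs (τ - _)]
    refine Real.cos_lt_cos_of_nonneg_of_le_pi (abs_nonneg _) hπ ?_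
    rw [abs_lt]
    constructor <;> linarith [ht.1, ht.2]

/-! ### Arc length and the area of circular caps -/

/-- The projection to the direction τ of the chord (a right angle past the middle of the arc) is
1-Lipschitz, and the image of the arc covers the interval between the images of its ends. -/
lemma hausdorffMeasure_ge_edist_of_segment_image {S : Set Plane} {a b : ℝ} (hab : a ≤ b)
    (hS : circlePoint '' Set.Ioo a b ⊆ S) :
    ENNReal.ofReal (2 * Real.sin ((b - a) / 2)) ≤ Measure.hausdorffMeasure 1 S := by
  rcases le_or_gt (2 * Real.sin ((b - a) / 2)) 0 with h | hpos
  · rw [ENNReal.ofReal_of_nonpos h]; exact zero_le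
  set τ := (a + b) / 2 + Real.pi / 2 with hτ
  have hlip : LipschitzWith 1 (arcFun τ) := by
    have h1 : ‖arcFun τ‖₊ ≤ 1 := by
      rw [← NNReal.coe_le_coe, coe_nnnorm, arcFun, innerSL_apply_norm, norm_circlePoint]
      rfl
    exact (arcFun τ).lipschitz.weaken h1
  have ha : arcFun τ (circlePoint a) = - Real.sin ((b - a) / 2) := by
    rw [arcFun_circlePoint, ← Real.cos_add_pi_div_two]
    congr 1
    rw [hτ]
    ring
  have hb : arcFun τ (circlePoint b) = Real.sin ((b - a) / 2) := by
    rw [arcFun_circlePoint, ← Real.cos_pi_div_two_sub]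
    congr 1
    rw [hτ]
    ring
  have hsub : Set.Ioo (- Real.sin ((b - a) / 2)) (Real.sin ((b - a) / 2)) ⊆ arcFun τ '' S := by
    have hiv := intermediate_value_Ioo hab
      ((arcFun τ).continuous.comp continuous_circlePoint).continuousOn
    simp only [Function.comp, ha, hb] at hiv
    refine hiv.trans ?_
    rintro _ ⟨t, ht, rfl⟩
    exact ⟨circlePoint t, hS ⟨t, ht, rfl⟩, rfl⟩
  calc ENNReal.ofReal (2 * Real.sin ((b - a) / 2))
      = volume (Set.Ioo (- Real.sin ((b - a) / 2)) (Real.sin ((b - a) / 2))) := by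
        rw [Real.volume_Ioo]; congr 1; ring
    _ ≤ volume (arcFun τ '' S) := measure_mono hsub
    _ = Measure.hausdorffMeasure 1 (arcFun τ '' S) := by rw [hausdorffMeasure_real]
    _ ≤ Measure.hausdorffMeasure 1 S := by
        have := hlip.hausdorffMeasure_image_le zero_le_one S
        simpa using this

/-- The parametrization is 1-Lipschitz, which gives the upper bound. For the lower bound the arc is
divided into n pieces, each at least as long as its chord; the total deficit is n times a
`capExcess` and tends to 0. -/
lemma hausdorffMeasure_arc {s t : ℝ} (hst : s ≤ t) (hts : t ≤ s + 2 * Real.pi) :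
    Measure.hausdorffMeasure 1 (circlePoint '' Set.Ioo s t) = ENNReal.ofReal (t - s) := by
  have hπ := Real.pi_pos
  refine le_antisymm ?_ ?_
  · have := lipschitz_circlePoint.hausdorffMeasure_image_le zero_le_one (Set.Ioo s t)
    rw [hausdorffMeasure_real, Real.volume_Ioo] at this
    simpa using this
  · have hL : 0 ≤ t - s := by linarith
    refine ENNReal.le_of_forall_pos_le_add fun ε hε _ => ?_
    have hε' : (0 : ℝ) < ε := by exact_mod_cast hε
    -- The first bound keeps δ ≤ π, the second makes nδ³ = (t − s)³/n² at most ε.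
    obtain ⟨n, hn⟩ := exists_nat_ge (max 2 ((t - s) ^ 3 / ε))
    have hn2 : (2 : ℝ) ≤ n := (le_max_left _ _).trans hn
    have hn3 : (t - s) ^ 3 / ε ≤ n := (le_max_right _ _).trans hn
    have hn0 : (0 : ℝ) < n := by linarith
    set δ := (t - s) / n with hδ
    have hδ0 : 0 ≤ δ := div_nonneg hL hn0.le
    have hnδ : n * δ = t - s := by rw [hδ]; field_simp
    have hδπ : δ ≤ Real.pi := by
      rw [hδ, div_le_iff₀ hn0]; nlinarith
    let I : ℕ → Set ℝ := fun i => Set.Ioo (s + i * δ) (s + (i + 1) * δ)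
    -- An open arc is the intersection of the circle with an open half-plane.
    have hmeas : ∀ i, MeasurableSet (circlePoint '' I i) := by
      intro i
      have h := sphere_inter_cos_lt (τ := s + (i + 1 / 2) * δ) (h := δ / 2) (by linarith)
        (by linarith)
      have e : I i = Set.Ioo (s + (i + 1 / 2) * δ - δ / 2) (s + (i + 1 / 2) * δ + δ / 2) := by
        simp only [I]
        congr 1 <;> ring
      rw [e, ← h]
      exact Metric.isClosed_sphere.measurableSet.inter
        (measurableSet_lt measurable_const (arcFun _).continuous.measurable)
    have hIst : ∀ i < n, I i ⊆ Set.Ioo s t := by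
      intro i hi x hx
      have hi' : ((i + 1 : ℕ) : ℝ) ≤ n := by exact_mod_cast hi
      push_cast at hi'
      have h1 : (i + 1) * δ ≤ n * δ := mul_le_mul_of_nonneg_right hi' hδ0
      have h2 : 0 ≤ i * δ := mul_nonneg (Nat.cast_nonneg _) hδ0
      exact ⟨by linarith [hx.1], by linarith [hx.2]⟩
    have hinj : Set.InjOn circlePoint (Set.Ioo s t) :=
      (circlePoint_injOn s).mono (Set.Ioo_subset_Ico_self.trans (Set.Ico_subset_Ico_right hts))
    have hdisjI : ∀ i j : ℕ, i < j → Disjoint (I i) (I j) := by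
      intro i j hij
      rw [Set.disjoint_left]
      intro x hx hx'
      have hij' : ((i + 1 : ℕ) : ℝ) ≤ j := by exact_mod_cast hij
      push_cast at hij'
      have h1 : (i + 1) * δ ≤ j * δ := mul_le_mul_of_nonneg_right hij' hδ0
      linarith [hx.2, hx'.1]
    have hdisj : (Finset.range n : Set ℕ).PairwiseDisjoint fun i => circlePoint '' I i := by
      intro i hi j hj hij
      have hi : i < n := by simpa using hi
      have hj : j < n := by simpa using hj
      have h1 : Disjoint (I i) (I j) := by
        rcases hij.lt_or_gt with h | h
        · exact hdisjI i j h
        · exact (hdisjI j i h).symm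
      rw [Function.onFun, Set.disjoint_iff_inter_eq_empty, ← hinj.image_inter (hIst i hi) (hIst j hj),
        Set.disjoint_iff_inter_eq_empty.1 h1, Set.image_empty]
    have hU : Measure.hausdorffMeasure 1 (⋃ i ∈ Finset.range n, circlePoint '' I i) =
        ∑ i ∈ Finset.range n, Measure.hausdorffMeasure 1 (circlePoint '' I i) :=
      measure_biUnion_finset hdisj fun i _ => hmeas i
    have hge : ∀ i ∈ Finset.range n, ENNReal.ofReal (2 * Real.sin (δ / 2)) ≤
        Measure.hausdorffMeasure 1 (circlePoint '' I i) := by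
      intro i _
      have := hausdorffMeasure_ge_edist_of_segment_image (a := s + i * δ) (b := s + (i + 1) * δ)
        (by linarith) (le_refl (circlePoint '' I i))
      rwa [show s + (i + 1) * δ - (s + i * δ) = δ by ring] at this
    have hreal : t - s ≤ n * (2 * Real.sin (δ / 2)) + ε := by
      have h1 := capExcess_le_cube hδ0
      unfold capExcess at h1
      have h2 : n * δ ^ 3 ≤ ε := by
        have : n * δ ^ 3 = (t - s) ^ 3 / n / n := by rw [hδ]; field_simp
        rw [this, div_le_iff₀ hn0, div_le_iff₀ hn0]
        rw [div_le_iff₀ hε'] at hn3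
        have : (ε : ℝ) * n ≤ ε * n * n := by nlinarith [mul_pos hε' hn0]
        linarith
      have h3 : n * (δ - 2 * Real.sin (δ / 2)) ≤ n * δ ^ 3 := mul_le_mul_of_nonneg_left h1 hn0.le
      linarith
    calc ENNReal.ofReal (t - s) ≤ ENNReal.ofReal (n * (2 * Real.sin (δ / 2)) + ε) :=
          ENNReal.ofReal_le_ofReal hreal
      _ ≤ ENNReal.ofReal (n * (2 * Real.sin (δ / 2))) + ENNReal.ofReal ε :=
          ENNReal.ofReal_add_le
      _ = ∑ i ∈ Finset.range n, ENNReal.ofReal (2 * Real.sin (δ / 2)) + ε := by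
          rw [Finset.sum_const, Finset.card_range, nsmul_eq_mul,
            ENNReal.ofReal_mul (Nat.cast_nonneg _), ENNReal.ofReal_natCast,
            ENNReal.ofReal_coe_nnreal]
      _ ≤ ∑ i ∈ Finset.range n, Measure.hausdorffMeasure 1 (circlePoint '' I i) + ε := by
          gcongr with i hi
          exact hge i hi
      _ = Measure.hausdorffMeasure 1 (⋃ i ∈ Finset.range n, circlePoint '' I i) + ε := by rw [hU]
      _ ≤ Measure.hausdorffMeasure 1 (circlePoint '' Set.Ioo s t) + ε := by
          gcongr
          refine Set.iUnion₂_subset fun i hi => Set.image_mono (hIst i (by simpa using hi))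

lemma frontier_unitDisk : frontier unitDisk = Metric.sphere (0 : Plane) 1 := by
  rw [unitDisk, frontier_closedBall _ one_ne_zero]

lemma boundaryLength_unitDisk : boundaryLength unitDisk = ENNReal.ofReal (2 * Real.pi) := by
  have hπ := Real.pi_pos
  have := Measure.nullSingletonClass_hausdorff Plane (zero_lt_one' ℝ)
  have h := hausdorffMeasure_arc (s := 0) (t := 2 * Real.pi) (by linarith) (by linarith)
  rw [sub_zero] at h
  rw [boundaryLength, frontier_unitDisk, ← h]
  refine le_antisymm ?_ (measure_mono ?_)
  · calc Measure.hausdorffMeasure 1 (Metric.sphere (0 : Plane) 1)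
        ≤ Measure.hausdorffMeasure 1
          ({circlePoint 0} ∪ circlePoint '' Set.Ioo 0 (2 * Real.pi)) := by
          refine measure_mono fun x hx => ?_
          obtain ⟨t, ht, rfl⟩ := exists_circlePoint_eq (mem_sphere_zero_iff_norm.1 hx) 0
          rw [zero_add] at ht
          rcases ht.1.eq_or_lt with h0 | h0
          · left; rw [← h0]; rfl
          · exact Or.inr ⟨t, ⟨h0, ht.2⟩, rfl⟩
      _ ≤ _ := (measure_union_le _ _).trans_eq (by rw [measure_singleton, zero_add])
  · rintro _ ⟨t, -, rfl⟩
    exact mem_sphere_zero_iff_norm.2 (norm_circlePoint t)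

/-- The orthonormal basis of the plane that starts with the direction `τ`. -/
noncomputable def rotatedBasis (τ : ℝ) : OrthonormalBasis (Fin 2) ℝ Plane :=
  have h : Orthonormal ℝ ![circlePoint τ, circlePoint (τ + Real.pi / 2)] := by
    rw [orthonormal_iff_ite]
    intro i j
    fin_cases i <;> fin_cases j <;>
      simp [inner_circlePoint, -inner_self_eq_norm_sq_to_K]
  (basisOfOrthonormalOfCardEqFinrank h (by simp)).toOrthonormalBasis (by
    rw [coe_basisOfOrthonormalOfCardEqFinrank]; exact h)

lemma rotatedBasis_zero (τ : ℝ) : rotatedBasis τ 0 = circlePoint τ := by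
  simp [rotatedBasis]

lemma integral_two_mul_sqrt_one_sub_sq {c : ℝ} (h1 : -1 ≤ c) (h2 : c ≤ 1) :
    ∫ u in c..1, 2 * Real.sqrt (1 - u ^ 2) =
      Real.pi / 2 - (c * Real.sqrt (1 - c ^ 2) + Real.arcsin c) := by
  have hF : ∀ u ∈ Set.Ioo c 1, HasDerivAt (fun u : ℝ => u * Real.sqrt (1 - u ^ 2) + Real.arcsin u)
      (2 * Real.sqrt (1 - u ^ 2)) u := by
    intro u hu
    have hu1 : -1 < u := by linarith [hu.1]
    have hpos : 0 < 1 - u ^ 2 := by nlinarith [hu.2]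
    have d1 : HasDerivAt (fun u : ℝ => 1 - u ^ 2) (-(2 * u)) u := by
      have := ((hasDerivAt_id u).pow 2).const_sub 1
      simpa using this
    have d2 := Real.hasDerivAt_arcsin hu1.ne' hu.2.ne
    refine (((hasDerivAt_id u).mul (d1.sqrt hpos.ne')).add d2).congr_deriv ?_
    have hs := Real.sqrt_pos.2 hpos
    have hsq := Real.sq_sqrt hpos.le
    simp only [id]
    field_simp
    rw [hsq]
    ring
  rw [intervalIntegral.integral_eq_sub_of_hasDerivAt_of_le h2 _ hF]
  · simp
  · exact Continuous.intervalIntegrable (by fun_prop) _ _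
  · have : Continuous (fun u : ℝ => u * Real.sqrt (1 - u ^ 2) + Real.arcsin u) :=
      (by fun_prop : Continuous fun u : ℝ => u * Real.sqrt (1 - u ^ 2)).add
        Real.continuous_arcsin
    exact this.continuousOn

/-- In the orthonormal coordinates starting with the direction τ, the slice of the cap at height u
has length 2√(1 − u²) for u between cos h and 1; Fubini reduces the area to an elementary integral.
-/
lemma volume_cap (τ : ℝ) {h : ℝ} (h0 : 0 ≤ h) (hπ : h ≤ Real.pi) :
    volume (unitDisk ∩ {x | Real.cos h ≤ arcFun τ x}) = ENNReal.ofReal (capArea (2 * h)) := by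
  set c := Real.cos h with hc
  have hc1 : -1 ≤ c := Real.neg_one_le_cos h
  have hc2 : c ≤ 1 := Real.cos_le_one h
  set S : Set (ℝ × ℝ) := {p | c ≤ p.1 ∧ p.1 ^ 2 + p.2 ^ 2 ≤ 1} with hS
  have hSm : MeasurableSet S :=
    (measurableSet_le measurable_const measurable_fst).inter
      (measurableSet_le (f := fun p : ℝ × ℝ => p.1 ^ 2 + p.2 ^ 2) (by fun_prop) measurable_const)
  have hmp : MeasurePreserving (fun x : Plane => ((rotatedBasis τ).repr x 0,
      (rotatedBasis τ).repr x 1)) := by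
    have h1 := (rotatedBasis τ).measurePreserving_repr
    have h2 := PiLp.volume_preserving_ofLp (Fin 2)
    have h3 := volume_preserving_finTwoArrow ℝ
    exact h3.comp (h2.comp h1)
  have hpre : unitDisk ∩ {x | c ≤ arcFun τ x} = (fun x : Plane => ((rotatedBasis τ).repr x 0,
      (rotatedBasis τ).repr x 1)) ⁻¹' S := by
    ext x
    have e1 : (rotatedBasis τ).repr x 0 = arcFun τ x := by
      rw [OrthonormalBasis.repr_apply_apply, rotatedBasis_zero, arcFun_apply]
    have e2 : ‖x‖ ^ 2 = (rotatedBasis τ).repr x 0 ^ 2 + (rotatedBasis τ).repr x 1 ^ 2 := by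
      rw [← (rotatedBasis τ).repr.norm_map x, EuclideanSpace.norm_sq_eq, Fin.sum_univ_two]
      simp
    have e3 : x ∈ unitDisk ↔ ‖x‖ ^ 2 ≤ 1 := by
      rw [unitDisk, mem_closedBall_zero_iff, sq_le_one_iff₀ (norm_nonneg _)]
    simp only [Set.mem_inter_iff, e3, Set.mem_preimage, hS, Set.mem_ofPred_eq, e2, e1]
    tauto
  rw [hpre, hmp.measure_preimage hSm.nullMeasurableSet, Measure.volume_eq_prod,
    Measure.prod_apply hSm]
  have hslice : ∀ u, volume (Prod.mk u ⁻¹' S) =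
      (Set.Icc c 1).indicator (fun u => ENNReal.ofReal (2 * Real.sqrt (1 - u ^ 2))) u := by
    intro u
    by_cases hu : u ∈ Set.Icc c 1
    · rw [Set.indicator_of_mem hu]
      have hu0 : 0 ≤ 1 - u ^ 2 := by nlinarith [hu.1, hu.2]
      have : Prod.mk u ⁻¹' S = Set.Icc (-Real.sqrt (1 - u ^ 2)) (Real.sqrt (1 - u ^ 2)) := by
        ext v
        simp only [Set.mem_preimage, hS, Set.mem_ofPred_eq, Set.mem_Icc, ← abs_le]
        rw [Real.le_sqrt (abs_nonneg _) hu0, sq_abs]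
        constructor
        · rintro ⟨-, h⟩; linarith
        · intro h; exact ⟨hu.1, by linarith⟩
      rw [this, Real.volume_Icc]
      congr 1
      ring
    · rw [Set.indicator_of_notMem hu]
      have : Prod.mk u ⁻¹' S = ∅ := by
        ext v
        simp only [Set.mem_preimage, hS, Set.mem_ofPred_eq, Set.mem_empty_iff_false, iff_false]
        rintro ⟨h1, h2⟩
        exact hu ⟨h1, by nlinarith [sq_nonneg v]⟩
      rw [this, measure_empty]
  simp_rw [hslice]
  rw [lintegral_indicator measurableSet_Icc,
    ← ofReal_integral_eq_lintegral_ofReal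
      ((Continuous.integrableOn_Icc (by fun_prop) : IntegrableOn _ _ _))
      (Filter.Eventually.of_forall fun u => by positivity)]
  congr 1
  rw [integral_Icc_eq_integral_Ioc, ← intervalIntegral.integral_of_le hc2,
    integral_two_mul_sqrt_one_sub_sq hc1 hc2, hc]
  have hs : Real.sqrt (1 - Real.cos h ^ 2) = Real.sin h := by
    rw [← Real.abs_sin_eq_sqrt_one_sub_cos_sq, abs_of_nonneg]
    exact Real.sin_nonneg_of_nonneg_of_le_pi h0 hπ
  have ha : Real.arcsin (Real.cos h) = Real.pi / 2 - h := by
    rw [← Real.sin_pi_div_two_sub, Real.arcsin_sin (by linarith) (by linarith)]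
  rw [hs, ha, capArea, Real.sin_two_mul]
  ring

lemma volume_unitDisk : volume unitDisk = ENNReal.ofReal Real.pi := by
  have h := volume_cap 0 Real.pi_pos.le le_rfl
  have e : unitDisk ∩ {x | Real.cos Real.pi ≤ arcFun 0 x} = unitDisk := by
    rw [Set.inter_eq_left]
    intro x hx
    change Real.cos Real.pi ≤ arcFun 0 x
    have h1 := abs_real_inner_le_norm (circlePoint 0) x
    rw [norm_circlePoint, one_mul] at h1
    rw [unitDisk, mem_closedBall_zero_iff] at hx
    rw [Real.cos_pi, arcFun_apply]
    linarith [(abs_le.1 h1).1]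
  rw [e] at h
  rw [h, capArea, Real.sin_two_pi]
  congr 1
  ring

/-! ### Convex hulls of subsets of the unit circle -/

/-- The unit disk without the caps over the arcs in `S`. -/
def cutDisk (S : Finset (ℝ × ℝ)) : Set Plane :=
  {x | x ∈ unitDisk ∧ ∀ p ∈ S, arcFun ((p.1 + p.2) / 2) x ≤ Real.cos ((p.2 - p.1) / 2)}

/-- The arcs between consecutive points of `F`, where the circle is cut open at the angle `φ`. -/
def gaps (F : Set Plane) (φ : ℝ) : Set (ℝ × ℝ) :=
  {p | φ ≤ p.1 ∧ p.1 < p.2 ∧ p.2 ≤ φ + 2 * Real.pi ∧ circlePoint p.1 ∈ F ∧ circlePoint p.2 ∈ F ∧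
    ∀ σ ∈ Set.Ioo p.1 p.2, circlePoint σ ∉ F}

section gaps
variable {F : Set Plane} {φ : ℝ}

/-- The ends of a gap belong to F and so cannot lie inside another gap; overlapping gaps therefore
have the same ends. -/
lemma gaps_disjoint {p q : ℝ × ℝ} (hp : p ∈ gaps F φ) (hq : q ∈ gaps F φ) (hpq : p ≠ q) :
    p.2 ≤ q.1 ∨ q.2 ≤ p.1 := by
  by_contra hcon
  push Not at hcon
  obtain ⟨-, h1, -, h2, h3, h4⟩ := hp
  obtain ⟨-, g1, -, g2, g3, g4⟩ := hq
  refine hpq (Prod.ext (le_antisymm ?_ ?_) (le_antisymm ?_ ?_))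
  · exact not_lt.1 fun h => g4 _ ⟨h, hcon.2⟩ h2
  · exact not_lt.1 fun h => h4 _ ⟨h, hcon.1⟩ g2
  · exact not_lt.1 fun h => h4 _ ⟨hcon.2, h⟩ g3
  · exact not_lt.1 fun h => g4 _ ⟨hcon.1, h⟩ h3

/-- The ends are the last angle of F before σ and the first one after it. Both exist because φ and φ
+ 2π are angles of F. -/
lemma exists_gap (hF : IsClosed F) (hφ : circlePoint φ ∈ F) {σ : ℝ} (h1 : φ ≤ σ)
    (h2 : σ ≤ φ + 2 * Real.pi) (hσ : circlePoint σ ∉ F) :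
    ∃ p ∈ gaps F φ, p.1 < σ ∧ σ < p.2 := by
  have hcl : IsClosed {u : ℝ | circlePoint u ∈ F} := hF.preimage continuous_circlePoint
  obtain ⟨s, hs, hsm⟩ := (isCompact_Icc.inter_right hcl : IsCompact (Set.Icc φ σ ∩ _)).exists_isGreatest
    ⟨φ, ⟨le_rfl, h1⟩, hφ⟩
  obtain ⟨t, ht, htm⟩ := (isCompact_Icc.inter_right hcl :
    IsCompact (Set.Icc σ (φ + 2 * Real.pi) ∩ _)).exists_isLeast
    ⟨φ + 2 * Real.pi, ⟨h2, le_rfl⟩, by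
      change circlePoint _ ∈ F
      rwa [circlePoint_add_two_pi]⟩
  have hsF : circlePoint s ∈ F := hs.2
  have htF : circlePoint t ∈ F := ht.2
  have hsσ : s < σ := lt_of_le_of_ne hs.1.2 (by rintro rfl; exact hσ hsF)
  have htσ : σ < t := lt_of_le_of_ne ht.1.1 (by rintro rfl; exact hσ htF)
  refine ⟨(s, t), ⟨hs.1.1, hsσ.trans htσ, ht.1.2, hsF, htF, fun u hu huF => ?_⟩, hsσ, htσ⟩
  rcases le_total u σ with h | h
  · exact absurd (hsm ⟨⟨hs.1.1.trans hu.1.le, h⟩, huF⟩) (not_le.2 hu.1)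
  · exact absurd (htm ⟨⟨h, hu.2.le.trans ht.1.2⟩, huF⟩) (not_le.2 hu.2)

lemma sum_gaps_le (S : Finset (ℝ × ℝ)) (hS : (S : Set (ℝ × ℝ)) ⊆ gaps F φ) :
    ∑ p ∈ S, (p.2 - p.1) ≤ 2 * Real.pi := by
  have hdisj : (S : Set (ℝ × ℝ)).PairwiseDisjoint fun p => Set.Ioo p.1 p.2 := by
    intro p hp q hq hpq
    rw [Function.onFun, Set.disjoint_left]
    intro x hx hx'
    rcases gaps_disjoint (hS hp) (hS hq) hpq with h | h
    · linarith [hx.2, hx'.1]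
    · linarith [hx.1, hx'.2]
  have h1 := measure_biUnion_finset (μ := volume) hdisj fun p _ => measurableSet_Ioo
  have h2 : (⋃ p ∈ S, Set.Ioo p.1 p.2) ⊆ Set.Ioo φ (φ + 2 * Real.pi) :=
    Set.iUnion₂_subset fun p hp => Set.Ioo_subset_Ioo (hS hp).1 (hS hp).2.2.1
  have h3 := measure_mono (μ := volume) h2
  rw [h1, Real.volume_Ioo, add_sub_cancel_left] at h3
  simp only [Real.volume_Ioo] at h3
  rw [← ENNReal.ofReal_sum_of_nonneg fun p hp => sub_nonneg.2 (hS hp).2.1.le] at h3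
  exact (ENNReal.ofReal_le_ofReal_iff Real.two_pi_pos.le).1 h3

lemma arcFun_le_of_mem (hF : F ⊆ Metric.sphere 0 1) {p : ℝ × ℝ} (hp : p ∈ gaps F φ) {x : Plane}
    (hx : x ∈ F) : arcFun ((p.1 + p.2) / 2) x ≤ Real.cos ((p.2 - p.1) / 2) := by
  by_contra hlt
  have hlt := not_le.1 hlt
  have hπ : (p.2 - p.1) / 2 ≤ Real.pi := by linarith [hp.1, hp.2.2.1]
  have h0 : 0 ≤ (p.2 - p.1) / 2 := by linarith [hp.2.1]
  have h : x ∈ circlePoint '' Set.Ioo ((p.1 + p.2) / 2 - (p.2 - p.1) / 2)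
      ((p.1 + p.2) / 2 + (p.2 - p.1) / 2) := by
    rw [← sphere_inter_cos_lt h0 hπ]
    exact ⟨hF hx, hlt⟩
  obtain ⟨t, ht, rfl⟩ := h
  exact hp.2.2.2.2.2 t ⟨by linarith [ht.1], by linarith [ht.2]⟩ hx

lemma convex_cutDisk (S : Finset (ℝ × ℝ)) : Convex ℝ (cutDisk S) := by
  have : cutDisk S = unitDisk ∩ ⋂ p ∈ S,
      {x | arcFun ((p.1 + p.2) / 2) x ≤ Real.cos ((p.2 - p.1) / 2)} := by
    ext x
    simp [cutDisk]
  rw [this]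
  exact convex_unitDisk.inter (convex_iInter₂ fun p _ => convex_halfSpace_le (arcFun _).isLinear _)

lemma isCompact_cutDisk (S : Finset (ℝ × ℝ)) : IsCompact (cutDisk S) := by
  have : cutDisk S = unitDisk ∩ ⋂ p ∈ S,
      {x | arcFun ((p.1 + p.2) / 2) x ≤ Real.cos ((p.2 - p.1) / 2)} := by
    ext x
    simp [cutDisk]
  rw [this]
  exact isCompact_unitDisk.inter_right (isClosed_biInter fun p _ =>
    isClosed_le (arcFun _).continuous continuous_const)

lemma convexHull_subset_cutDisk (hF : F ⊆ Metric.sphere 0 1) (S : Finset (ℝ × ℝ))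
    (hS : (S : Set (ℝ × ℝ)) ⊆ gaps F φ) : convexHull ℝ F ⊆ cutDisk S :=
  convexHull_min (fun _ hx => ⟨Metric.sphere_subset_closedBall (hF hx),
    fun _ hp => arcFun_le_of_mem hF (hS hp) hx⟩) (convex_cutDisk S)

/-- Boundary length and area of the disk after caps have been cut off. -/
lemma boundaryLength_cutDisk (hF : F ⊆ Metric.sphere 0 1)
    (hi : (interior (convexHull ℝ F)).Nonempty) (S : Finset (ℝ × ℝ))
    (hS : (S : Set (ℝ × ℝ)) ⊆ gaps F φ) :
    boundaryLength (cutDisk S) =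
        ENNReal.ofReal (2 * Real.pi - ∑ p ∈ S, capExcess (p.2 - p.1)) ∧
      volume (cutDisk S) = ENNReal.ofReal (Real.pi - ∑ p ∈ S, capArea (p.2 - p.1)) := by
  classical
  induction S using Finset.induction_on with
  | empty =>
    have : cutDisk ∅ = unitDisk := by ext x; simp [cutDisk]
    simp [this, boundaryLength_unitDisk, volume_unitDisk]
  | insert p S hpS ih =>
    rw [Finset.coe_insert, Set.insert_subset_iff] at hS
    obtain ⟨hp, hS⟩ := hS
    obtain ⟨ih1, ih2⟩ := ih hS
    set f := arcFun ((p.1 + p.2) / 2) with hf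
    have hf0 : f ≠ 0 := arcFun_ne_zero _
    set h := (p.2 - p.1) / 2 with hh
    have hπ : h ≤ Real.pi := by linarith [hp.1, hp.2.2.1]
    have h0 : 0 < h := by linarith [hp.2.1]
    have hins : cutDisk (insert p S) = cutDisk S ∩ {x | f x ≤ Real.cos h} := by
      ext x
      simp only [cutDisk, Finset.forall_mem_insert, Set.mem_ofPred_eq, Set.mem_inter_iff]
      tauto
    -- Caps over different gaps do not overlap, so beyond the new chord nothing of the disk has been
    -- removed yet.
    have hcap : cutDisk S ∩ {x | Real.cos h ≤ f x} = unitDisk ∩ {x | Real.cos h ≤ f x} := by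
      apply Set.Subset.antisymm
      · exact Set.inter_subset_inter_left _ fun x hx => hx.1
      · rintro x ⟨hx, hxc⟩
        refine ⟨⟨hx, fun q hq => ?_⟩, hxc⟩
        have hpq : p ≠ q := by rintro rfl; exact hpS hq
        exact arcFun_le_cos_of_disjoint hp.1 hp.2.1 hp.2.2.1 (hS hq).1 (hS hq).2.1 (hS hq).2.2.1
          (gaps_disjoint hp (hS hq) hpq) hx hxc
    have hKsub := convexHull_subset_cutDisk hF S hS
    have hiS : (interior (cutDisk S)).Nonempty := hi.mono (interior_mono hKsub)
    have e1 : (p.1 + p.2) / 2 - h = p.1 := by rw [hh]; ring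
    have e2 : (p.1 + p.2) / 2 + h = p.2 := by rw [hh]; ring
    have hab : cutDisk S ∩ {x | f x = Real.cos h} =
        segment ℝ (circlePoint p.1) (circlePoint p.2) := by
      have := unitDisk_inter_arcFun_eq ((p.1 + p.2) / 2) h0.le hπ
      rw [e1, e2] at this
      rw [← this]
      apply Set.Subset.antisymm
      · exact Set.inter_subset_inter_left _ fun x hx => hx.1
      · rintro x ⟨hx, hxc : f x = Real.cos h⟩
        have : x ∈ cutDisk S ∩ {x | Real.cos h ≤ f x} := by
          rw [hcap]; exact ⟨hx, hxc.ge⟩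
        exact ⟨this.1, hxc⟩
    have hab' : cutDisk S ∩ {x | (-f) x = -Real.cos h} =
        segment ℝ (circlePoint p.1) (circlePoint p.2) := by
      rw [← hab]
      ext x
      simp
    have hcl := (isCompact_cutDisk S).isClosed
    -- an interior point of the hull lies strictly on this side of the chord
    obtain ⟨z, hz⟩ := hi
    have hzc : f z < Real.cos h := by
      have hsub : convexHull ℝ F ⊆ {x | -Real.cos h ≤ (-f) x} :=
        convexHull_min (fun x hx => by
          have := arcFun_le_of_mem hF hp hx
          simpa using this) (convex_halfSpace_ge (-f).isLinear _)
      have := interior_mono hsub hz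
      rw [interior_le_of_ne_zero (neg_ne_zero.2 hf0)] at this
      have : -Real.cos h < (-f) z := this
      rw [neg_apply] at this
      linarith
    have hmid : circlePoint ((p.1 + p.2) / 2) ∈ cutDisk S ∩ {x | Real.cos h ≤ f x} := by
      rw [hcap]
      refine ⟨circlePoint_mem_unitDisk _, ?_⟩
      change Real.cos h ≤ f _
      rw [hf, arcFun_circlePoint, sub_self, Real.cos_zero]
      exact Real.cos_le_one h
    have hmidlt : Real.cos h < f (circlePoint ((p.1 + p.2) / 2)) := by
      rw [hf, arcFun_circlePoint, sub_self]
      exact Real.cos_lt_cos_of_nonneg_of_le_pi le_rfl hπ h0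
    have hsplit := boundaryLength_split hcl (convex_cutDisk S) hiS hab
      (hKsub (interior_subset hz)) hzc hmid.1 hmidlt
    -- The boundary inside an open set depends only on the set there, and beyond the chord the set
    -- coincides with the disk; what is cut off is therefore exactly the arc.
    have hfr : frontier (cutDisk S) ∩ {x | Real.cos h < f x} =
        circlePoint '' Set.Ioo p.1 p.2 := by
      have hop : IsOpen {x : Plane | Real.cos h < f x} := isOpen_lt continuous_const f.continuous
      have hin : cutDisk S ∩ {x | Real.cos h < f x} = unitDisk ∩ {x | Real.cos h < f x} := by
        have hsub : {x : Plane | Real.cos h < f x} ⊆ {x | Real.cos h ≤ f x} :=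
          fun x (hx : Real.cos h < f x) => hx.le
        rw [← Set.inter_eq_self_of_subset_right hsub, ← Set.inter_assoc, ← Set.inter_assoc, hcap]
      rw [← frontier_inter_open_inter hop, hin, frontier_inter_open_inter hop, frontier_unitDisk,
        hf, sphere_inter_cos_lt h0.le hπ, e1, e2]
    have hcut := boundaryLength_cut hcl (neg_ne_zero.2 hf0) hab'
    have hset : {x : Plane | -Real.cos h ≤ (-f) x} = {x | f x ≤ Real.cos h} := by
      ext x; simp
    have hset' : {x : Plane | -Real.cos h < (-f) x} = {x | f x < Real.cos h} := by
      ext x; simp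
    rw [hset, hset', edist_circlePoint hp.2.1.le (by linarith [hp.1, hp.2.2.1])] at hcut
    rw [hfr, hausdorffMeasure_arc hp.2.1.le (by linarith [hp.1, hp.2.2.1]), ih1] at hsplit
    have hsin : 0 ≤ Real.sin ((p.2 - p.1) / 2) := Real.sin_nonneg_of_nonneg_of_le_pi h0.le hπ
    have hle : ∀ q ∈ S, capExcess (q.2 - q.1) ≤ q.2 - q.1 := fun q hq =>
      capExcess_le (by linarith [(hS hq).2.1]) (by linarith [(hS hq).1, (hS hq).2.2.1])
    have hX : 0 ≤ 2 * Real.pi - ∑ q ∈ S, capExcess (q.2 - q.1) := by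
      have := Finset.sum_le_sum hle
      have := sum_gaps_le S hS
      linarith
    refine ⟨?_, ?_⟩
    · rw [hins, hcut]
      set μ := Measure.hausdorffMeasure 1 (frontier (cutDisk S) ∩ {x | f x < Real.cos h})
      have hμ : μ = ENNReal.ofReal (2 * Real.pi - ∑ q ∈ S, capExcess (q.2 - q.1) - (p.2 - p.1)) := by
        rw [ENNReal.ofReal_sub _ (by linarith [hp.2.1]), hsplit]
        exact (ENNReal.add_sub_cancel_right ENNReal.ofReal_ne_top).symm
      have hX2 : 0 ≤ 2 * Real.pi - ∑ q ∈ S, capExcess (q.2 - q.1) - (p.2 - p.1) := by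
        have h1 := Finset.sum_le_sum hle
        have h2 := sum_gaps_le (insert p S) (by
          rw [Finset.coe_insert, Set.insert_subset_iff]; exact ⟨hp, hS⟩)
        rw [Finset.sum_insert hpS] at h2
        linarith
      rw [hμ, ← ENNReal.ofReal_add hX2 (by linarith), Finset.sum_insert hpS]
      congr 1
      unfold capExcess
      ring
    · have hv := volume_cut (cutDisk S) hf0 (Real.cos h)
      rw [hcap, hf, volume_cap _ h0.le hπ, ih2, ← hf, ← hins] at hv
      have e3 : 2 * h = p.2 - p.1 := by rw [hh]; ring
      rw [e3] at hv
      rw [Finset.sum_insert hpS, add_comm (capArea _), ← sub_sub,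
        ENNReal.ofReal_sub _ (capArea_pos (by linarith [hp.2.1])).le, hv]
      exact (ENNReal.add_sub_cancel_right ENNReal.ofReal_ne_top).symm

/-- The points of the disk outside the hull of `F` lie in the caps over the gaps of `F`. -/
lemma exists_gap_of_notMem (hFc : IsClosed F)
    (hK : IsClosed (convexHull ℝ F)) (hφ : circlePoint φ ∈ F) {x : Plane} (hx : x ∈ unitDisk)
    (hxK : x ∉ convexHull ℝ F) :
    ∃ p ∈ gaps F φ, Real.cos ((p.2 - p.1) / 2) < arcFun ((p.1 + p.2) / 2) x := by
  have hπ := Real.pi_pos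
  -- A line separating x from the hull has a unit normal at some angle τ and a level ρ. The closed
  -- arc of half-width arccos ρ about τ contains no point of F, so it lies in a single gap, and the
  -- cap over that gap contains x.
  obtain ⟨g, r, hgK, hgx⟩ := geometric_hahn_banach_closed_point (convex_convexHull ℝ F) hK hxK
  set u := (InnerProductSpace.toDual ℝ Plane).symm g with hu
  have hgu : ∀ z, g z = inner ℝ u z := fun z => by rw [hu, InnerProductSpace.toDual_symm_apply]
  have hu0 : u ≠ 0 := by
    intro h0
    have h1 := hgK _ (subset_convexHull ℝ F hφ)
    rw [hgu, h0, inner_zero_left] at h1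
    rw [hgu, h0, inner_zero_left] at hgx
    linarith
  have hun : 0 < ‖u‖ := norm_pos_iff.2 hu0
  obtain ⟨τ, hτ, hτu⟩ := exists_circlePoint_eq (x := ‖u‖⁻¹ • u)
    (by rw [norm_smul, norm_inv, norm_norm, inv_mul_cancel₀ hun.ne']) φ
  have harc : ∀ z, arcFun τ z = ‖u‖⁻¹ * g z := fun z => by
    rw [arcFun_apply, hτu, inner_smul_left, hgu, conj_trivial]
  set ρ := ‖u‖⁻¹ * r with hρ
  have hρx : ρ < arcFun τ x := by
    rw [harc]; exact mul_lt_mul_of_pos_left hgx (inv_pos.2 hun)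
  have hρF : ∀ z ∈ F, arcFun τ z < ρ := fun z hz => by
    rw [harc]; exact mul_lt_mul_of_pos_left (hgK z (subset_convexHull ℝ F hz)) (inv_pos.2 hun)
  have hx1 : arcFun τ x ≤ 1 := by
    rw [arcFun_apply]
    refine (real_inner_le_norm _ _).trans ?_
    rw [norm_circlePoint, one_mul]
    rwa [unitDisk, mem_closedBall_zero_iff] at hx
  have hρ1 : -1 < ρ := by
    have h1 := hρF _ hφ
    rw [arcFun_circlePoint] at h1
    exact (Real.neg_one_le_cos _).trans_lt h1
  have hcos : Real.cos (Real.arccos ρ) = ρ := Real.cos_arccos hρ1.le (by linarith)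
  set h := Real.arccos ρ with hh
  have hpos : 0 < h := Real.arccos_pos.2 (by linarith)
  have hltπ : h ≤ Real.pi := Real.arccos_le_pi _
  have hnot : ∀ σ, τ - h ≤ σ → σ ≤ τ + h → circlePoint σ ∉ F := by
    intro σ h1 h2 hσ
    have h3 := hρF _ hσ
    rw [arcFun_circlePoint, ← hcos, ← Real.cos_abs (τ - σ)] at h3
    refine absurd h3 (not_lt.2 (Real.cos_le_cos_of_nonneg_of_le_pi (abs_nonneg _) hltπ ?_))
    rw [abs_le]
    constructor <;> linarith
  obtain ⟨p, hp, hp1, hp2⟩ := exists_gap hFc hφ hτ.1 hτ.2.le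
    (hnot τ (by linarith) (by linarith))
  refine ⟨p, hp, cos_lt_arcFun_of_subset hpos.le (by linarith [hp.1, hp.2.2.1])
    (τ := τ) (h := h) ?_ ?_ hx (by rwa [hcos])⟩
  · have : p.1 < τ - h := by
      by_contra hcon
      exact hnot p.1 (not_lt.1 hcon) (by linarith) hp.2.2.2.1
    linarith
  · have : τ + h < p.2 := by
      by_contra hcon
      exact hnot p.2 (by linarith) (not_lt.1 hcon) hp.2.2.2.2.1
    linarith

lemma convexHull_eq_cutDisk (hF : F ⊆ Metric.sphere 0 1) (hFc : IsClosed F)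
    (hK : IsClosed (convexHull ℝ F)) (hφ : circlePoint φ ∈ F) {S : Finset (ℝ × ℝ)}
    (hS : (S : Set (ℝ × ℝ)) = gaps F φ) : convexHull ℝ F = cutDisk S := by
  refine Set.Subset.antisymm (convexHull_subset_cutDisk hF S hS.subset) fun x hx => ?_
  by_contra hxK
  obtain ⟨p, hp, hpx⟩ := exists_gap_of_notMem hFc hK hφ hx.1 hxK
  exact absurd (hx.2 p (hS.ge hp)) (not_le.2 hpx)

lemma summable_gaps : Summable (fun p : gaps F φ => (p : ℝ × ℝ).2 - (p : ℝ × ℝ).1) ∧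
    ∑' p : gaps F φ, ((p : ℝ × ℝ).2 - (p : ℝ × ℝ).1) ≤ 2 * Real.pi := by
  classical
  have h0 : ∀ p : gaps F φ, 0 ≤ (p : ℝ × ℝ).2 - (p : ℝ × ℝ).1 := fun p => by
    linarith [p.2.2.1]
  have hle : ∀ S : Finset (gaps F φ), ∑ p ∈ S, ((p : ℝ × ℝ).2 - (p : ℝ × ℝ).1) ≤
      2 * Real.pi := by
    intro S
    have := sum_gaps_le (F := F) (φ := φ) (S.map (Function.Embedding.subtype _)) (by
      intro p hp
      simp only [Finset.coe_map, Function.Embedding.subtype_apply, Set.mem_image] at hp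
      obtain ⟨q, -, rfl⟩ := hp
      exact q.2)
    rwa [Finset.sum_map] at this
  have hs := summable_of_sum_le h0 hle
  exact ⟨hs, hs.tsum_le_of_sum_le hle⟩

/-- Boundary length and area of the convex hull of a closed subset of the circle. -/
lemma boundaryLength_le_of_subset_sphere (hF : F ⊆ Metric.sphere 0 1) (hFc : IsClosed F)
    (hK : IsClosed (convexHull ℝ F)) (hφ : circlePoint φ ∈ F)
    (hi : (interior (convexHull ℝ F)).Nonempty) :
    boundaryLength (convexHull ℝ F) ≤ ENNReal.ofReal
        (2 * Real.pi - ∑' p : gaps F φ, capExcess ((p : ℝ × ℝ).2 - (p : ℝ × ℝ).1)) ∧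
      ENNReal.ofReal (Real.pi - ∑' p : gaps F φ, capArea ((p : ℝ × ℝ).2 - (p : ℝ × ℝ).1)) ≤
        volume (convexHull ℝ F) := by
  classical
  have h0 : ∀ p : gaps F φ, 0 ≤ (p : ℝ × ℝ).2 - (p : ℝ × ℝ).1 := fun p => by
    linarith [p.2.2.1]
  obtain ⟨hs, hs2⟩ := summable_gaps (F := F) (φ := φ)
  have hsub : convexHull ℝ F ⊆ unitDisk :=
    convexHull_min (hF.trans Metric.sphere_subset_closedBall) convex_unitDisk
  have hcpt : IsCompact (convexHull ℝ F) := isCompact_unitDisk.of_isClosed_subset hK hsub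
  constructor
  -- Cutting off finitely many caps gives a set that encloses the hull, so monotonicity of the
  -- boundary length applies; then the finite set of gaps exhausts all gaps.
  · have hle : ∀ S : Finset (gaps F φ), boundaryLength (convexHull ℝ F) ≤ ENNReal.ofReal
        (2 * Real.pi - ∑ p ∈ S, capExcess ((p : ℝ × ℝ).2 - (p : ℝ × ℝ).1)) := by
      intro S
      have hS : ((S.map (Function.Embedding.subtype _) : Finset (ℝ × ℝ)) : Set (ℝ × ℝ)) ⊆
          gaps F φ := by
        intro p hp
        simp only [Finset.coe_map, Function.Embedding.subtype_apply, Set.mem_image] at hp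
        obtain ⟨q, -, rfl⟩ := hp
        exact q.2
      have h1 := (boundaryLength_cutDisk hF hi _ hS).1
      rw [Finset.sum_map] at h1
      change _ = ENNReal.ofReal
        (2 * Real.pi - ∑ p ∈ S, capExcess ((p : ℝ × ℝ).2 - (p : ℝ × ℝ).1)) at h1
      rw [← h1]
      exact boundaryLength_mono hcpt (convex_convexHull ℝ F) hi (isCompact_cutDisk _)
        (convexHull_subset_cutDisk hF _ hS)
    have hsE := summable_capExcess h0 hs hs2
    exact ge_of_tendsto (ENNReal.tendsto_ofReal (tendsto_const_nhds.sub hsE.hasSum))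
      (Filter.Eventually.of_forall hle)
  -- Gaps are disjoint nonempty open intervals. Countability permits subadditivity for the cover of
  -- the disk by the hull and all caps.
  · have hcount : (gaps F φ).Countable := by
      have hd : (gaps F φ).PairwiseDisjoint fun p => Set.Ioo p.1 p.2 := by
        intro p hp q hq hpq
        rw [Function.onFun, Set.disjoint_left]
        intro x hx hx'
        rcases gaps_disjoint hp hq hpq with h | h
        · linarith [hx.2, hx'.1]
        · linarith [hx.1, hx'.2]
      exact hd.countable_of_isOpen (fun p _ => isOpen_Ioo) fun p hp => Set.nonempty_Ioo.2 hp.2.1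
    have : Countable (gaps F φ) := hcount.to_subtype
    have hsA := summable_capArea h0 hs
    have hA0 : ∀ p : gaps F φ, 0 ≤ capArea ((p : ℝ × ℝ).2 - (p : ℝ × ℝ).1) := fun p =>
      (capArea_pos (by linarith [p.2.2.1])).le
    have hcov : unitDisk ⊆ convexHull ℝ F ∪ ⋃ p : gaps F φ, (unitDisk ∩
        {x | Real.cos (((p : ℝ × ℝ).2 - (p : ℝ × ℝ).1) / 2) ≤
          arcFun (((p : ℝ × ℝ).1 + (p : ℝ × ℝ).2) / 2) x}) := by
      intro x hx
      by_cases hxK : x ∈ convexHull ℝ F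
      · exact Or.inl hxK
      · obtain ⟨p, hp, hpx⟩ := exists_gap_of_notMem hFc hK hφ hx hxK
        exact Or.inr (Set.mem_iUnion.2 ⟨⟨p, hp⟩, hx, hpx.le⟩)
    have h1 : ENNReal.ofReal Real.pi ≤ volume (convexHull ℝ F) +
        ENNReal.ofReal (∑' p : gaps F φ, capArea ((p : ℝ × ℝ).2 - (p : ℝ × ℝ).1)) := by
      rw [← volume_unitDisk, ENNReal.ofReal_tsum_of_nonneg hA0 hsA]
      refine (measure_mono hcov).trans ((measure_union_le _ _).trans ?_)
      gcongr
      refine (measure_iUnion_le _).trans (ENNReal.tsum_le_tsum fun p => ?_)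
      rw [volume_cap _ (by linarith [h0 p]) (by linarith [p.2.1, p.2.2.2.1])]
      exact ENNReal.ofReal_le_ofReal (by rw [mul_div_cancel₀ _ two_ne_zero])
    rw [ENNReal.ofReal_sub _ (tsum_nonneg hA0)]
    exact tsub_le_iff_right.2 h1

end gaps

/-! ### Compact convex sets and their extreme points -/

lemma convexHull_range_eq_image {n : ℕ} (u : Fin n → Plane) :
    convexHull ℝ (Set.range u) = (fun w : Fin n → ℝ => ∑ i, w i • u i) '' stdSimplex ℝ (Fin n) := by
  have h : (fun w : Fin n → ℝ => ∑ i, w i • u i) = Fintype.linearCombination ℝ u := by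
    ext1 w
    rw [Fintype.linearCombination_apply]
  rw [h, ← convexHull_rangle_single_eq_stdSimplex, LinearMap.image_convexHull, ← Set.range_comp]
  congr 2
  ext1 i
  simp [Fintype.linearCombination_apply_single]

/-- Carathéodory in the plane: three points suffice, so the hull is a continuous image of the
product of a simplex and three copies of S. -/
lemma isCompact_convexHull {S : Set Plane} (hS : IsCompact S) : IsCompact (convexHull ℝ S) := by
  have h : convexHull ℝ S = (fun q : (Fin 3 → ℝ) × (Fin 3 → Plane) => ∑ i, q.1 i • q.2 i) ''
      (stdSimplex ℝ (Fin 3) ×ˢ Set.univ.pi fun _ => S) := by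
    apply Set.Subset.antisymm
    · intro x hx
      obtain ⟨ι, _, z, w, hz, hind, hw, hw1, hx'⟩ := eq_pos_convex_span_of_mem_convexHull hx
      have hne : Nonempty ι := by
        by_contra hcon
        rw [not_nonempty_iff] at hcon
        simp at hw1
      have hcard : Fintype.card ι ≤ Fintype.card (Fin 3) := by
        have := hind.card_le_finrank_succ
        have h2 := Submodule.finrank_le (vectorSpan ℝ (Set.range z))
        simp only [finrank_euclideanSpace, Fintype.card_fin] at h2 ⊢
        omega
      obtain ⟨e⟩ := Function.Embedding.nonempty_of_card_le hcard
      -- A left inverse of the embedding repeats points so that exactly three are listed.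
      have hσ := Function.invFun_surjective e.injective
      have hxz : x ∈ convexHull ℝ (Set.range (z ∘ Function.invFun e)) := by
        rw [Set.range_comp, hσ.range_eq, Set.image_univ, ← hx']
        exact (convex_convexHull ℝ _).sum_mem (fun i _ => (hw i).le) hw1
          fun i _ => subset_convexHull ℝ _ (Set.mem_range_self i)
      rw [convexHull_range_eq_image] at hxz
      obtain ⟨w', hw', rfl⟩ := hxz
      exact ⟨(w', _), ⟨hw', fun i _ => hz (Set.mem_range_self _)⟩, rfl⟩
    · rintro _ ⟨⟨w, u⟩, ⟨hw, hu⟩, rfl⟩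
      exact (convex_convexHull ℝ _).sum_mem (fun i _ => hw.1 i) hw.2
        fun i _ => subset_convexHull ℝ _ (hu i trivial)
  rw [h]
  exact ((isCompact_stdSimplex ℝ (Fin 3)).prod (isCompact_univ_pi fun _ => hS)).image (by fun_prop)

lemma mem_of_mem_extremePoints {K S : Set Plane} (hS : S ⊆ K) (hc : Convex ℝ K) {x : Plane}
    (hx : x ∈ K.extremePoints ℝ) (hxS : x ∈ convexHull ℝ S) : x ∈ S :=
  extremePoints_convexHull_subset (inter_extremePoints_subset_extremePoints_of_subset
    (convexHull_min hS hc) ⟨hxS, hx⟩)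

/-- Krein–Milman; since the hull of a compact planar set is closed, no closure is needed. -/
lemma subset_convexHull_of_extremePoints_subset {K S : Set Plane} (hK : IsCompact K)
    (hc : Convex ℝ K) (hS : IsCompact S) (h : K.extremePoints ℝ ⊆ S) : K ⊆ convexHull ℝ S := by
  rw [← closure_convexHull_extremePoints hK hc]
  exact closure_minimal (convexHull_mono h) (isCompact_convexHull hS).isClosed

/-! ### Triangles -/

section triangle
variable {v a b : Plane} {α β : Plane →L[ℝ] ℝ}

/-- `α` and `β` are the linear coordinates belonging to the basis `a - v`, `b - v`. -/
structure TriangleCoords (v a b : Plane) (α β : Plane →L[ℝ] ℝ) : Prop where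
  αa : α (a - v) = 1
  αb : α (b - v) = 0
  βa : β (a - v) = 0
  βb : β (b - v) = 1

lemma TriangleCoords.swap (h : TriangleCoords v a b α β) : TriangleCoords v b a β α :=
  ⟨h.βb, h.βa, h.αb, h.αa⟩

lemma TriangleCoords.ne (h : TriangleCoords v a b α β) : α ≠ 0 ∧ β ≠ 0 ∧ -(α + β) ≠ 0 := by
  refine ⟨?_, ?_, ?_⟩ <;> intro h0
  · have := h.αa; simp [h0] at this
  · have := h.βb; simp [h0] at this
  · have := DFunLike.congr_fun h0 (a - v)
    simp only [neg_apply, add_apply, zero_apply] at this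
    linarith [h.αa, h.βa]

lemma continuousLinearMap_apply_plane (f : Plane →L[ℝ] ℝ) (x : Plane) :
    f x = x 0 * f (EuclideanSpace.single 0 1) + x 1 * f (EuclideanSpace.single 1 1) := by
  have : x = x 0 • EuclideanSpace.single 0 (1 : ℝ) + x 1 • EuclideanSpace.single 1 (1 : ℝ) := by
    ext i
    fin_cases i <;> simp
  conv_lhs => rw [this]
  simp

lemma TriangleCoords.eq_zero (h : TriangleCoords v a b α β) {y : Plane} (h1 : α y = 0)
    (h2 : β y = 0) : y = 0 := by
  obtain ⟨e1, e2, e3, e4⟩ := h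
  rw [continuousLinearMap_apply_plane] at h1 h2 e1 e2 e3 e4
  set α0 := α (EuclideanSpace.single 0 1)
  set α1 := α (EuclideanSpace.single 1 1)
  set β0 := β (EuclideanSpace.single 0 1)
  set β1 := β (EuclideanSpace.single 1 1)
  set p := (a - v) 0
  set q := (a - v) 1
  set r := (b - v) 0
  set s := (b - v) 1
  have hdet : (α0 * β1 - α1 * β0) * (p * s - q * r) = 1 := by
    linear_combination (r * β0 + s * β1) * e1 + e4 - (p * β0 + q * β1) * e2
  have hd : α0 * β1 - α1 * β0 ≠ 0 := left_ne_zero_of_mul_eq_one hdet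
  ext i
  fin_cases i
  · refine (mul_eq_zero.1 (?_ : (α0 * β1 - α1 * β0) * y 0 = 0)).resolve_left hd
    linear_combination β1 * h1 - α1 * h2
  · refine (mul_eq_zero.1 (?_ : (α0 * β1 - α1 * β0) * y 1 = 0)).resolve_left hd
    linear_combination α0 * h2 - β0 * h1

lemma TriangleCoords.expand (h : TriangleCoords v a b α β) (x : Plane) :
    x = v + α (x - v) • (a - v) + β (x - v) • (b - v) := by
  have : x - v - α (x - v) • (a - v) - β (x - v) • (b - v) = 0 := by
    apply h.eq_zero <;> rw [map_sub, map_sub, map_smul, map_smul]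
    · rw [h.αa, h.αb]; simp
    · rw [h.βa, h.βb]; simp
  rw [sub_sub, sub_sub, sub_eq_zero] at this
  rw [add_assoc, ← this]

lemma TriangleCoords.convexHull_eq (h : TriangleCoords v a b α β) :
    convexHull ℝ {v, a, b} =
      {x | α v ≤ α x} ∩ {x | β v ≤ β x} ∩ {x | (-(α + β)) v - 1 ≤ (-(α + β)) x} := by
  have h1 := h.αa
  have h2 := h.αb
  have h3 := h.βa
  have h4 := h.βb
  rw [map_sub] at h1 h2 h3 h4
  apply Set.Subset.antisymm
  · refine convexHull_min ?_ (((convex_halfSpace_ge α.isLinear _).inter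
      (convex_halfSpace_ge β.isLinear _)).inter (convex_halfSpace_ge (-(α + β)).isLinear _))
    rintro x (rfl | rfl | rfl) <;>
    simp only [Set.mem_inter_iff, Set.mem_ofPred_eq, neg_apply, add_apply] <;>
    refine ⟨⟨?_, ?_⟩, ?_⟩ <;> linarith
  · rintro x ⟨⟨hα, hβ⟩, hs⟩
    simp only [Set.mem_ofPred_eq, neg_apply, add_apply] at hα hβ hs
    have hx := h.expand x
    have := (convex_convexHull ℝ {v, a, b}).sum_mem (t := Finset.univ)
      (w := ![1 - α (x - v) - β (x - v), α (x - v), β (x - v)]) (z := ![v, a, b])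
      (by
        intro i _
        fin_cases i <;> simp [map_sub] <;> linarith)
      (by rw [Fin.sum_univ_three]; simp; ring)
      (by
        intro i _
        refine subset_convexHull ℝ _ ?_
        fin_cases i <;> simp)
    rw [Fin.sum_univ_three] at this
    convert this using 1
    conv_lhs => rw [hx]
    simp only [Matrix.cons_val_zero, Matrix.cons_val_one, Matrix.cons_val]
    module

lemma TriangleCoords.mem_segment (h : TriangleCoords v a b α β) {x : Plane} (h0 : α v ≤ α x)
    (h1 : α x ≤ α v + 1) (hβ : β x = β v) : x ∈ segment ℝ v a := by
  rw [segment_eq_image']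
  refine ⟨α (x - v), ⟨by rw [map_sub]; linarith, by rw [map_sub]; linarith⟩, ?_⟩
  have := h.expand x
  rw [map_sub β, hβ, sub_self, zero_smul, add_zero] at this
  exact this.symm

lemma TriangleCoords.mem_segment_opposite (h : TriangleCoords v a b α β) {x : Plane}
    (h0 : α v ≤ α x) (h1 : β v ≤ β x) (hs : (-(α + β)) x = (-(α + β)) v - 1) :
    x ∈ segment ℝ a b := by
  simp only [neg_apply, add_apply] at hs
  rw [segment_eq_image']
  refine ⟨β (x - v), ⟨by rw [map_sub]; linarith, by rw [map_sub]; linarith⟩, ?_⟩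
  have := h.expand x
  have e : α (x - v) = 1 - β (x - v) := by rw [map_sub, map_sub]; linarith
  rw [e] at this
  conv_rhs => rw [this]
  module

lemma TriangleCoords.frontier_eq (h : TriangleCoords v a b α β) :
    frontier (convexHull ℝ {v, a, b}) = segment ℝ v a ∪ segment ℝ v b ∪ segment ℝ a b := by
  obtain ⟨n1, n2, n3⟩ := h.ne
  have h1 := h.αa
  have h2 := h.αb
  have h3 := h.βa
  have h4 := h.βb
  rw [map_sub] at h1 h2 h3 h4
  have hcl : IsClosed (convexHull ℝ {v, a, b}) :=
    (Set.toFinite {v, a, b}).isClosed_convexHull ℝ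
  have hsub : ∀ {x y : Plane}, x ∈ ({v, a, b} : Set Plane) → y ∈ ({v, a, b} : Set Plane) →
      segment ℝ x y ⊆ convexHull ℝ {v, a, b} := fun hx hy =>
    segment_subset_convexHull hx hy
  have hline : ∀ (f : Plane →L[ℝ] ℝ) {x y z : Plane}, f x = f y → z ∈ segment ℝ x y →
      f z = f x := by
    rintro f x y z hxy ⟨s, t, -, -, hst, rfl⟩
    rw [map_add, map_smul, map_smul, ← hxy, ← add_smul, hst, one_smul]
  rw [hcl.frontier_eq]
  apply Set.Subset.antisymm
  · rintro x ⟨hx, hxi⟩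
    rw [h.convexHull_eq, interior_inter, interior_inter, interior_le_of_ne_zero n1,
      interior_le_of_ne_zero n2, interior_le_of_ne_zero n3] at hxi
    rw [h.convexHull_eq] at hx
    obtain ⟨⟨hα, hβ⟩, hs⟩ := hx
    simp only [Set.mem_ofPred_eq] at hα hβ hs
    have hs' := hs
    simp only [neg_apply, add_apply] at hs'
    rcases hα.eq_or_lt with e1 | e1
    · exact Or.inl (Or.inr (h.swap.mem_segment hβ (by linarith) e1.symm))
    rcases hβ.eq_or_lt with e2 | e2
    · exact Or.inl (Or.inl (h.mem_segment hα (by linarith) e2.symm))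
    rcases hs.eq_or_lt with e3 | e3
    · exact Or.inr (h.mem_segment_opposite hα hβ e3.symm)
    · exact absurd ⟨⟨e1, e2⟩, e3⟩ hxi
  · have key : ∀ x ∈ convexHull ℝ {v, a, b}, (α x = α v ∨ β x = β v ∨
        (-(α + β)) x = (-(α + β)) v - 1) →
        x ∈ convexHull ℝ {v, a, b} \ interior (convexHull ℝ {v, a, b}) := by
      intro x hx hor
      refine ⟨hx, fun hxi => ?_⟩
      rw [h.convexHull_eq, interior_inter, interior_inter, interior_le_of_ne_zero n1,
        interior_le_of_ne_zero n2, interior_le_of_ne_zero n3] at hxi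
      obtain ⟨⟨hα, hβ⟩, hs⟩ := hxi
      simp only [Set.mem_ofPred_eq] at hα hβ hs
      rcases hor with e | e | e <;> linarith
    rintro x ((hx | hx) | hx)
    · exact key x (hsub (by simp) (by simp) hx) (Or.inr (Or.inl (hline β (by linarith) hx)))
    · exact key x (hsub (by simp) (by simp) hx) (Or.inl (hline α (by linarith) hx))
    · refine key x (hsub (by simp) (by simp) hx) (Or.inr (Or.inr ?_))
      rw [hline (-(α + β)) _ hx] <;> simp only [neg_apply, add_apply] <;> linarith

lemma TriangleCoords.boundaryLength_eq (h : TriangleCoords v a b α β) :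
    boundaryLength (convexHull ℝ {v, a, b}) = edist v a + edist v b + edist a b := by
  have h1 := h.αa
  have h2 := h.αb
  have h3 := h.βa
  have h4 := h.βb
  rw [map_sub] at h1 h2 h3 h4
  have := Measure.nullSingletonClass_hausdorff Plane (zero_lt_one' ℝ)
  have hm : ∀ x y : Plane, MeasurableSet (segment ℝ x y) := fun x y => by
    rw [← convexHull_pair]
    exact ((Set.toFinite {x, y}).isClosed_convexHull ℝ).measurableSet
  have hline : ∀ (f : Plane →L[ℝ] ℝ) {x y z : Plane}, f x = f y → z ∈ segment ℝ x y →
      f z = f x := by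
    rintro f x y z hxy ⟨s, t, -, -, hst, rfl⟩
    rw [map_add, map_smul, map_smul, ← hxy, ← add_smul, hst, one_smul]
  have hz : ∀ x y : Plane, α x = α y → β x = β y → x = y := fun x y e1 e2 =>
    sub_eq_zero.1 (h.eq_zero (by rw [map_sub, e1, sub_self]) (by rw [map_sub, e2, sub_self]))
  have hsum : ∀ z ∈ segment ℝ a b, α z + β z = α a + β a := fun z hz =>
    hline (α + β) (by simp only [add_apply]; linarith) hz
  rw [boundaryLength, h.frontier_eq, measure_union₀ (hm _ _).nullMeasurableSet,
    measure_union₀ (hm _ _).nullMeasurableSet, hausdorffMeasure_segment,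
    hausdorffMeasure_segment, hausdorffMeasure_segment]
  · refine measure_mono_null (t := {v}) ?_ (by simp)
    rintro x ⟨hx1, hx2⟩
    exact hz _ _ (hline α (by linarith) hx2) (hline β (by linarith) hx1)
  · refine measure_mono_null (t := {a, b}) ?_ (Set.Finite.measure_zero (by simp) _)
    rintro x ⟨hx1 | hx1, hx2⟩
    · have e1 := hline β (by linarith) hx1
      have e2 := hsum x hx2
      exact Or.inl (hz _ _ (by linarith) (by linarith))
    · have e1 := hline α (by linarith) hx1
      have e2 := hsum x hx2
      exact Or.inr (hz _ _ (by linarith) (by linarith))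

/-- Moving the vertex `v` parallel to the side `a b`. -/
lemma TriangleCoords.shear (h : TriangleCoords v a b α β) (s : ℝ) :
    TriangleCoords (v + s • (b - a)) a b ((1 - s) • α - s • β) (s • α + (1 + s) • β) := by
  have h1 := h.αa
  have h2 := h.αb
  have h3 := h.βa
  have h4 := h.βb
  rw [map_sub] at h1 h2 h3 h4
  constructor <;>
  simp only [map_sub, map_add, map_smul, smul_eq_mul, sub_apply, add_apply, smul_apply]
  · linear_combination (1 + s) * (1 - s) * h1 - s * (1 - s) * h2 - (1 + s) * s * h3 + s ^ 2 * h4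
  · linear_combination s * (1 - s) * h1 + (1 - s) ^ 2 * h2 - s ^ 2 * h3 - s * (1 - s) * h4
  · linear_combination s * (1 + s) * h1 - s ^ 2 * h2 + (1 + s) ^ 2 * h3 - s * (1 + s) * h4
  · linear_combination s ^ 2 * h1 + s * (1 - s) * h2 + s * (1 + s) * h3 + (1 - s ^ 2) * h4

/-- The functional α + β vanishes on b − a, so the displacement along b − a is a transvection of
determinant 1. The subsequent translation by `c` is chosen to keep a and b fixed. -/
lemma TriangleCoords.volume_shear (h : TriangleCoords v a b α β) (s : ℝ) :
    volume (convexHull ℝ {v + s • (b - a), a, b}) = volume (convexHull ℝ {v, a, b}) := by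
  have h1 := h.αa
  have h2 := h.αb
  have h3 := h.βa
  have h4 := h.βb
  rw [map_sub] at h1 h2 h3 h4
  set f : Module.Dual ℝ Plane := (-s) • ((α + β : Plane →L[ℝ] ℝ) : Plane →ₗ[ℝ] ℝ) with hf
  have hfx : ∀ x, f x = -s * (α x + β x) := fun x => by simp [hf]; ring
  set e := LinearMap.transvection f (b - a) with he
  have hdet : LinearMap.det e = 1 := by
    rw [he, LinearMap.transvection.det, hfx, map_sub, map_sub]
    linear_combination (-s) * (h2 - h1 + h4 - h3)
  set c := (s * (1 + α v + β v)) • (b - a) with hc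
  have hgv : ∀ x, (e.toAffineMap + AffineMap.const ℝ Plane c) x =
      x + (s * (1 + α v + β v) - s * (α x + β x)) • (b - a) := fun x => by
    simp only [AffineMap.coe_add, Pi.add_apply, LinearMap.coe_toAffineMap, AffineMap.const_apply,
      he, LinearMap.transvection.apply, hfx, hc]
    module
  have himg : convexHull ℝ {v + s • (b - a), a, b} =
      (fun x => c + x) '' (e '' convexHull ℝ {v, a, b}) := by
    have h5 : (fun x => c + x) '' (e '' convexHull ℝ {v, a, b}) =
        (e.toAffineMap + AffineMap.const ℝ Plane c) '' convexHull ℝ {v, a, b} := by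
      rw [Set.image_image]
      exact Set.image_congr fun x _ => add_comm _ _
    rw [h5, AffineMap.image_convexHull, Set.image_insert_eq, Set.image_pair, hgv, hgv, hgv]
    have e1 : s * (1 + α v + β v) - s * (α v + β v) = s := by ring
    have e2 : s * (1 + α v + β v) - s * (α a + β a) = 0 := by
      linear_combination -s * h1 - s * h3
    have e3 : s * (1 + α v + β v) - s * (α b + β b) = 0 := by
      linear_combination -s * h2 - s * h4
    rw [e1, e2, e3, zero_smul, add_zero, add_zero]
  rw [himg, Set.image_add_left, measure_preimage_add, Measure.addHaar_image_linearMap, hdet]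
  simp

/-- One of two opposite small displacements of the vertex increases the perimeter. -/
lemma TriangleCoords.exists_lt (h : TriangleCoords v a b α β) {s : ℝ} (hs : 0 < s) :
    ∃ t, |t| = s ∧ boundaryLength (convexHull ℝ {v, a, b}) <
      boundaryLength (convexHull ℝ {v + t • (b - a), a, b}) := by
  -- Strict triangle inequality: v is the midpoint of the two displaced points, and their difference
  -- vectors to x are not on one ray because f takes opposite nonzero values on them. It is used
  -- with β at a and with α at b.
  have key : ∀ (f : Plane →L[ℝ] ℝ) (x : Plane), f (x - v) = 0 → f (b - a) ≠ 0 →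
      2 * dist v x < dist (v + s • (b - a)) x + dist (v + (-s) • (b - a)) x := by
    intro f x hfx hf
    have hfx' : f (v - x) = 0 := by rw [← neg_sub, map_neg, hfx, neg_zero]
    have e1 : f (v + s • (b - a) - x) = s * f (b - a) := by
      rw [add_sub_right_comm, map_add, hfx', map_smul, zero_add, smul_eq_mul]
    have e2 : f (v + (-s) • (b - a) - x) = -s * f (b - a) := by
      rw [add_sub_right_comm, map_add, hfx', map_smul, zero_add, smul_eq_mul]
    have hns : ¬ SameRay ℝ (v + s • (b - a) - x) (v + (-s) • (b - a) - x) := by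
      intro hr
      obtain ⟨r₁, r₂, hr₁, hr₂, hr⟩ := hr.exists_pos
        (fun h0 => by rw [h0, map_zero] at e1; exact mul_ne_zero hs.ne' hf e1.symm)
        (fun h0 => by rw [h0, map_zero] at e2; exact mul_ne_zero (neg_ne_zero.2 hs.ne') hf e2.symm)
      have := congrArg f hr
      rw [map_smul, map_smul, e1, e2, smul_eq_mul, smul_eq_mul] at this
      have : (r₁ + r₂) * s * f (b - a) = 0 := by linear_combination this
      exact mul_ne_zero (mul_ne_zero (by positivity) hs.ne') hf this
    have := norm_add_lt_of_not_sameRay hns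
    rw [dist_eq_norm, dist_eq_norm, dist_eq_norm]
    convert this using 1
    rw [← abs_of_pos (two_pos (α := ℝ)), ← Real.norm_eq_abs, ← norm_smul]
    congr 1
    module
  have e : b - a = (b - v) - (a - v) := by abel
  have ka := key β a h.βa (by rw [e, map_sub, h.βa, h.βb]; norm_num)
  have kb := key α b h.αb (by rw [e, map_sub, h.αa, h.αb]; norm_num)
  have conv : ∀ t : ℝ, dist v a + dist v b < dist (v + t • (b - a)) a + dist (v + t • (b - a)) b →
      boundaryLength (convexHull ℝ {v, a, b}) <
        boundaryLength (convexHull ℝ {v + t • (b - a), a, b}) := by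
    intro t ht
    rw [h.boundaryLength_eq, (h.shear t).boundaryLength_eq]
    simp only [edist_dist]
    rw [← ENNReal.ofReal_add (by positivity) (by positivity),
      ← ENNReal.ofReal_add (by positivity) (by positivity),
      ← ENNReal.ofReal_add (by positivity) (by positivity),
      ← ENNReal.ofReal_add (by positivity) (by positivity)]
    have hp : 0 ≤ dist v a + dist v b + dist a b := by positivity
    exact (ENNReal.ofReal_lt_ofReal_iff_of_nonneg hp).2 (by linarith)
  rcases lt_or_ge (dist v a + dist v b) (dist (v + s • (b - a)) a + dist (v + s • (b - a)) b)
    with hlt | hge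
  · exact ⟨s, abs_of_pos hs, conv s hlt⟩
  · exact ⟨-s, by rw [abs_neg, abs_of_pos hs], conv (-s) (by linarith)⟩

end triangle

/-! ### Gluing convex sets along a chord -/

/-- A large multiple of the disk encloses K. Finiteness is what allows strict inequalities to
survive addition in `ENNReal`. -/
lemma boundaryLength_ne_top {K : Set Plane} (hK : IsCompact K) (hKc : Convex ℝ K)
    (hi : (interior K).Nonempty) : boundaryLength K ≠ ⊤ := by
  obtain ⟨R, hR⟩ := hK.isBounded.subset_closedBall 0
  have hR1 : 0 < max R 1 := by positivity
  have hsub : K ⊆ AffineMap.homothety (0 : Plane) (max R 1) '' unitDisk := by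
    intro x hx
    refine ⟨(max R 1)⁻¹ • x, ?_, ?_⟩
    · have := hR hx
      rw [mem_closedBall_zero_iff] at this
      rw [unitDisk, mem_closedBall_zero_iff, norm_smul, norm_inv, Real.norm_of_nonneg hR1.le,
        inv_mul_le_one₀ hR1]
      exact this.trans (le_max_left _ _)
    · simp [AffineMap.homothety_apply, hR1.ne']
  refine ne_top_of_le_ne_top ?_ (boundaryLength_mono hK hKc hi (isCompact_unitDisk.image (by
    exact (AffineMap.homothety (0 : Plane) (max R 1)).continuous_of_finiteDimensional)) hsub)
  rw [boundaryLength_homothety _ _ hR1, boundaryLength_unitDisk]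
  exact ENNReal.mul_ne_top ENNReal.ofReal_ne_top ENNReal.ofReal_ne_top

section glue
variable {f : Plane →L[ℝ] ℝ} {c : ℝ} {a b : Plane}

lemma exists_smul_eq_of_apply_eq_zero (hf : f ≠ 0) {x y : Plane} (hx : f x = 0) (hy : f y = 0)
    (hx0 : x ≠ 0) : ∃ τ : ℝ, y = τ • x := by
  rw [continuousLinearMap_apply_plane] at hx hy
  set f0 := f (EuclideanSpace.single 0 1) with h0
  set f1 := f (EuclideanSpace.single 1 1) with h1
  have hf' : f0 ≠ 0 ∨ f1 ≠ 0 := by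
    by_contra hcon
    push Not at hcon
    refine hf (ContinuousLinearMap.ext fun z => ?_)
    rw [continuousLinearMap_apply_plane, ← h0, ← h1, hcon.1, hcon.2]
    simp
  have hcross : x 0 * y 1 = x 1 * y 0 := by
    rcases hf' with h | h <;> refine mul_left_cancel₀ h ?_
    · linear_combination y 1 * hx - x 1 * hy
    · linear_combination x 0 * hy - y 0 * hx
  by_cases hx00 : x 0 = 0
  · have hx1 : x 1 ≠ 0 := fun h => hx0 (by ext i; fin_cases i <;> simp [hx00, h])
    refine ⟨y 1 / x 1, ?_⟩
    ext i
    fin_cases i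
    · have : y 0 = 0 := by
        rw [hx00, zero_mul, eq_comm, mul_eq_zero] at hcross
        exact hcross.resolve_left hx1
      simp [hx00, this]
    · simp [hx1]
  · refine ⟨y 0 / x 0, ?_⟩
    ext i
    fin_cases i
    · simp [hx00]
    · simp only [Fin.mk_one, PiLp.smul_apply, smul_eq_mul]
      field_simp
      linear_combination hcross

/-- Along the line f = c the functional g bounds the position on the side of a, and g' on the side
of b. -/
lemma mem_segment_of_support (hf : f ≠ 0) (ha : f a = c) (hb : f b = c) {g g' : Plane →L[ℝ] ℝ}
    (hga : g b < g a) (hgb : g' a < g' b) {z : Plane} (hz : f z = c) (h1 : g z ≤ g a)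
    (h2 : g' z ≤ g' b) : z ∈ segment ℝ a b := by
  have hab : b - a ≠ 0 := fun h => by rw [sub_eq_zero.1 h] at hga; exact lt_irrefl _ hga
  obtain ⟨τ, hτ⟩ := exists_smul_eq_of_apply_eq_zero hf (x := b - a) (y := z - a)
    (by rw [map_sub, ha, hb, sub_self]) (by rw [map_sub, ha, hz, sub_self]) hab
  have hz' : z = a + τ • (b - a) := by rw [← hτ, add_sub_cancel]
  rw [segment_eq_image']
  refine ⟨τ, ⟨?_, ?_⟩, hz'.symm⟩
  · rw [hz', map_add, map_smul, map_sub, smul_eq_mul] at h1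
    by_contra hcon
    nlinarith
  · rw [hz', map_add, map_smul, map_sub, smul_eq_mul] at h2
    by_contra hcon
    nlinarith

/-- A segment from one piece to the other crosses the line f = c. The functionals supporting the
union at a and b force the crossing point into the segment a b, which belongs to both pieces, so
each half of the segment stays in its piece. -/
lemma convex_union_of_support {C C' : Set Plane} (hf : f ≠ 0) (hC : Convex ℝ C)
    (hC' : Convex ℝ C') (h1 : ∀ x ∈ C, f x ≤ c) (h2 : ∀ x ∈ C', c ≤ f x) (ha : f a = c)
    (hb : f b = c) (hab : segment ℝ a b ⊆ C) (hab' : segment ℝ a b ⊆ C') {g g' : Plane →L[ℝ] ℝ}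
    (hg : ∀ x ∈ C ∪ C', g x ≤ g a) (hga : g b < g a) (hg' : ∀ x ∈ C ∪ C', g' x ≤ g' b)
    (hgb : g' a < g' b) : Convex ℝ (C ∪ C') := by
  have hlin : ∀ (g : Plane →L[ℝ] ℝ) {x y : Plane} {s t : ℝ} {d : ℝ}, 0 ≤ s → 0 ≤ t → s + t = 1 →
      g x ≤ d → g y ≤ d → g (s • x + t • y) ≤ d := by
    intro g x y s t d hs ht hst hx hy
    exact convex_halfSpace_le g.isLinear d hx hy hs ht hst
  have key : ∀ x ∈ C, ∀ y ∈ C', ∀ s t : ℝ, 0 ≤ s → 0 ≤ t → s + t = 1 →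
      s • x + t • y ∈ C ∪ C' := by
    intro x hx y hy s t hs ht hst
    rcases (h1 x hx).eq_or_lt with e | hlt
    · exact Or.inr (hC' (hab' (mem_segment_of_support hf ha hb hga hgb e (hg x (Or.inl hx))
        (hg' x (Or.inl hx)))) hy hs ht hst)
    rcases (h2 y hy).eq_or_lt with e | hlt'
    · exact Or.inl (hC hx (hab (mem_segment_of_support hf ha hb hga hgb e.symm (hg y (Or.inr hy))
        (hg' y (Or.inr hy)))) hs ht hst)
    have hd : 0 < f y - f x := by linarith
    set z := ((f y - c) / (f y - f x)) • x + ((c - f x) / (f y - f x)) • y with hz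
    have z0 : 0 ≤ (f y - c) / (f y - f x) := div_nonneg (by linarith) hd.le
    have z1 : 0 ≤ (c - f x) / (f y - f x) := div_nonneg (by linarith) hd.le
    have z2 : (f y - c) / (f y - f x) + (c - f x) / (f y - f x) = 1 := by field_simp; ring
    have hfz : f z = c := by
      rw [hz, map_add, map_smul, map_smul, smul_eq_mul, smul_eq_mul]
      field_simp
      ring
    have hzab : z ∈ segment ℝ a b := mem_segment_of_support hf ha hb hga hgb hfz
      (hlin g z0 z1 z2 (hg x (Or.inl hx)) (hg y (Or.inr hy)))
      (hlin g' z0 z1 z2 (hg' x (Or.inl hx)) (hg' y (Or.inr hy)))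
    have hs' : s = 1 - t := by linarith
    -- The point lies before or after the crossing point z.
    rcases le_or_gt (t * (f y - f x)) (c - f x) with hle | hgt
    · left
      have hcx : 0 < c - f x := by linarith
      have hw : s • x + t • y = (1 - t * (f y - f x) / (c - f x)) • x +
          (t * (f y - f x) / (c - f x)) • z := by
        rw [hz, hs']
        ext i
        simp only [PiLp.add_apply, PiLp.smul_apply, smul_eq_mul]
        field_simp
        ring
      rw [hw]
      refine hC hx (hab hzab) ?_ (by positivity) (by ring)
      rw [sub_nonneg, div_le_one hcx]
      exact hle
    · right
      have hcy : 0 < f y - c := by linarith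
      have hw : s • x + t • y = (s * (f y - f x) / (f y - c)) • z +
          (1 - s * (f y - f x) / (f y - c)) • y := by
        rw [hz, hs']
        ext i
        simp only [PiLp.add_apply, PiLp.smul_apply, smul_eq_mul]
        field_simp
        ring
      rw [hw]
      refine hC' (hab' hzab) hy (by positivity) ?_ (by ring)
      rw [sub_nonneg, div_le_one hcy, hs']
      nlinarith
  rw [convex_iff_forall_pos]
  rintro x (hx | hx) y (hy | hy) s t hs ht hst
  · exact Or.inl (hC hx hy hs.le ht.le hst)
  · exact key x hx y hy s t hs.le ht.le hst
  · rw [add_comm]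
    exact key y hy x hx t s ht.le hs.le (by rw [add_comm]; exact hst)
  · exact Or.inr (hC' hx hy hs.le ht.le hst)

/-- Enlarging the boundary length of one of the two parts into which a line cuts a convex set
enlarges the boundary length of the set. -/
lemma boundaryLength_lt_of_cut {K L : Set Plane} (hf : f ≠ 0) (hK : IsCompact K)
    (hKc : Convex ℝ K) (hi : (interior K).Nonempty) (hL : IsCompact L) (hLc : Convex ℝ L)
    (hLi : (interior L).Nonempty) (hKL : K ∩ {x | f x ≤ c} = L ∩ {x | f x ≤ c})
    (hab : K ∩ {x | f x = c} = segment ℝ a b) (hlo : ∃ p ∈ K, f p < c) (hhi : ∃ q ∈ K, c < f q)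
    (hhi' : ∃ q ∈ L, c < f q)
    (hlt : boundaryLength (K ∩ {x | c ≤ f x}) < boundaryLength (L ∩ {x | c ≤ f x})) :
    boundaryLength K < boundaryLength L := by
  obtain ⟨p, hp, hpc⟩ := hlo
  obtain ⟨q, hq, hqc⟩ := hhi
  obtain ⟨q', hq', hqc'⟩ := hhi'
  have hpL : p ∈ L := by
    have : p ∈ L ∩ {x | f x ≤ c} := hKL ▸ ⟨hp, hpc.le⟩
    exact this.1
  have hab' : L ∩ {x | f x = c} = segment ℝ a b := by
    rw [← hab]
    ext x
    have h := Set.ext_iff.1 hKL x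
    simp only [Set.mem_inter_iff, Set.mem_ofPred_eq] at h ⊢
    constructor
    · rintro ⟨h1, h2⟩; exact ⟨(h.2 ⟨h1, h2.le⟩).1, h2⟩
    · rintro ⟨h1, h2⟩; exact ⟨(h.1 ⟨h1, h2.le⟩).1, h2⟩
  rw [boundaryLength_split hK.isClosed hKc hi hab hp hpc hq hqc,
    boundaryLength_split hL.isClosed hLc hLi hab' hpL hpc hq' hqc']
  rw [boundaryLength_cut hK.isClosed hf hab, boundaryLength_cut hL.isClosed hf hab'] at hlt
  have hfr : frontier K ∩ {x | f x < c} = frontier L ∩ {x | f x < c} := by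
    have ho : IsOpen {x | f x < c} := isOpen_lt f.continuous continuous_const
    have hKL' : K ∩ {x | f x < c} = L ∩ {x | f x < c} := by
      have : {x | f x < c} = {x | f x ≤ c} ∩ {x | f x < c} := by
        ext x
        exact ⟨fun h => ⟨(show f x < c from h).le, h⟩, fun h => h.2⟩
      rw [this, ← Set.inter_assoc, hKL, Set.inter_assoc]
    rw [hK.isClosed.frontier_eq, hL.isClosed.frontier_eq, Set.sdiff_inter_right_comm,
      Set.sdiff_inter_right_comm, hKL']
    have : interior K ∩ {x | f x < c} = interior L ∩ {x | f x < c} := by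
      rw [← ho.interior_eq, ← interior_inter, ← interior_inter, hKL']
    ext x
    have h := Set.ext_iff.1 this x
    simp only [Set.mem_sdiff, Set.mem_inter_iff] at h ⊢
    tauto
  rw [hfr]
  refine ENNReal.add_lt_add_left ?_ ((ENNReal.add_lt_add_iff_right (edist_ne_top a b)).1 hlt)
  rw [← hfr]
  exact ne_top_of_le_ne_top (boundaryLength_ne_top hK hKc hi) (measure_mono Set.inter_subset_left)

end glue

/-! ### Pushing an isolated extreme point -/

/-- The two tangents from a point `v` to a compact convex set `W`. -/
lemma exists_tangents {W : Set Plane} (hW : IsCompact W) (hWc : Convex ℝ W) {v : Plane}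
    (hv : v ∉ W) (hi : (interior (convexHull ℝ (insert v W))).Nonempty) :
    ∃ a ∈ W, ∃ b ∈ W, ∃ α β, TriangleCoords v a b α β ∧ (∀ w ∈ W, α v ≤ α w ∧ β v ≤ β w) ∧
      (∀ w ∈ W, β w = β v → α w ≤ α a) ∧ ∀ w ∈ W, α w = α v → β w ≤ β b := by
  obtain ⟨g, u, hgv, hgW⟩ := geometric_hahn_banach_point_closed hWc hW.isClosed hv
  have hg : ∀ w ∈ W, 0 < g (w - v) := fun w hw => by rw [map_sub]; linarith [hgW w hw]
  set g0 := g (EuclideanSpace.single 0 1) with hg0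
  set g1 := g (EuclideanSpace.single 1 1) with hg1
  -- This is g turned by a right angle. The quotient e/g is the slope of the ray from v to a point
  -- of W, and its extreme values belong to the two tangents.
  set e : Plane →L[ℝ] ℝ := g0 • EuclideanSpace.proj 1 - g1 • EuclideanSpace.proj 0 with he
  have hge : ∀ y, g y = y 0 * g0 + y 1 * g1 := continuousLinearMap_apply_plane g
  have hey : ∀ y, e y = g0 * y 1 - g1 * y 0 := fun y => by simp [he]
  have hne : W.Nonempty := by
    rw [Set.nonempty_iff_ne_empty]
    rintro rfl
    simp at hi
  have hsq : 0 < g0 ^ 2 + g1 ^ 2 := by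
    obtain ⟨w, hw⟩ := hne
    by_contra hcon
    have h0 : g0 = 0 := by nlinarith [sq_nonneg g0, sq_nonneg g1]
    have h1 : g1 = 0 := by nlinarith [sq_nonneg g0, sq_nonneg g1]
    have := hg w hw
    rw [hge, h0, h1] at this
    simp at this
  set σ : Plane → ℝ := fun w => e (w - v) / g (w - v) with hσ
  have hσc : ContinuousOn σ W := by
    refine ContinuousOn.div (by fun_prop) (by fun_prop) fun w hw => (hg w hw).ne'
  obtain ⟨w0, hw0, hmin⟩ := hW.exists_isMinOn hne hσc
  obtain ⟨w1, hw1, hmax⟩ := hW.exists_isMaxOn hne hσc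
  have hlo : ∀ w ∈ W, 0 ≤ e (w - v) - σ w0 * g (w - v) := fun w hw => by
    have : σ w0 ≤ e (w - v) / g (w - v) := hmin hw
    rw [le_div_iff₀ (hg w hw)] at this
    linarith
  have hhi : ∀ w ∈ W, 0 ≤ σ w1 * g (w - v) - e (w - v) := fun w hw => by
    have : e (w - v) / g (w - v) ≤ σ w1 := hmax hw
    rw [div_le_iff₀ (hg w hw)] at this
    linarith
  have e0 : e (w0 - v) = σ w0 * g (w0 - v) := by
    exact (div_mul_cancel₀ _ (hg w0 hw0).ne').symm
  have e1 : e (w1 - v) = σ w1 * g (w1 - v) := by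
    exact (div_mul_cancel₀ _ (hg w1 hw1).ne').symm
  set ea : Plane →L[ℝ] ℝ := e - σ w0 • g with hea
  set eb : Plane →L[ℝ] ℝ := σ w1 • g - e with heb
  have eax : ∀ y, ea y = e y - σ w0 * g y := fun y => by simp [hea]
  have ebx : ∀ y, eb y = σ w1 * g y - e y := fun y => by simp [heb]
  -- Equal extreme slopes would put v and W on one line, contrary to the nonempty interior.
  have hlt : σ w0 < σ w1 := by
    refine lt_of_le_of_ne (hmin hw1) fun heq => ?_
    have hea0 : ea ≠ 0 := fun h0 => by
      have h1 := eax (WithLp.toLp 2 ![-g1, g0])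
      rw [h0, hey, hge] at h1
      simp at h1
      nlinarith
    have hall : ∀ x ∈ convexHull ℝ (insert v W), ea x = ea v := by
      have : convexHull ℝ (insert v W) ⊆ {x | ea x = ea v} := by
        refine convexHull_min ?_ (convex_hyperplane ea.isLinear _)
        rintro x (rfl | hx)
        · rfl
        · have h1 := hlo x hx
          have h2 := hhi x hx
          rw [← heq] at h2
          have := eax (x - v)
          rw [map_sub] at this
          change ea x = ea v
          linarith
      exact this
    obtain ⟨x, hx⟩ := hi
    have hsub : convexHull ℝ (insert v W) ⊆ {x | ea v ≤ ea x} := fun x hx => (hall x hx).ge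
    have hx' := interior_mono hsub hx
    rw [interior_le_of_ne_zero hea0] at hx'
    have hx' : ea v < ea x := hx'
    exact hx'.ne' (hall x (interior_subset hx))
  -- On each tangent the point of W farthest from v is chosen; this makes it an extreme point of the
  -- hull of v and W.
  obtain ⟨a, ⟨ha, ha0⟩, hamax⟩ := (hW.inter_right
    (isClosed_eq ea.continuous (continuous_const (y := ea v)))).exists_isMaxOn
    ⟨w0, hw0, by
      have := eax (w0 - v)
      rw [e0, sub_self, map_sub, sub_eq_zero] at this
      exact this⟩ eb.continuous.continuousOn
  obtain ⟨b, ⟨hb, hb0⟩, hbmax⟩ := (hW.inter_right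
    (isClosed_eq eb.continuous (continuous_const (y := eb v)))).exists_isMaxOn
    ⟨w1, hw1, by
      have := ebx (w1 - v)
      rw [e1, sub_self, map_sub, sub_eq_zero] at this
      exact this⟩ ea.continuous.continuousOn
  have ha0 : ea a = ea v := ha0
  have hb0 : eb b = eb v := hb0
  have ha0' : ea (a - v) = 0 := by rw [map_sub, ha0, sub_self]
  have hb0' : eb (b - v) = 0 := by rw [map_sub, hb0, sub_self]
  have hpa : 0 < eb (a - v) := by
    have h1 := eax (a - v)
    have h2 := ebx (a - v)
    nlinarith [hg a ha]
  have hpb : 0 < ea (b - v) := by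
    have h1 := eax (b - v)
    have h2 := ebx (b - v)
    nlinarith [hg b hb]
  have hW1 : ∀ w ∈ W, eb v ≤ eb w ∧ ea v ≤ ea w := fun w hw => by
    have h1 := eax (w - v)
    have h2 := ebx (w - v)
    have h3 := hlo w hw
    have h4 := hhi w hw
    rw [map_sub] at h1 h2
    constructor <;> linarith
  refine ⟨a, ha, b, hb, (eb (a - v))⁻¹ • eb, (ea (b - v))⁻¹ • ea, ⟨?_, ?_, ?_, ?_⟩, ?_, ?_, ?_⟩ <;>
  simp only [smul_apply, smul_eq_mul]
  · exact inv_mul_cancel₀ hpa.ne'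
  · rw [hb0', mul_zero]
  · rw [ha0', mul_zero]
  · exact inv_mul_cancel₀ hpb.ne'
  · intro w hw
    exact ⟨mul_le_mul_of_nonneg_left (hW1 w hw).1 (by positivity),
      mul_le_mul_of_nonneg_left (hW1 w hw).2 (by positivity)⟩
  · intro w hw hβ
    exact mul_le_mul_of_nonneg_left (hamax ⟨hw, mul_left_cancel₀ (by positivity) hβ⟩)
      (by positivity)
  · intro w hw hα
    exact mul_le_mul_of_nonneg_left (hbmax ⟨hw, mul_left_cancel₀ (by positivity) hα⟩)
      (by positivity)

lemma TriangleCoords.interior_nonempty {v a b : Plane} {α β : Plane →L[ℝ] ℝ}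
    (h : TriangleCoords v a b α β) : (interior (convexHull ℝ {v, a, b})).Nonempty := by
  obtain ⟨n1, n2, n3⟩ := h.ne
  have h1 := h.αa
  have h2 := h.αb
  have h3 := h.βa
  have h4 := h.βb
  rw [h.convexHull_eq, interior_inter, interior_inter, interior_le_of_ne_zero n1,
    interior_le_of_ne_zero n2, interior_le_of_ne_zero n3]
  refine ⟨v + (1 / 3 : ℝ) • (a - v) + (1 / 3 : ℝ) • (b - v), ⟨?_, ?_⟩, ?_⟩ <;>
  simp only [Set.mem_ofPred_eq, neg_apply, add_apply, map_add, map_smul, h1, h2, h3, h4,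
    smul_eq_mul] <;>
  linarith

/-- A point of a face of a cone over a segment is an extreme point if it is farthest away. -/
lemma TriangleCoords.mem_extremePoints {v a b : Plane} {α β : Plane →L[ℝ] ℝ}
    (h : TriangleCoords v a b α β) {W : Set Plane} (hWc : Convex ℝ W) (ha : a ∈ W)
    (hW : ∀ w ∈ W, α v ≤ α w ∧ β v ≤ β w) (hmax : ∀ w ∈ W, β w = β v → α w ≤ α a) :
    a ∈ (convexHull ℝ (insert v W)).extremePoints ℝ := by
  have h1 := h.αa
  have h3 := h.βa
  rw [map_sub] at h1 h3
  have hK : ∀ x ∈ convexHull ℝ (insert v W), β v ≤ β x ∧ (β x = β v → α x ≤ α a) := by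
    intro x hx
    rw [convexHull_insert ⟨a, ha⟩, hWc.convexHull_eq, mem_convexJoin] at hx
    obtain ⟨v', rfl, w, hw, s, t, hs, ht, hst, rfl⟩ := hx
    obtain ⟨hw1, hw2⟩ := hW w hw
    have hs' : s = 1 - t := by linarith
    simp only [map_add, map_smul, smul_eq_mul, hs']
    refine ⟨by linarith [mul_nonneg ht (sub_nonneg.2 hw2)], fun hβ => ?_⟩
    rcases ht.eq_or_lt with rfl | ht0
    · linarith
    · have : β w = β v' := by
        have h5 : t * (β w - β v') = 0 := by
          linarith
        linarith [(mul_eq_zero.1 h5).resolve_left ht0.ne']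
      have := hmax w hw this
      linarith [mul_nonneg ht (sub_nonneg.2 this), mul_nonneg (hs'.symm ▸ hs : 0 ≤ 1 - t)
        (by linarith : 0 ≤ α a - α v')]
  refine ⟨subset_convexHull ℝ _ (Or.inr ha), fun x hx y hy hxy => ?_⟩
  obtain ⟨s, t, hs, ht, hst, e⟩ := hxy
  obtain ⟨hx1, hx2⟩ := hK x hx
  obtain ⟨hy1, hy2⟩ := hK y hy
  have eα := congrArg α e
  have eβ := congrArg β e
  simp only [map_add, map_smul, smul_eq_mul] at eα eβ
  obtain rfl : s = 1 - t := by linarith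
  have hβx : β x = β v := by
    by_contra hne
    have := lt_of_le_of_ne hx1 (Ne.symm hne)
    linarith [mul_pos hs (sub_pos.2 this), mul_nonneg ht.le (sub_nonneg.2 hy1)]
  have hβy : β y = β v := by
    by_contra hne
    have := lt_of_le_of_ne hy1 (Ne.symm hne)
    linarith [mul_pos ht (sub_pos.2 this), mul_nonneg hs.le (sub_nonneg.2 hx1)]
  have hαx : α x = α a := by
    by_contra hne
    have := lt_of_le_of_ne (hx2 hβx) hne
    linarith [mul_pos hs (sub_pos.2 this), mul_nonneg ht.le (sub_nonneg.2 (hy2 hβy))]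
  exact sub_eq_zero.1 (h.eq_zero (by rw [map_sub, hαx, sub_self])
    (by rw [map_sub, hβx]; linarith))

/-- An isolated extreme point, all of whose neighbours have supporting lines that avoid it, can be
moved such that the area stays the same and the perimeter increases. -/
lemma exists_push {K : Set Plane} (hK : IsCompact K) (hKc : Convex ℝ K)
    (hi : (interior K).Nonempty) {v : Plane} (hv : v ∈ K.extremePoints ℝ)
    (hiso : v ∉ closure (K.extremePoints ℝ \ {v}))
    (hsupp : ∀ b ∈ K.extremePoints ℝ, b ≠ v → ∃ g : Plane →L[ℝ] ℝ, (∀ x ∈ K, g x ≤ g b) ∧ g v < g b)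
    {U : Set Plane} (hU : U ∈ nhds v) :
    ∃ v' ∈ U, boundaryLength K <
        boundaryLength (convexHull ℝ (insert v' (closure (K.extremePoints ℝ \ {v})))) ∧
      volume (convexHull ℝ (insert v' (closure (K.extremePoints ℝ \ {v})))) = volume K := by
  set S := closure (K.extremePoints ℝ \ {v}) with hS
  have hSK : S ⊆ K := closure_minimal (fun x hx => hx.1.1) hK.isClosed
  have hScpt : IsCompact S := hK.of_isClosed_subset isClosed_closure hSK
  set W := convexHull ℝ S with hW
  have hWK : W ⊆ K := convexHull_min hSK hKc
  have hvW : v ∉ W := fun h => hiso (mem_of_mem_extremePoints hSK hKc hv h)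
  have hWc : Convex ℝ W := convex_convexHull ℝ _
  have hWcpt : IsCompact W := isCompact_convexHull hScpt
  have hKW : K = convexHull ℝ (insert v W) := by
    apply Set.Subset.antisymm
    · refine subset_convexHull_of_extremePoints_subset hK hKc (hWcpt.insert v) fun x hx => ?_
      by_cases hxv : x = v
      · exact Or.inl hxv
      · exact Or.inr (subset_convexHull ℝ _ (subset_closure ⟨hx, hxv⟩))
    · exact convexHull_min (Set.insert_subset hv.1 hWK) hKc
  -- Beyond the line through the two tangent points, K is exactly the triangle v a b.
  obtain ⟨a, ha, b, hb, α, β, h, hWpos, hmaxa, hmaxb⟩ := exists_tangents hWcpt hWc hvW (hKW ▸ hi)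
  have h1 := h.αa
  have h2 := h.αb
  have h3 := h.βa
  have h4 := h.βb
  rw [map_sub] at h1 h2 h3 h4
  have haK := h.mem_extremePoints hWc ha hWpos hmaxa
  have hbK := h.swap.mem_extremePoints hWc hb (fun w hw => (hWpos w hw).symm) hmaxb
  rw [← hKW] at haK hbK
  have hav : a ≠ v := by rintro rfl; exact hvW ha
  have hbv : b ≠ v := by rintro rfl; exact hvW hb
  have hKα : ∀ x ∈ K, α v ≤ α x := by
    have : K ⊆ {x | α v ≤ α x} := by
      rw [hKW]
      refine convexHull_min ?_ (convex_halfSpace_ge α.isLinear _)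
      rintro x (rfl | hx)
      · exact le_refl (_ : ℝ)
      · exact (hWpos x hx).1
    exact this
  have hKβ : ∀ x ∈ K, β v ≤ β x := by
    have : K ⊆ {x | β v ≤ β x} := by
      rw [hKW]
      refine convexHull_min ?_ (convex_halfSpace_ge β.isLinear _)
      rintro x (rfl | hx)
      · exact le_refl (_ : ℝ)
      · exact (hWpos x hx).2
    exact this
  set f : Plane →L[ℝ] ℝ := -(α + β) with hf
  set c : ℝ := f v - 1 with hc
  have hfx : ∀ x, f x = -(α x + β x) := fun x => by simp [hf]
  have hf0 : f ≠ 0 := h.ne.2.2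
  have hfa : f a = c := by rw [hc, hfx, hfx]; linarith
  have hfb : f b = c := by rw [hc, hfx, hfx]; linarith
  set T := convexHull ℝ {v, a, b} with hT
  have hTK : T ⊆ K := convexHull_min (by
    rintro x (rfl | rfl | rfl)
    exacts [hv.1, haK.1, hbK.1]) hKc
  have hTcut : K ∩ {x | c ≤ f x} = T := by
    apply Set.Subset.antisymm
    · rintro x ⟨hx, hxc⟩
      rw [hT, h.convexHull_eq]
      exact ⟨⟨hKα x hx, hKβ x hx⟩, hxc⟩
    · intro x hx
      refine ⟨hTK hx, ?_⟩
      rw [hT, h.convexHull_eq] at hx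
      exact hx.2
  have hab : K ∩ {x | f x = c} = segment ℝ a b := by
    apply Set.Subset.antisymm
    · rintro x ⟨hx, hxc⟩
      exact h.mem_segment_opposite (hKα x hx) (hKβ x hx) hxc
    · exact (convex_iff_segment_subset.1 (hKc.inter (convex_hyperplane f.isLinear c)))
        ⟨haK.1, hfa⟩ ⟨hbK.1, hfb⟩
  have hSf : ∀ w ∈ S, f w ≤ c := by
    have : S ⊆ {x | f x ≤ c} := by
      refine closure_minimal ?_ (isClosed_le f.continuous continuous_const)
      rintro w ⟨hw, hwv⟩
      by_contra hlt
      have hlt : c < f w := not_le.1 hlt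
      have hwT : w ∈ T := hTcut ▸ ⟨hw.1, hlt.le⟩
      have := mem_of_mem_extremePoints (S := {v, a, b}) ((subset_convexHull ℝ _).trans hTK) hKc hw hwT
      rcases this with rfl | rfl | rfl
      · exact hwv rfl
      · exact hlt.ne' hfa
      · exact hlt.ne' hfb
    exact this
  have hWf : ∀ w ∈ W, f w ≤ c := convexHull_min hSf (convex_halfSpace_le f.isLinear c)
  -- supporting functionals
  obtain ⟨ga, hga, hgav⟩ := hsupp a haK hav
  obtain ⟨gb, hgb, hgbv⟩ := hsupp b hbK hbv
  -- The functional −β is maximal on K along the line v a, so subtracting β from `ga` keeps the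
  -- support at a and makes it strict at b, while strictness at v comes from `ga`. Thus nearby
  -- positions of v remain below the supporting lines at a and b, and the new triangle can be glued
  -- on.
  set g := ga - β with hg
  set g' := gb - α with hg'
  have hgK : ∀ x ∈ K, g x ≤ g a := fun x hx => by
    simp only [hg, sub_apply]
    linarith [hga x hx, hKβ x hx]
  have hgK' : ∀ x ∈ K, g' x ≤ g' b := fun x hx => by
    simp only [hg', sub_apply]
    linarith [hgb x hx, hKα x hx]
  have hgba : g b < g a := by
    simp only [hg, sub_apply]
    linarith [hga b hbK.1]
  have hgab : g' a < g' b := by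
    simp only [hg', sub_apply]
    linarith [hgb a haK.1]
  have hgv : g v < g a := by
    simp only [hg, sub_apply]
    linarith
  have hgv' : g' v < g' b := by
    simp only [hg', sub_apply]
    linarith
  -- the displacement
  obtain ⟨t, ht, hlt⟩ : ∃ t : ℝ, (v + t • (b - a) ∈ U ∧ g (v + t • (b - a)) < g a ∧
      g' (v + t • (b - a)) < g' b) ∧
      boundaryLength T < boundaryLength (convexHull ℝ {v + t • (b - a), a, b}) := by
    have hcont : Filter.Tendsto (fun t : ℝ => v + t • (b - a)) (nhds 0) (nhds v) := by
      have : Continuous fun t : ℝ => v + t • (b - a) := by fun_prop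
      simpa using this.tendsto 0
    have hev : ∀ᶠ t : ℝ in nhds 0, v + t • (b - a) ∈ U ∧ g (v + t • (b - a)) < g a ∧
        g' (v + t • (b - a)) < g' b :=
      (hcont.eventually hU).and ((hcont.eventually
        ((isOpen_lt g.continuous continuous_const).mem_nhds hgv)).and (hcont.eventually
        ((isOpen_lt g'.continuous continuous_const).mem_nhds hgv')))
    obtain ⟨ε, hε, hball⟩ := Metric.eventually_nhds_iff.1 hev
    obtain ⟨t, ht, hlt⟩ := h.exists_lt (half_pos hε)
    exact ⟨t, hball (by rw [dist_zero_right, Real.norm_eq_abs, ht]; linarith), hlt⟩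
  set v' := v + t • (b - a) with hv'
  obtain ⟨hvU, hgv1, hgv2⟩ := ht
  set T' := convexHull ℝ {v', a, b} with hT'
  have hfv' : f v' = f v := by
    rw [hv', map_add, map_smul, map_sub, hfa, hfb, sub_self, smul_zero, add_zero]
  have hT'f : ∀ x ∈ T', c ≤ f x := by
    refine convexHull_min ?_ (convex_halfSpace_ge f.isLinear c)
    rintro x (rfl | rfl | rfl)
    · change c ≤ f v'
      rw [hfv', hc]; linarith
    · exact hfa.ge
    · exact hfb.ge
  have hT'g : ∀ x ∈ T', g x ≤ g a := by
    refine convexHull_min ?_ (convex_halfSpace_le g.isLinear _)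
    rintro x (rfl | rfl | rfl)
    exacts [hgv1.le, le_refl (_ : ℝ), hgba.le]
  have hT'g' : ∀ x ∈ T', g' x ≤ g' b := by
    refine convexHull_min ?_ (convex_halfSpace_le g'.isLinear _)
    rintro x (rfl | rfl | rfl)
    exacts [hgv2.le, hgab.le, le_refl (_ : ℝ)]
  have habT' : segment ℝ a b ⊆ T' := segment_subset_convexHull (by simp) (by simp)
  have hconv : Convex ℝ ((K ∩ {x | f x ≤ c}) ∪ T') := by
    refine convex_union_of_support hf0 (hKc.inter (convex_halfSpace_le f.isLinear c))
      (convex_convexHull ℝ _) (fun x hx => hx.2) hT'f hfa hfb ?_ habT' (g := g) (g' := g') ?_ hgba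
      ?_ hgab
    · rw [← hab]
      rintro x ⟨hx, hxc⟩
      exact ⟨hx, le_of_eq hxc⟩
    · rintro x (hx | hx)
      exacts [hgK x hx.1, hT'g x hx]
    · rintro x (hx | hx)
      exacts [hgK' x hx.1, hT'g' x hx]
  -- A point of K on the far side lies on a segment from v to some w in W. This segment meets the
  -- line in a point z of the segment a b, hence of W, and the point lies between z and w.
  have hlow : K ∩ {x | f x ≤ c} ⊆ W := by
    rintro x ⟨hx, hxc⟩
    have hxc : f x ≤ c := hxc
    rw [hKW, convexHull_insert ⟨a, ha⟩, hWc.convexHull_eq, mem_convexJoin] at hx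
    obtain ⟨v₁, rfl, w, hw, s, r, hs, hr, hsr, rfl⟩ := hx
    have hwc := hWf w hw
    have hd : 0 < f v₁ - f w := by linarith
    rw [map_add, map_smul, map_smul, smul_eq_mul, smul_eq_mul] at hxc
    have hr' : r = 1 - s := by linarith
    have hsle : s * (f v₁ - f w) ≤ c - f w := by rw [hr'] at hxc; linarith
    rcases hs.eq_or_lt with rfl | hs0
    · have : r = 1 := by linarith
      simpa [this] using hw
    have hcw : 0 < c - f w := lt_of_lt_of_le (mul_pos hs0 hd) hsle
    set z := ((c - f w) / (f v₁ - f w)) • v₁ + ((f v₁ - c) / (f v₁ - f w)) • w with hz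
    have hvc : 0 ≤ f v₁ - c := by rw [hc]; linarith
    have hzK : z ∈ K := hKc hv.1 (hWK hw) (by positivity) (by positivity) (by field_simp; ring)
    have hfz : f z = c := by
      rw [hz, map_add, map_smul, map_smul, smul_eq_mul, smul_eq_mul]
      field_simp
      ring
    have hzW : z ∈ W := by
      have : z ∈ segment ℝ a b := hab ▸ ⟨hzK, hfz⟩
      exact (convex_iff_segment_subset.1 hWc) ha hb this
    have hw' : s • v₁ + r • w = (s * (f v₁ - f w) / (c - f w)) • z +
        (1 - s * (f v₁ - f w) / (c - f w)) • w := by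
      rw [hz, hr']
      ext i
      simp only [PiLp.add_apply, PiLp.smul_apply, smul_eq_mul]
      field_simp
      ring
    rw [hw']
    refine hWc hzW hw (by positivity) ?_ (by ring)
    rw [sub_nonneg, div_le_one hcw]
    exact hsle
  have hL : convexHull ℝ (insert v' S) = (K ∩ {x | f x ≤ c}) ∪ T' := by
    apply Set.Subset.antisymm
    · refine convexHull_min (Set.insert_subset (Or.inr (subset_convexHull ℝ _ (by simp))) ?_) hconv
      exact fun x hx => Or.inl ⟨hSK hx, hSf x hx⟩
    · have hWL : W ⊆ convexHull ℝ (insert v' S) := convexHull_mono (Set.subset_insert _ _)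
      refine Set.union_subset (hlow.trans hWL) (convexHull_min ?_ (convex_convexHull ℝ _))
      rintro x (rfl | rfl | rfl)
      exacts [subset_convexHull ℝ _ (Or.inl rfl), hWL ha, hWL hb]
  have hLcpt : IsCompact (convexHull ℝ (insert v' S)) := isCompact_convexHull (hScpt.insert v')
  set L := convexHull ℝ (insert v' S) with hLdef
  have hKL : K ∩ {x | f x ≤ c} = L ∩ {x | f x ≤ c} := by
    rw [hL]
    apply Set.Subset.antisymm
    · exact fun x hx => ⟨Or.inl hx, hx.2⟩
    · rintro x ⟨hx | hx, hxc⟩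
      · exact hx
      · have : x ∈ segment ℝ a b := mem_segment_of_support hf0 hfa hfb hgba hgab
          (le_antisymm hxc (hT'f x hx)) (hT'g x hx) (hT'g' x hx)
        rw [← hab] at this
        exact ⟨this.1, hxc⟩
  have hLT' : L ∩ {x | c ≤ f x} = T' := by
    rw [hL]
    apply Set.Subset.antisymm
    · rintro x ⟨hx | hx, hxc⟩
      · exact habT' (hab ▸ ⟨hx.1, le_antisymm hx.2 hxc⟩)
      · exact hx
    · exact fun x hx => ⟨Or.inr hx, hT'f x hx⟩
  refine ⟨v', hvU, ?_, ?_⟩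
  -- If nothing lies strictly on the far side, K is the triangle itself and the line does not split
  -- its boundary.
  · by_cases hp : ∃ p ∈ K, f p < c
    · refine boundaryLength_lt_of_cut hf0 hK hKc hi hLcpt (convex_convexHull ℝ _) ?_ hKL hab hp
        ⟨v, hv.1, by rw [hc]; linarith⟩ ⟨v', ?_, by rw [hfv', hc]; linarith⟩ ?_
      · refine (h.shear t).interior_nonempty.mono (interior_mono ?_)
        exact Set.subset_union_right.trans hL.ge
      · exact subset_convexHull ℝ _ (Or.inl rfl)
      · rw [hTcut, hLT']
        exact hlt
    · push Not at hp
      have e1 : K = T := by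
        rw [← hTcut]
        exact (Set.inter_eq_left.2 hp).symm
      have e2 : L = T' := by
        rw [← hLT', eq_comm, Set.inter_eq_left]
        intro x hx
        rw [hL] at hx
        rcases hx with hx | hx
        exacts [hp x hx.1, hT'f x hx]
      exact (congrArg boundaryLength e1).trans_lt (hlt.trans_eq (congrArg boundaryLength e2).symm)
  · rw [volume_cut L hf0 c, volume_cut K hf0 c, hKL, hLT', hTcut]
    congr 1
    exact h.volume_shear t

/-! ### Polygons as functions of their vertices -/

section vertices
variable {n : ℕ}

lemma le_of_forall_one_lt_le_ofReal_mul {x y : ENNReal}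
    (h : ∀ t : ℝ, 1 < t → x ≤ ENNReal.ofReal t * y) : x ≤ y := by
  have h1 : Filter.Tendsto (fun t : ℝ => ENNReal.ofReal t * y) (nhdsWithin 1 (Set.Ioi 1))
      (nhds (1 * y)) := by
    refine ENNReal.Tendsto.mul_const ?_ (Or.inl one_ne_zero)
    have := ((ENNReal.continuous_ofReal.tendsto 1).mono_left
      (nhdsWithin_le_nhds (s := Set.Ioi (1 : ℝ))))
    simpa using this
  rw [one_mul] at h1
  exact ge_of_tendsto h1 (Filter.eventually_of_mem self_mem_nhdsWithin h)

lemma mem_homothety_image_iff {t : ℝ} (ht : t ≠ 0) (p x : Plane) (K : Set Plane) :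
    x ∈ AffineMap.homothety p t '' K ↔ AffineMap.homothety p t⁻¹ x ∈ K := by
  constructor
  · rintro ⟨y, hy, rfl⟩
    rw [← AffineMap.homothety_mul_apply, inv_mul_cancel₀ ht, AffineMap.homothety_one]
    exact hy
  · intro h
    refine ⟨_, h, ?_⟩
    rw [← AffineMap.homothety_mul_apply, mul_inv_cancel₀ ht, AffineMap.homothety_one]
    rfl

/-- Otherwise some f separates x from the new hull. The old vertices are within r/4 of the new ones,
so f ≤ f x + ‖f‖r/4 on the old hull; but f is larger at the point x + (r/2)y of the ball about x,
where f y > ‖f‖/2. -/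
lemma eventually_mem_convexHull_range {V₀ : Fin n → Plane} {x : Plane}
    (hx : x ∈ interior (convexHull ℝ (Set.range V₀))) :
    ∀ᶠ V in nhds V₀, x ∈ convexHull ℝ (Set.range V) := by
  obtain ⟨r, hr, hball⟩ := Metric.isOpen_iff.1 isOpen_interior x hx
  refine Metric.eventually_nhds_iff.2 ⟨r / 4, by positivity, fun V hV => ?_⟩
  by_contra hcon
  obtain ⟨f, u, hfu, hfx⟩ := geometric_hahn_banach_closed_point (convex_convexHull ℝ _)
    ((Set.finite_range V).isClosed_convexHull ℝ) hcon
  obtain ⟨y, hy1, hy2⟩ : ∃ y : Plane, ‖y‖ ≤ 1 ∧ ‖f‖ / 2 < f y := by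
    have hf0 : f ≠ 0 := by
      rintro rfl
      have : (convexHull ℝ (Set.range V)).Nonempty := by
        rw [convexHull_nonempty_iff]
        by_contra hne
        rw [Set.not_nonempty_iff_eq_empty, Set.range_eq_empty_iff] at hne
        rw [Set.range_eq_empty] at hx
        simp at hx
      obtain ⟨z, hz⟩ := this
      have := hfu z hz
      simp at this hfx
      linarith
    have hfn : 0 < ‖f‖ := norm_pos_iff.2 hf0
    obtain ⟨y, hy, hfy⟩ := f.exists_lt_apply_of_lt_opNorm (r := ‖f‖ / 2) (by linarith)
    rcases le_or_gt 0 (f y) with h0 | h0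
    · exact ⟨y, hy.le, by rwa [Real.norm_of_nonneg h0] at hfy⟩
    · exact ⟨-y, by rw [norm_neg]; exact hy.le, by rwa [map_neg, ← Real.norm_of_nonpos h0.le]⟩
  have hsub : convexHull ℝ (Set.range V₀) ⊆ {z | f z ≤ f x + ‖f‖ * (r / 4)} := by
    refine convexHull_min ?_ (convex_halfSpace_le f.isLinear _)
    rintro _ ⟨i, rfl⟩
    have h1 := hfu (V i) (subset_convexHull ℝ _ (Set.mem_range_self i))
    have h2 : ‖V₀ i - V i‖ ≤ r / 4 := by
      rw [← dist_eq_norm, dist_comm]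
      exact (dist_le_pi_dist V V₀ i).trans hV.le
    have h3 := (le_abs_self _).trans (f.le_opNorm (V₀ i - V i))
    rw [map_sub] at h3
    have h4 := mul_le_mul_of_nonneg_left h2 (norm_nonneg f)
    change f (V₀ i) ≤ _
    linarith
  have hmem : x + (r / 2) • y ∈ convexHull ℝ (Set.range V₀) := by
    refine interior_subset (hball ?_)
    rw [Metric.mem_ball, dist_self_add_left, norm_smul, Real.norm_of_nonneg (by positivity)]
    nlinarith
  have := hsub hmem
  rw [Set.mem_ofPred_eq, map_add, map_smul, smul_eq_mul] at this
  nlinarith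

/-- Nearby polygons are nested between homothetic copies of each other. This controls length and
area at a nondegenerate polygon without any formula for them. -/
lemma eventually_subset_homothety {V₀ : Fin n → Plane} {p : Plane}
    (hp : p ∈ interior (convexHull ℝ (Set.range V₀))) {t : ℝ} (ht : 1 < t) :
    ∀ᶠ V in nhds V₀,
      convexHull ℝ (Set.range V) ⊆ AffineMap.homothety p t '' convexHull ℝ (Set.range V₀) ∧
      convexHull ℝ (Set.range V₀) ⊆ AffineMap.homothety p t '' convexHull ℝ (Set.range V) := by
  have ht0 : t ≠ 0 := by positivity
  have hc := convex_convexHull ℝ (Set.range V₀)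
  have hint := hc.closure_subset_image_homothety_interior_of_one_lt hp t ht
  have hshrink : ∀ x ∈ convexHull ℝ (Set.range V₀),
      AffineMap.homothety p t⁻¹ x ∈ interior (convexHull ℝ (Set.range V₀)) := fun x hx =>
    (mem_homothety_image_iff ht0 p x _).1 (hint (subset_closure hx))
  have h1 : ∀ᶠ V in nhds V₀, ∀ i : Fin n,
      AffineMap.homothety p t⁻¹ (V i) ∈ interior (convexHull ℝ (Set.range V₀)) := by
    refine Filter.eventually_all.2 fun i => ?_
    have hcont : Continuous fun V : Fin n → Plane => AffineMap.homothety p t⁻¹ (V i) :=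
      (AffineMap.homothety_continuous p t⁻¹).comp (continuous_apply i)
    exact hcont.continuousAt.eventually (isOpen_interior.mem_nhds
      (hshrink _ (subset_convexHull ℝ _ (Set.mem_range_self i))))
  have h2 : ∀ᶠ V in nhds V₀, ∀ i : Fin n,
      AffineMap.homothety p t⁻¹ (V₀ i) ∈ convexHull ℝ (Set.range V) :=
    Filter.eventually_all.2 fun i =>
      eventually_mem_convexHull_range (hshrink _ (subset_convexHull ℝ _ (Set.mem_range_self i)))
  filter_upwards [h1, h2] with V hV1 hV2
  constructor
  · refine convexHull_min ?_ (hc.affine_image _)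
    rintro _ ⟨i, rfl⟩
    exact (mem_homothety_image_iff ht0 _ _ _).2 (interior_subset (hV1 i))
  · refine convexHull_min ?_ ((convex_convexHull ℝ _).affine_image _)
    rintro _ ⟨i, rfl⟩
    exact (mem_homothety_image_iff ht0 _ _ _).2 (hV2 i)

lemma interior_nonempty_of_homothety {K : Set Plane} {p : Plane} {t : ℝ} (ht : t ≠ 0)
    (h : (interior (AffineMap.homothety p t '' K)).Nonempty) : (interior K).Nonempty := by
  have e : (AffineMap.homothety p t : Plane → Plane) =
      (IsometryEquiv.vaddConst p).toHomeomorph ∘ (Homeomorph.smulOfNeZero t ht) ∘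
        (IsometryEquiv.vaddConst p).symm.toHomeomorph := by
    ext x
    simp [AffineMap.homothety_apply]
  rw [e] at h
  simp only [Set.image_comp, ← Homeomorph.image_interior] at h
  simpa only [Set.image_nonempty] using h

lemma eventually_boundaryLength_lt {V₀ : Fin n → Plane}
    (hi : (interior (convexHull ℝ (Set.range V₀))).Nonempty) {y : ENNReal}
    (hy : boundaryLength (convexHull ℝ (Set.range V₀)) < y) :
    ∀ᶠ V in nhds V₀, boundaryLength (convexHull ℝ (Set.range V)) < y := by
  obtain ⟨t, ht, hty⟩ : ∃ t : ℝ, 1 < t ∧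
      ENNReal.ofReal t * boundaryLength (convexHull ℝ (Set.range V₀)) < y := by
    by_contra hcon
    push Not at hcon
    exact not_le.2 hy (le_of_forall_one_lt_le_ofReal_mul hcon)
  obtain ⟨p, hp⟩ := hi
  filter_upwards [eventually_subset_homothety hp ht] with V hV
  have ht0 : 0 < t := by linarith
  have hiV : (interior (convexHull ℝ (Set.range V))).Nonempty :=
    interior_nonempty_of_homothety ht0.ne' (⟨p, interior_mono hV.2 hp⟩ : (interior (AffineMap.homothety p t '' _)).Nonempty)
  refine (boundaryLength_mono ((Set.finite_range V).isCompact_convexHull ℝ) (convex_convexHull ℝ _)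
    hiV (((Set.finite_range V₀).isCompact_convexHull ℝ).image
    (AffineMap.homothety_continuous p t)) hV.1).trans_lt ?_
  rwa [boundaryLength_homothety _ _ ht0]

lemma isClosed_volume_le (α : ENNReal) :
    IsClosed {V : Fin n → Plane | volume (convexHull ℝ (Set.range V)) ≤ α} := by
  refine isClosed_iff_frequently.2 fun V₀ hV₀ => ?_
  change volume _ ≤ α
  rcases (interior (convexHull ℝ (Set.range V₀))).eq_empty_or_nonempty with he | ⟨p, hp⟩
  · have h := (convex_convexHull ℝ (Set.range V₀)).addHaar_frontier volume
    rw [((Set.finite_range V₀).isClosed_convexHull ℝ).frontier_eq, he, Set.sdiff_empty] at h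
    rw [h]
    exact zero_le
  · refine le_of_forall_one_lt_le_ofReal_mul fun t ht => ?_
    -- The area scales with the square of the ratio, so the ratio √t produces the factor t.
    have ht' : 1 < Real.sqrt t := by
      rw [Real.lt_sqrt zero_le_one]; simpa using ht
    obtain ⟨V, hV, hVα⟩ := ((eventually_subset_homothety hp ht').and_frequently hV₀).exists
    have := measure_mono (μ := volume) hV.2
    rw [volume_homothety, Real.sq_sqrt (by linarith)] at this
    exact this.trans (by gcongr; exact hVα)

lemma isClosed_mem_convexHull (x : Plane) :
    IsClosed {V : Fin n → Plane | x ∈ convexHull ℝ (Set.range V)} := by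
  rw [← isOpen_compl_iff, isOpen_iff_mem_nhds]
  intro V₀ hV₀
  obtain ⟨f, u, hfu, hfx⟩ := geometric_hahn_banach_closed_point (convex_convexHull ℝ _)
    ((Set.finite_range V₀).isClosed_convexHull ℝ) hV₀
  have h : ∀ᶠ V in nhds V₀, ∀ i : Fin n, f (V i) < u := Filter.eventually_all.2 fun i => by
    have hcont : Continuous fun V : Fin n → Plane => f (V i) := by fun_prop
    exact hcont.continuousAt.eventually
      (isOpen_Iio.mem_nhds (hfu _ (subset_convexHull ℝ _ (Set.mem_range_self i))))
  filter_upwards [h] with V hV hx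
  have : convexHull ℝ (Set.range V) ⊆ {z | f z < u} :=
    convexHull_min (by rintro _ ⟨i, rfl⟩; exact hV i) (convex_halfSpace_lt f.isLinear u)
  exact lt_asymm hfx (this hx)

/-- Boundary length fails to be upper semicontinuous at a nondegenerate segment, since thin polygons
around it have about twice its length. Truncation from below at b restores semicontinuity if b
dominates the limits at degenerate polygons. -/
lemma exists_max_boundaryLength {𝒱 : Set (Fin n → Plane)} (hcpt : IsCompact 𝒱)
    (hne : 𝒱.Nonempty) (b : ENNReal)
    (hdeg : ∀ V₀ ∈ 𝒱, interior (convexHull ℝ (Set.range V₀)) = ∅ → ∀ y > b,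
      ∀ᶠ V in nhds V₀, boundaryLength (convexHull ℝ (Set.range V)) < y) :
    ∃ V₀ ∈ 𝒱, ∀ V ∈ 𝒱, boundaryLength (convexHull ℝ (Set.range V)) ≤
      max (boundaryLength (convexHull ℝ (Set.range V₀))) b := by
  have husc : UpperSemicontinuousOn
      (fun V : Fin n → Plane => max (boundaryLength (convexHull ℝ (Set.range V))) b) 𝒱 := by
    intro V₀ hV₀ y hy
    have hy := max_lt_iff.1 hy
    refine Filter.Eventually.filter_mono nhdsWithin_le_nhds ?_
    rcases (interior (convexHull ℝ (Set.range V₀))).eq_empty_or_nonempty with he | hi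
    · filter_upwards [hdeg V₀ hV₀ he y hy.2] with V hV using max_lt hV hy.2
    · filter_upwards [eventually_boundaryLength_lt hi hy.1] with V hV using max_lt hV hy.2
  obtain ⟨V₀, hV₀, hmax⟩ := husc.exists_isMaxOn hne hcpt
  exact ⟨V₀, hV₀, fun V hV => (le_max_left _ _).trans (hmax hV)⟩

end vertices

/-- The convex hulls of at most `n` points. -/
def polygons (n : ℕ) : Set (Set Plane) :=
  {P | ∃ V : Finset Plane, V.Nonempty ∧ V.card ≤ n ∧ P = convexHull ℝ (V : Set Plane)}

lemma mem_polygons_iff {n : ℕ} {P : Set Plane} :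
    P ∈ polygons n ↔ ∃ V : Fin n → Plane, P.Nonempty ∧ P = convexHull ℝ (Set.range V) := by
  classical
  constructor
  · rintro ⟨V, hV, hcard, rfl⟩
    have : Nonempty V := hV.to_subtype
    obtain ⟨e⟩ := Function.Embedding.nonempty_of_card_le
      (show Fintype.card V ≤ Fintype.card (Fin n) by simpa using hcard)
    refine ⟨fun i => (Function.invFun e i : V), by simpa using hV, ?_⟩
    congr 1
    rw [show (fun i => ((Function.invFun e i : V) : Plane)) = Subtype.val ∘ Function.invFun e from rfl,
      Set.range_comp, (Function.invFun_surjective e.injective).range_eq]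
    simp
  · rintro ⟨V, hne, rfl⟩
    refine ⟨Finset.univ.image V, ?_, Finset.card_image_le.trans (by simp), by simp⟩
    rw [convexHull_nonempty_iff] at hne
    rw [← Finset.coe_nonempty]
    simpa using hne

lemma polygons_mono {m n : ℕ} (h : m ≤ n) : polygons m ⊆ polygons n :=
  fun _ ⟨V, h1, h2, h3⟩ => ⟨V, h1, h2.trans h, h3⟩

/-- The polygons with at most `n` vertices and area at most `α` between `X` and `E`. -/
def polygonsBetween (n : ℕ) (X E : Set Plane) (α : ENNReal) : Set (Set Plane) :=
  {P | P ∈ polygons n ∧ X ⊆ P ∧ P ⊆ E ∧ volume P ≤ α}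

lemma exists_max_polygonsBetween {n : ℕ} {X E : Set Plane} {α : ENNReal} (hE : IsCompact E)
    (hEc : Convex ℝ E) (hne : (polygonsBetween n X E α).Nonempty) (b : ENNReal)
    (hdeg : ∀ V₀ : Fin n → Plane, Set.range V₀ ⊆ E → X ⊆ convexHull ℝ (Set.range V₀) →
      interior (convexHull ℝ (Set.range V₀)) = ∅ → ∀ y > b,
      ∀ᶠ V in nhds V₀, boundaryLength (convexHull ℝ (Set.range V)) < y) :
    ∃ P ∈ polygonsBetween n X E α, ∀ Q ∈ polygonsBetween n X E α,
      boundaryLength Q ≤ max (boundaryLength P) b := by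
  set 𝒱 : Set (Fin n → Plane) := (Set.univ.pi fun _ => E) ∩
    ((⋂ x ∈ X, {V | x ∈ convexHull ℝ (Set.range V)}) ∩
      {V | volume (convexHull ℝ (Set.range V)) ≤ α}) with h𝒱
  have hcpt : IsCompact 𝒱 := (isCompact_univ_pi fun _ => hE).inter_right
    ((isClosed_biInter fun x _ => isClosed_mem_convexHull x).inter (isClosed_volume_le α))
  have hmem : ∀ V : Fin n → Plane, V ∈ 𝒱 ↔ Set.range V ⊆ E ∧ X ⊆ convexHull ℝ (Set.range V) ∧
      volume (convexHull ℝ (Set.range V)) ≤ α := by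
    intro V
    simp only [h𝒱, Set.mem_inter_iff, Set.mem_univ_pi, Set.mem_iInter, Set.range_subset_iff]
    rfl
  have hP : ∀ P ∈ polygonsBetween n X E α, ∃ V ∈ 𝒱, P = convexHull ℝ (Set.range V) := by
    rintro P ⟨hP, hXP, hPE, hPα⟩
    obtain ⟨V, -, rfl⟩ := mem_polygons_iff.1 hP
    exact ⟨V, (hmem V).2 ⟨(subset_convexHull ℝ _).trans hPE, hXP, hPα⟩, rfl⟩
  obtain ⟨P₀, hP₀⟩ := hne
  obtain ⟨V₁, hV₁, rfl⟩ := hP P₀ hP₀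
  have hn : Nonempty (Fin n) := by
    obtain ⟨W, hW, hWn, -⟩ := hP₀.1
    have := hW.card_pos
    exact ⟨⟨0, by omega⟩⟩
  obtain ⟨V₀, hV₀, hmax⟩ := exists_max_boundaryLength hcpt ⟨V₁, hV₁⟩ b
    fun V hV => hdeg V ((hmem V).1 hV).1 ((hmem V).1 hV).2.1
  obtain ⟨h1, h2, h3⟩ := (hmem V₀).1 hV₀
  refine ⟨_, ⟨mem_polygons_iff.2 ⟨V₀, ?_, rfl⟩, h2, convexHull_min h1 hEc, h3⟩, fun Q hQ => ?_⟩
  · exact (Set.range_nonempty V₀).convexHull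
  · obtain ⟨V, hV, rfl⟩ := hP Q hQ
    exact hmax V hV

/-! ### Polygons of maximal perimeter -/

/-- An isolated extreme point has a supporting line that avoids any given other extreme point. -/
lemma exists_support_of_isolated {K : Set Plane} (hK : IsCompact K) (hKc : Convex ℝ K) {b v : Plane}
    (hb : b ∈ K.extremePoints ℝ) (hiso : b ∉ closure (K.extremePoints ℝ \ {b}))
    (hv : v ∈ K.extremePoints ℝ) (hbv : b ≠ v) :
    ∃ g : Plane →L[ℝ] ℝ, (∀ x ∈ K, g x ≤ g b) ∧ g v < g b := by
  set S := closure (K.extremePoints ℝ \ {b}) with hS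
  have hSK : S ⊆ K := closure_minimal (fun x hx => hx.1.1) hK.isClosed
  have hScpt : IsCompact S := hK.of_isClosed_subset isClosed_closure hSK
  have hbS : b ∉ convexHull ℝ S := fun h => hiso (mem_of_mem_extremePoints hSK hKc hb h)
  obtain ⟨g, u, hgu, hub⟩ := geometric_hahn_banach_closed_point (convex_convexHull ℝ S)
    (isCompact_convexHull hScpt).isClosed hbS
  have hgS : ∀ x ∈ S, g x < g b := fun x hx => (hgu x (subset_convexHull ℝ _ hx)).trans hub
  refine ⟨g, ?_, hgS v (subset_closure ⟨hv, hbv.symm⟩)⟩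
  have : K ⊆ {x | g x ≤ g b} := by
    refine (subset_convexHull_of_extremePoints_subset hK hKc (hScpt.insert b) fun x hx => ?_).trans
      (convexHull_min ?_ (convex_halfSpace_le g.isLinear _))
    · by_cases hxb : x = b
      · exact Or.inl hxb
      · exact Or.inr (subset_closure ⟨hx, hxb⟩)
    · rintro x (rfl | hx)
      · exact le_refl (_ : ℝ)
      · exact (hgS x hx).le
  exact this

lemma polygons_facts {n : ℕ} {P : Set Plane} (h : P ∈ polygons n) :
    IsCompact P ∧ Convex ℝ P ∧ P.Nonempty ∧
      ∃ V : Finset Plane, V.card ≤ n ∧ (V : Set Plane) = P.extremePoints ℝ := by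
  classical
  obtain ⟨V, hV, hcard, rfl⟩ := h
  refine ⟨V.finite_toSet.isCompact_convexHull ℝ, convex_convexHull ℝ _, hV.to_set.convexHull, ?_⟩
  have hsub : (convexHull ℝ (V : Set Plane)).extremePoints ℝ ⊆ V := extremePoints_convexHull_subset
  obtain ⟨V', hV'⟩ := (V.finite_toSet.subset hsub).exists_finset_coe
  refine ⟨V', (Finset.card_le_card ?_).trans hcard, hV'⟩
  rw [← Finset.coe_subset, hV']
  exact hsub

/-- The push of a vertex of a polygon. -/
lemma exists_push_polygon {n : ℕ} {P : Set Plane} (hP : P ∈ polygons n)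
    (hi : (interior P).Nonempty) {v : Plane} (hv : v ∈ P.extremePoints ℝ) {U : Set Plane}
    (hU : U ∈ nhds v) :
    ∃ v' ∈ U, convexHull ℝ (insert v' (P.extremePoints ℝ \ {v})) ∈ polygons n ∧
      boundaryLength P < boundaryLength (convexHull ℝ (insert v' (P.extremePoints ℝ \ {v}))) ∧
      volume (convexHull ℝ (insert v' (P.extremePoints ℝ \ {v}))) = volume P := by
  classical
  obtain ⟨hcpt, hc, -, V, hVn, hV⟩ := polygons_facts hP
  have hcl : ∀ b, closure (P.extremePoints ℝ \ {b}) = P.extremePoints ℝ \ {b} := fun b => by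
    rw [← hV]
    exact (V.finite_toSet.subset Set.sdiff_subset).isClosed.closure_eq
  have hiso : ∀ b, b ∉ closure (P.extremePoints ℝ \ {b}) := fun b hb => by
    rw [hcl] at hb
    exact hb.2 rfl
  obtain ⟨v', hv'U, h1, h2⟩ := exists_push hcpt hc hi hv (hiso v)
    (fun b hb hbv => exists_support_of_isolated hcpt hc hb (hiso b) hv hbv) hU
  rw [hcl] at h1 h2
  refine ⟨v', hv'U, ⟨insert v' (V.erase v), Finset.insert_nonempty _ _, ?_, ?_⟩, h1, h2⟩
  · have hvV : v ∈ V := by rw [← Finset.mem_coe, hV]; exact hv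
    have := Finset.card_insert_le v' (V.erase v)
    have := Finset.card_erase_add_one hvV
    omega
  · rw [Finset.coe_insert, Finset.coe_erase, hV]

/-- A point of a convex set on a supporting line stays in the convex hull of the extreme points
if an extreme point off the supporting line is moved. -/
lemma mem_convexHull_of_support {P : Set Plane} (hP : IsCompact P) (hc : Convex ℝ P) {v x : Plane}
    (hfin : (P.extremePoints ℝ).Finite) (hx : x ∈ P) {g : Plane →L[ℝ] ℝ}
    (hg : ∀ y ∈ P, g y ≤ g x) (hgv : g v < g x) :
    x ∈ convexHull ℝ (P.extremePoints ℝ \ {v}) := by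
  set W := P.extremePoints ℝ \ {v} with hW
  have hWfin : W.Finite := hfin.subset Set.sdiff_subset
  have hsub := subset_convexHull_of_extremePoints_subset hP hc (hWfin.insert v).isCompact
    (fun y hy => by
      by_cases hyv : y = v
      · exact Or.inl hyv
      · exact Or.inr ⟨hy, hyv⟩)
  have hx' := hsub hx
  rcases W.eq_empty_or_nonempty with h0 | hne
  · rw [h0] at hx'
    simp at hx'
    rw [hx'] at hgv
    exact absurd hgv (lt_irrefl _)
  rw [convexHull_insert hne, mem_convexJoin] at hx'
  obtain ⟨v₁, rfl, w, hw, s, t, hs, ht, hst, rfl⟩ := hx'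
  have hwP : w ∈ P := convexHull_min (fun y hy => hy.1.1) hc hw
  have hgw := hg w hwP
  rcases hs.eq_or_lt with rfl | hs0
  · have : t = 1 := by linarith
    simpa [this] using hw
  · exfalso
    rw [map_add, map_smul, map_smul, smul_eq_mul, smul_eq_mul] at hgw hgv
    obtain rfl : t = 1 - s := by linarith
    nlinarith

/-- A vertex v in the interior of E could be pushed. The new polygon still contains X: a line
supporting E at a point of X misses v, so that point is spanned by the other vertices. -/
lemma extremePoints_subset_frontier {n : ℕ} {X E P : Set Plane} {α : ENNReal} (hEc : Convex ℝ E)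
    (hX : X ⊆ frontier E) (hP : P ∈ polygonsBetween n X E α) (hi : (interior P).Nonempty)
    (hmax : ∀ Q ∈ polygonsBetween n X E α, boundaryLength Q ≤ boundaryLength P) :
    P.extremePoints ℝ ⊆ frontier E := by
  obtain ⟨hPn, hXP, hPE, hPα⟩ := hP
  obtain ⟨hcpt, hc, -, V, hVn, hV⟩ := polygons_facts hPn
  have hfin : (P.extremePoints ℝ).Finite := hV ▸ V.finite_toSet
  intro v hv
  by_contra hvE
  have hvi : v ∈ interior E := by
    by_contra hcon
    exact hvE ⟨subset_closure (hPE hv.1), hcon⟩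
  obtain ⟨v', hv', h1, h2, h3⟩ := exists_push_polygon hPn hi hv (isOpen_interior.mem_nhds hvi)
  refine not_le.2 h2 (hmax _ ⟨h1, ?_, convexHull_min (Set.insert_subset (interior_subset hv')
    fun x hx => hPE hx.1.1) hEc, h3.le.trans hPα⟩)
  intro x hx
  obtain ⟨g, hg, hg'⟩ := exists_support hEc ⟨v, hvi⟩ (hX hx).2
  exact convexHull_mono (Set.subset_insert _ _) (mem_convexHull_of_support hcpt hc hfin (hXP hx)
    (fun y hy => hg y (hPE hy)) (hg' v hvi))

/-! ### Degenerate convex sets -/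

lemma exists_line_of_interior_eq_empty {K : Set Plane} (hc : Convex ℝ K) (hi : interior K = ∅)
    (hne : K.Nonempty) :
    ∃ f : Plane →L[ℝ] ℝ, f ≠ 0 ∧ ∃ c, ∀ x ∈ K, f x = c := by
  have h1 : affineSpan ℝ K ≠ ⊤ := fun h => by
    have := hc.interior_nonempty_iff_affineSpan_eq_top.2 h
    rw [hi] at this
    exact Set.not_nonempty_empty this
  obtain ⟨x₀, hx₀⟩ := hne
  have h2 : vectorSpan ℝ K ≠ ⊤ := fun h =>
    h1 ((AffineSubspace.affineSpan_eq_top_iff_vectorSpan_eq_top_of_nonempty ℝ Plane Plane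
      ⟨x₀, hx₀⟩).2 h)
  obtain ⟨f, hf0, hf⟩ := Submodule.exists_le_ker_of_lt_top _ (lt_top_iff_ne_top.2 h2)
  refine ⟨LinearMap.toContinuousLinearMap f, fun h => hf0 ?_, f x₀, fun x hx => ?_⟩
  · ext x
    exact DFunLike.congr_fun h x
  · have := hf (vsub_mem_vectorSpan ℝ hx hx₀)
    rw [LinearMap.mem_ker, vsub_eq_sub, map_sub, sub_eq_zero] at this
    exact this

lemma exists_segment_of_interior_eq_empty {K : Set Plane} (hK : IsCompact K) (hc : Convex ℝ K)
    (hi : interior K = ∅) (hne : K.Nonempty) : ∃ a b, K = segment ℝ a b := by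
  obtain ⟨f, hf0, c, hfc⟩ := exists_line_of_interior_eq_empty hc hi hne
  obtain ⟨x₀, hx₀⟩ := hne
  by_cases hsub : ∀ x ∈ K, x = x₀
  · exact ⟨x₀, x₀, by
      rw [segment_same]
      exact Set.eq_singleton_iff_unique_mem.2 ⟨hx₀, hsub⟩⟩
  push Not at hsub
  obtain ⟨x₁, hx₁, hne⟩ := hsub
  have hu : x₁ - x₀ ≠ 0 := sub_ne_zero.2 hne
  set e : Plane →L[ℝ] ℝ := innerSL ℝ (x₁ - x₀) with he
  have heu : 0 < e (x₁ - x₀) := by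
    simp only [he, innerSL_apply_apply]
    exact real_inner_self_pos.2 hu
  have hpar : ∀ x ∈ K, ∃ τ : ℝ, x = x₀ + τ • (x₁ - x₀) ∧ e x = e x₀ + τ * e (x₁ - x₀) := by
    intro x hx
    obtain ⟨τ, hτ⟩ := exists_smul_eq_of_apply_eq_zero hf0 (x := x₁ - x₀) (y := x - x₀)
      (by rw [map_sub, hfc _ hx₁, hfc _ hx₀, sub_self])
      (by rw [map_sub, hfc _ hx, hfc _ hx₀, sub_self]) hu
    have hx' : x = x₀ + τ • (x₁ - x₀) := by rw [← hτ, add_sub_cancel]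
    exact ⟨τ, hx', by conv_lhs => rw [hx', map_add, map_smul, smul_eq_mul]⟩
  obtain ⟨a, ha, hmin⟩ := hK.exists_isMinOn ⟨x₀, hx₀⟩ e.continuous.continuousOn
  obtain ⟨b, hb, hmax⟩ := hK.exists_isMaxOn ⟨x₀, hx₀⟩ e.continuous.continuousOn
  refine ⟨a, b, Set.Subset.antisymm (fun x hx => ?_) (hc.segment_subset ha hb)⟩
  obtain ⟨τ, hτ, eτ⟩ := hpar x hx
  obtain ⟨τa, hτa, eτa⟩ := hpar a ha
  obtain ⟨τb, hτb, eτb⟩ := hpar b hb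
  have h1 : e a ≤ e x := hmin hx
  have h2 : e x ≤ e b := hmax hx
  have h1' : τa ≤ τ := by
    by_contra hcon
    nlinarith
  have h2' : τ ≤ τb := by
    by_contra hcon
    nlinarith
  rw [hτ, hτa, hτb]
  have hmap : ∀ σ : ℝ, x₀ + σ • (x₁ - x₀) = AffineMap.lineMap x₀ x₁ σ := fun σ => by
    rw [AffineMap.lineMap_apply_module', add_comm]
  rw [hmap, hmap, hmap, ← image_segment, segment_eq_Icc (h1'.trans h2')]
  exact ⟨τ, ⟨h1', h2'⟩, rfl⟩

/-- A segment has a triangular neighbourhood of almost the same perimeter. -/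
lemma exists_triangle_of_segment (a b : Plane) {ε : ℝ} (hε : 0 < ε) :
    ∃ T : Set Plane, IsCompact T ∧ Convex ℝ T ∧ segment ℝ a b ⊆ interior T ∧
      boundaryLength T ≤ ENNReal.ofReal (2 * dist a b + ε) := by
  obtain ⟨u, hu1, hu⟩ : ∃ u : Plane, ‖u‖ = 1 ∧ b - a = dist a b • u := by
    by_cases hab : a = b
    · exact ⟨EuclideanSpace.single 0 1, by simp, by simp [hab]⟩
    · have hne : ‖b - a‖ ≠ 0 := norm_ne_zero_iff.2 (sub_ne_zero.2 (Ne.symm hab))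
      refine ⟨‖b - a‖⁻¹ • (b - a), ?_, ?_⟩
      · rw [norm_smul, norm_inv, norm_norm, inv_mul_cancel₀ hne]
      · rw [dist_comm, dist_eq_norm, smul_smul, mul_inv_cancel₀ hne, one_smul]
  set ℓ := dist a b with hℓ
  have hℓ0 : 0 ≤ ℓ := dist_nonneg
  have hsq : u 0 ^ 2 + u 1 ^ 2 = 1 := by
    have := EuclideanSpace.norm_sq_eq u
    rw [hu1, Fin.sum_univ_two] at this
    simpa using this.symm
  set w : Plane := !₂[-u 1, u 0] with hw
  have hw0 : w 0 = -u 1 := by simp [hw]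
  have hw1' : w 1 = u 0 := by simp [hw]
  have hw1 : ‖w‖ = 1 := by
    rw [EuclideanSpace.norm_eq, Fin.sum_univ_two, hw0, hw1']
    simp only [Real.norm_eq_abs, sq_abs, neg_sq]
    rw [add_comm, hsq, Real.sqrt_one]
  set eu : Plane →L[ℝ] ℝ := u 0 • EuclideanSpace.proj 0 + u 1 • EuclideanSpace.proj 1 with heu
  set ew : Plane →L[ℝ] ℝ := u 0 • EuclideanSpace.proj 1 - u 1 • EuclideanSpace.proj 0 with hew
  have euu : eu u = 1 := by simp [heu]; linarith
  have euw : eu w = 0 := by simp [heu, hw0, hw1']; ring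
  have ewu : ew u = 0 := by simp [hew]; ring
  have eww : ew w = 1 := by simp [hew, hw0, hw1']; linarith
  -- The triangle has one vertex δ behind a and two vertices δ beyond b, displaced sideways by ±δ.
  -- Its perimeter is at most 2ℓ + 8δ.
  set δ := ε / 16 with hδ
  have hδ0 : 0 < δ := by positivity
  set L := ℓ + 2 * δ with hL
  have hL0 : 0 < L := by positivity
  set v := a - δ • u with hv
  set p := b + δ • u + δ • w with hp
  set q := b + δ • u - δ • w with hq
  have hb : b = a + ℓ • u := by rw [← hu, add_sub_cancel]
  have hpv : p - v = L • u + δ • w := by rw [hp, hv, hb, hL]; module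
  have hqv : q - v = L • u - δ • w := by rw [hq, hv, hb, hL]; module
  -- The numbers 1/(2L) and 1/(2δ) normalize the coordinates with respect to p − v = Lu + δw and q −
  -- v = Lu − δw.
  obtain ⟨A, hA⟩ : ∃ A : ℝ, A * L = 1 / 2 := ⟨1 / (2 * L), by field_simp⟩
  obtain ⟨B, hB⟩ : ∃ B : ℝ, B * δ = 1 / 2 := ⟨1 / (2 * δ), by field_simp⟩
  have h : TriangleCoords v p q (A • eu + B • ew) (A • eu - B • ew) := by
    constructor <;> simp only [hpv, hqv, add_apply, sub_apply, smul_apply, map_add, map_sub,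
      map_smul, euu, euw, ewu, eww, smul_eq_mul] <;> linarith
  refine ⟨convexHull ℝ {v, p, q}, (Set.toFinite _).isCompact_convexHull ℝ, convex_convexHull ℝ _, ?_, ?_⟩
  · have hA0 : 0 < A := pos_of_mul_pos_left (by rw [hA]; norm_num) hL0.le
    have hAδ : 0 < A * δ := mul_pos hA0 hδ0
    have hAℓ : 0 ≤ A * ℓ := mul_nonneg hA0.le hℓ0
    have hsum : A * ℓ + 2 * (A * δ) = 1 / 2 := by rw [← hA, hL]; ring
    obtain ⟨n1, n2, n3⟩ := h.ne
    refine ((convex_convexHull ℝ _).interior).segment_subset ?_ ?_ <;>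
    rw [h.convexHull_eq, interior_inter, interior_inter, interior_le_of_ne_zero n1,
      interior_le_of_ne_zero n2, interior_le_of_ne_zero n3]
    · refine ⟨⟨?_, ?_⟩, ?_⟩ <;>
      simp only [hv, Set.mem_ofPred_eq, neg_apply, add_apply, sub_apply, smul_apply, map_sub,
        map_smul, euu, ewu, smul_eq_mul] <;> linarith
    · rw [hb]
      refine ⟨⟨?_, ?_⟩, ?_⟩ <;>
      simp only [hv, Set.mem_ofPred_eq, neg_apply, add_apply, sub_apply, smul_apply, map_add,
        map_sub, map_smul, euu, ewu, smul_eq_mul] <;> linarith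
  · rw [h.boundaryLength_eq, edist_dist, edist_dist, edist_dist,
      ← ENNReal.ofReal_add (by positivity) (by positivity),
      ← ENNReal.ofReal_add (by positivity) (by positivity)]
    refine ENNReal.ofReal_le_ofReal ?_
    have h1 : dist v p ≤ L + δ := by
      rw [dist_comm, dist_eq_norm, hpv]
      refine (norm_add_le _ _).trans_eq ?_
      rw [norm_smul, norm_smul, hu1, hw1, Real.norm_of_nonneg hL0.le, Real.norm_of_nonneg hδ0.le]
      ring
    have h2 : dist v q ≤ L + δ := by
      rw [dist_comm, dist_eq_norm, hqv]
      refine (norm_sub_le _ _).trans_eq ?_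
      rw [norm_smul, norm_smul, hu1, hw1, Real.norm_of_nonneg hL0.le, Real.norm_of_nonneg hδ0.le]
      ring
    have h3 : dist p q = 2 * δ := by
      have : p - q = (2 * δ) • w := by rw [hp, hq]; module
      rw [dist_eq_norm, this, norm_smul, hw1, Real.norm_of_nonneg (by positivity), mul_one]
    rw [h3]
    linarith

lemma boundaryLength_le_of_interior_eq_empty {K : Set Plane} (hK : IsCompact K) (hc : Convex ℝ K)
    (hi : interior K = ∅) {R : ℝ} (hKR : K ⊆ Metric.closedBall 0 R) :
    boundaryLength K ≤ ENNReal.ofReal (2 * R) := by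
  rcases K.eq_empty_or_nonempty with rfl | hne
  · simp [boundaryLength]
  obtain ⟨a, b, rfl⟩ := exists_segment_of_interior_eq_empty hK hc hi hne
  rw [boundaryLength, hK.isClosed.frontier_eq, hi, Set.sdiff_empty, hausdorffMeasure_segment,
    edist_dist]
  refine ENNReal.ofReal_le_ofReal ?_
  have h1 : dist a 0 ≤ R := hKR (left_mem_segment ℝ a b)
  have h2 : dist b 0 ≤ R := hKR (right_mem_segment ℝ a b)
  have := dist_triangle_right a b 0
  linarith

/-- A segment in the disk has length at most 2, and polygons close to it lie in a thin triangle of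
perimeter at most 4 + ε. -/
lemma eventually_boundaryLength_lt_of_interior_eq_empty {n : ℕ} {V₀ : Fin n → Plane}
    (hD : Set.range V₀ ⊆ unitDisk) (hi : interior (convexHull ℝ (Set.range V₀)) = ∅) {y : ENNReal}
    (hy : ENNReal.ofReal 4 < y) :
    ∀ᶠ V in nhds V₀, boundaryLength (convexHull ℝ (Set.range V)) < y := by
  rcases isEmpty_or_nonempty (Fin n) with hn | hn
  · refine Filter.Eventually.of_forall fun V => ?_
    rw [Set.range_eq_empty]
    simpa [boundaryLength] using (zero_le.trans_lt hy)
  have hcpt := (Set.finite_range V₀).isCompact_convexHull ℝ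
  obtain ⟨a, b, hab⟩ := exists_segment_of_interior_eq_empty hcpt (convex_convexHull ℝ _) hi
    (Set.range_nonempty V₀).convexHull
  have hsubD := convexHull_min hD convex_unitDisk
  have ha : a ∈ Metric.closedBall (0 : Plane) 1 := hsubD (hab ▸ left_mem_segment ℝ a b)
  have hb : b ∈ Metric.closedBall (0 : Plane) 1 := hsubD (hab ▸ right_mem_segment ℝ a b)
  have hdist : dist a b ≤ 2 := by
    have h1 : dist a 0 ≤ 1 := ha
    have h2 : dist b 0 ≤ 1 := hb
    have := dist_triangle_right a b 0
    linarith
  obtain ⟨ε, hε, hεy⟩ : ∃ ε : ℝ, 0 < ε ∧ ENNReal.ofReal (4 + ε) < y := by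
    have hcont : Continuous fun ε : ℝ => ENNReal.ofReal (4 + ε) :=
      ENNReal.continuous_ofReal.comp (by fun_prop)
    have hev := hcont.continuousAt.eventually (isOpen_Iio.mem_nhds
      (show ENNReal.ofReal (4 + 0) ∈ Set.Iio y by simpa using hy))
    obtain ⟨ε, hε⟩ := ((hev.filter_mono nhdsWithin_le_nhds).and
      (self_mem_nhdsWithin (s := Set.Ioi (0 : ℝ)))).exists
    exact ⟨ε, hε.2, hε.1⟩
  obtain ⟨T, hT, hTc, habT, hTlen⟩ := exists_triangle_of_segment a b hε
  -- Nearby vertices may leave the unit disk. In the ball of radius 2 a degenerate hull, which is a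
  -- segment counted once, still has length at most 4.
  have h1 : ∀ᶠ V in nhds V₀, ∀ i : Fin n, V i ∈ interior T ∩ Metric.ball 0 2 := by
    refine Filter.eventually_all.2 fun i => ?_
    have hi : V₀ i ∈ convexHull ℝ (Set.range V₀) := subset_convexHull ℝ _ (Set.mem_range_self i)
    refine (continuous_apply i).continuousAt.eventually
      ((isOpen_interior.inter Metric.isOpen_ball).mem_nhds ⟨habT (hab ▸ hi), ?_⟩)
    exact (Metric.closedBall_subset_ball (by norm_num)) (hsubD hi)
  filter_upwards [h1] with V hV
  have hVcpt := (Set.finite_range V).isCompact_convexHull ℝ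
  rcases (interior (convexHull ℝ (Set.range V))).eq_empty_or_nonempty with he | hne
  · refine (boundaryLength_le_of_interior_eq_empty hVcpt (convex_convexHull ℝ _) he (R := 2)
      (convexHull_min ?_ (convex_closedBall _ _))).trans_lt (by convert hy using 2; norm_num)
    rintro _ ⟨i, rfl⟩
    exact Metric.ball_subset_closedBall (hV i).2
  · refine (boundaryLength_mono hVcpt (convex_convexHull ℝ _) hne hT
      (convexHull_min ?_ hTc)).trans_lt (hTlen.trans_lt (lt_of_le_of_lt ?_ hεy))
    · rintro _ ⟨i, rfl⟩
      exact interior_subset (hV i).1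
    · exact ENNReal.ofReal_le_ofReal (by linarith)

lemma exists_max_polygon_unitDisk {n : ℕ} (hn : 1 ≤ n) (α : ENNReal) :
    ∃ P ∈ polygonsBetween n ∅ unitDisk α, ∀ Q ∈ polygonsBetween n ∅ unitDisk α,
      boundaryLength Q ≤ max (boundaryLength P) (ENNReal.ofReal 4) := by
  refine exists_max_polygonsBetween isCompact_unitDisk convex_unitDisk ?_ _
    fun V₀ hD _ hi y hy => eventually_boundaryLength_lt_of_interior_eq_empty hD hi hy
  refine ⟨{0}, ⟨{0}, Finset.singleton_nonempty _, by simpa using hn, by simp⟩,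
    Set.empty_subset _, ?_, by simp⟩
  simp [unitDisk]

/-! ### Improving convex sets with an extreme point inside the disk -/

/-- The push needs at every other extreme point a supporting line that avoids v. In the open disk
isolation provides it; on the circle the tangent of the disk does. -/
lemma exists_better_of_isolated {K : Set Plane} (hK : IsCompact K) (hKc : Convex ℝ K)
    (hi : (interior K).Nonempty) (hKD : K ⊆ unitDisk)
    (hiso : ∀ p ∈ K.extremePoints ℝ, ‖p‖ < 1 → p ∉ closure (K.extremePoints ℝ \ {p})) {v : Plane}
    (hv : v ∈ K.extremePoints ℝ) (hv1 : ‖v‖ < 1) :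
    ∃ L, IsCompact L ∧ Convex ℝ L ∧ L ⊆ unitDisk ∧ volume L ≤ volume K ∧
      boundaryLength K < boundaryLength L := by
  have hball : Metric.ball (0 : Plane) 1 ∈ nhds v :=
    Metric.isOpen_ball.mem_nhds (mem_ball_zero_iff.2 hv1)
  have hnorm : ∀ x ∈ K, ‖x‖ ≤ 1 := fun x hx => mem_closedBall_zero_iff.1 (hKD hx)
  obtain ⟨v', hv', h1, h2⟩ := exists_push hK hKc hi hv (hiso v hv hv1) (fun b hb hbv => by
    rcases lt_or_ge ‖b‖ 1 with hlt | hge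
    · exact exists_support_of_isolated hK hKc hb (hiso b hb hlt) hv hbv
    · have hb1 : ‖b‖ = 1 := le_antisymm (hnorm b hb.1) hge
      have hbb : innerSL ℝ b b = 1 := by
        rw [innerSL_apply_apply, real_inner_self_eq_norm_sq, hb1, one_pow]
      refine ⟨innerSL ℝ b, fun x hx => ?_, ?_⟩
      · rw [hbb, innerSL_apply_apply]
        exact (real_inner_le_norm b x).trans (by rw [hb1, one_mul]; exact hnorm x hx)
      · rw [hbb, innerSL_apply_apply]
        exact (real_inner_le_norm b v).trans_lt (by rw [hb1, one_mul]; exact hv1)) hball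
  have hSK : closure (K.extremePoints ℝ \ {v}) ⊆ K :=
    closure_minimal (fun x hx => hx.1.1) hK.isClosed
  refine ⟨_, isCompact_convexHull ((hK.of_isClosed_subset isClosed_closure hSK).insert v'),
    convex_convexHull ℝ _, convexHull_min (Set.insert_subset
    (Metric.ball_subset_closedBall hv') (hSK.trans hKD)) convex_unitDisk, h2.le, h1⟩

lemma interior_eq_empty_of_line {K : Set Plane} {f : Plane →L[ℝ] ℝ} (hf : f ≠ 0) {c : ℝ}
    (h : ∀ x ∈ K, f x = c) : interior K = ∅ := by
  rw [Set.eq_empty_iff_forall_notMem]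
  intro x hx
  have hsub : K ⊆ {x | c ≤ f x} := fun y hy => (h y hy).ge
  have hx' := interior_mono hsub hx
  rw [interior_le_of_ne_zero hf] at hx'
  exact (show c < f x from hx').ne' (h x (interior_subset hx))

/-- A line contains at most two extreme points of a convex set. -/
lemma card_le_two_of_line {P : Set Plane} (hc : Convex ℝ P) {V : Finset Plane}
    (hV : (V : Set Plane) ⊆ P.extremePoints ℝ) {g : Plane →L[ℝ] ℝ} (hg : g ≠ 0) {d : ℝ}
    (hVg : ∀ x ∈ V, g x = d) : V.card ≤ 2 := by
  classical
  rcases V.eq_empty_or_nonempty with rfl | hne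
  · simp
  have hline : ∀ x ∈ convexHull ℝ (V : Set Plane), g x = d :=
    convexHull_min (t := {x | g x = d}) hVg (convex_hyperplane g.isLinear d)
  obtain ⟨a, b, hab⟩ := exists_segment_of_interior_eq_empty
    (V.finite_toSet.isCompact_convexHull ℝ) (convex_convexHull ℝ _)
    (interior_eq_empty_of_line hg hline) hne.to_set.convexHull
  have hsub : V ⊆ {a, b} := by
    intro x hx
    have hxab : x ∈ convexHull ℝ ({a, b} : Set Plane) := by
      rw [convexHull_pair, ← hab]
      exact subset_convexHull ℝ _ hx
    have habP : ({a, b} : Set Plane) ⊆ P := by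
      refine (subset_convexHull ℝ _).trans ?_
      rw [convexHull_pair, ← hab]
      exact convexHull_min (fun y hy => (hV hy).1) hc
    simpa using mem_of_mem_extremePoints habP hc (hV hx) hxab
  exact (Finset.card_le_card hsub).trans Finset.card_le_two

/-! ### Polygonal regions and replacement of a slice by a polygon -/

/-- The intersection of half-planes. -/
def halfPlanes (H : Finset ((Plane →L[ℝ] ℝ) × ℝ)) : Set Plane := {y | ∀ q ∈ H, q.1 y ≤ q.2}

lemma convex_halfPlanes (H : Finset ((Plane →L[ℝ] ℝ) × ℝ)) : Convex ℝ (halfPlanes H) := by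
  have : halfPlanes H = ⋂ q ∈ H, {y | q.1 y ≤ q.2} := by
    ext y
    simp [halfPlanes]
  rw [this]
  exact convex_iInter₂ fun q _ => convex_halfSpace_le q.1.isLinear _

lemma isClosed_halfPlanes (H : Finset ((Plane →L[ℝ] ℝ) × ℝ)) : IsClosed (halfPlanes H) := by
  have : halfPlanes H = ⋂ q ∈ H, {y | q.1 y ≤ q.2} := by
    ext y
    simp [halfPlanes]
  rw [this]
  exact isClosed_biInter fun q _ => isClosed_le q.1.continuous continuous_const

lemma mem_frontier_halfPlanes {H : Finset ((Plane →L[ℝ] ℝ) × ℝ)} (hH : ∀ q ∈ H, q.1 ≠ 0)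
    {y : Plane} : y ∈ frontier (halfPlanes H) ↔ y ∈ halfPlanes H ∧ ∃ q ∈ H, q.1 y = q.2 := by
  rw [(isClosed_halfPlanes H).frontier_eq]
  constructor
  · rintro ⟨hy, hyi⟩
    refine ⟨hy, ?_⟩
    by_contra hcon
    push Not at hcon
    have hopen : IsOpen (⋂ q ∈ H, {y | q.1 y < q.2}) :=
      isOpen_biInter_finset fun q _ => isOpen_lt q.1.continuous continuous_const
    refine hyi (interior_maximal (fun z hz q hq => ?_) hopen ?_)
    · simp only [Set.mem_iInter] at hz
      exact (show q.1 z < q.2 from hz q hq).le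
    · simp only [Set.mem_iInter]
      exact fun q hq => lt_of_le_of_ne (hy q hq) (hcon q hq)
  · rintro ⟨hy, q, hq, hqy⟩
    refine ⟨hy, fun hyi => ?_⟩
    have hsub : halfPlanes H ⊆ {z | -q.2 ≤ (-q.1) z} := fun z hz => by
      have := hz q hq
      simp only [Set.mem_ofPred_eq, neg_apply]
      linarith
    have hyi' := interior_mono hsub hyi
    rw [interior_le_of_ne_zero (neg_ne_zero.2 (hH q hq))] at hyi'
    simp only [Set.mem_ofPred_eq, neg_apply] at hyi'
    linarith

/-- Each bounding line carries at most two extreme points of P. -/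
lemma card_le_of_subset_frontier_halfPlanes {H : Finset ((Plane →L[ℝ] ℝ) × ℝ)}
    (hH : ∀ q ∈ H, q.1 ≠ 0) {P : Set Plane} (hc : Convex ℝ P) {V : Finset Plane}
    (hV : (V : Set Plane) ⊆ P.extremePoints ℝ) (hfr : (V : Set Plane) ⊆ frontier (halfPlanes H)) :
    V.card ≤ 2 * H.card := by
  classical
  have hsub : V ⊆ H.biUnion fun q => V.filter fun x => q.1 x = q.2 := by
    intro x hx
    obtain ⟨-, q, hq, hqx⟩ := (mem_frontier_halfPlanes hH).1 (hfr hx)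
    simp only [Finset.mem_biUnion, Finset.mem_filter]
    exact ⟨q, hq, hx, hqx⟩
  refine (Finset.card_le_card hsub).trans ?_
  rw [mul_comm]
  refine Finset.card_biUnion_le_card_mul _ _ _ fun q hq => ?_
  refine card_le_two_of_line hc ((Finset.coe_subset.2 (Finset.filter_subset _ _)).trans hV)
    (hH q hq) (d := q.2) fun x hx => (Finset.mem_filter.1 hx).2

/-- A point on a supporting line is a convex combination of the extreme points on that line. -/
lemma mem_convexHull_filter {P : Set Plane} (hP : IsCompact P) (hc : Convex ℝ P)
    {V : Finset Plane} (hV : (V : Set Plane) = P.extremePoints ℝ) {x : Plane} (hx : x ∈ P)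
    {g : Plane →L[ℝ] ℝ} (hg : ∀ y ∈ P, g y ≤ g x) [DecidablePred fun y => g y = g x] :
    x ∈ convexHull ℝ ((V.filter fun y => g y = g x : Finset Plane) : Set Plane) := by
  set F := P ∩ {y | g y = g x} with hF
  have hFcpt : IsCompact F := hP.inter_right (isClosed_eq g.continuous continuous_const)
  have hFc : Convex ℝ F := hc.inter (convex_hyperplane g.isLinear _)
  have hext : F.extremePoints ℝ ⊆ (V.filter fun y => g y = g x : Finset Plane) := by
    rintro z ⟨⟨hzP, hzg⟩, hz⟩
    have hzg : g z = g x := hzg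
    rw [Finset.coe_filter]
    refine ⟨?_, hzg⟩
    rw [← Finset.mem_coe, hV]
    refine ⟨hzP, fun y₁ h₁ y₂ h₂ hy => ?_⟩
    obtain ⟨s, t, hs, ht, hst, e⟩ := hy
    have e' := congrArg g e
    rw [map_add, map_smul, map_smul, smul_eq_mul, smul_eq_mul, hzg] at e'
    have g1 := hg y₁ h₁
    have g2 := hg y₂ h₂
    obtain rfl : s = 1 - t := by linarith
    have e1 : g y₁ = g x := le_antisymm g1 (by nlinarith)
    have e2 : g y₂ = g x := le_antisymm g2 (by nlinarith)
    exact hz ⟨h₁, e1⟩ ⟨h₂, e2⟩ ⟨_, t, hs, ht, hst, e⟩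
  exact subset_convexHull_of_extremePoints_subset hFcpt hFc (Finset.finite_toSet _).isCompact hext
    ⟨hx, rfl⟩

/-- A polygon that has many extreme points of a larger convex set on its sides has many
vertices. -/
lemma card_le_of_support {K P : Set Plane} (hKc : Convex ℝ K) (hP : IsCompact P) (hc : Convex ℝ P)
    {V X : Finset Plane} (hV : (V : Set Plane) = P.extremePoints ℝ)
    (hX : (X : Set Plane) ⊆ K.extremePoints ℝ) (hXP : (X : Set Plane) ⊆ P)
    {g : Plane → Plane →L[ℝ] ℝ} (hg0 : ∀ x ∈ X, g x ≠ 0)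
    (hg : ∀ x ∈ X, ∀ y ∈ P, g x y ≤ g x x) : X.card ≤ 2 * 2 ^ V.card := by
  classical
  -- A point of X is mapped to the set of vertices of P on its supporting line, whose hull contains
  -- it. Points with the same image lie on one line, which contains at most two extreme points of K;
  -- and there are at most 2^|V| images.
  refine (Finset.card_le_mul_card_image (f := fun x => V.filter fun y => g x y = g x x) X 2
    fun A hA => ?_).trans (Nat.mul_le_mul_left 2 ?_)
  · obtain ⟨x₀, hx₀, rfl⟩ := Finset.mem_image.1 hA
    refine card_le_two_of_line hKc (V := X.filter fun x =>
      (V.filter fun y => g x y = g x x) = V.filter fun y => g x₀ y = g x₀ x₀)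
      ((Finset.coe_subset.2 (Finset.filter_subset _ _)).trans hX) (hg0 x₀ hx₀) (d := g x₀ x₀) ?_
    intro x hx
    obtain ⟨hxX, hxA⟩ := Finset.mem_filter.1 hx
    have := mem_convexHull_filter hP hc hV (hXP hxX) (hg x hxX)
    rw [hxA] at this
    exact convexHull_min (t := {y | g x₀ y = g x₀ x₀})
      (fun y hy => (Finset.mem_filter.1 hy).2) (convex_hyperplane (g x₀).isLinear _) this
  · rw [← Finset.card_powerset]
    exact Finset.card_le_card fun A hA => by
      obtain ⟨x, -, rfl⟩ := Finset.mem_image.1 hA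
      exact Finset.mem_powerset.2 (Finset.filter_subset _ _)

/-- In a polygonal region `E`, every compact convex set can be replaced by a polygon between a
prescribed subset `X` of the boundary of `E` and `E`, whose number of vertices is bounded in terms
of `E`. -/
lemma exists_polygon_in_halfPlanes {H : Finset ((Plane →L[ℝ] ℝ) × ℝ)} (hH : ∀ q ∈ H, q.1 ≠ 0)
    (hE : IsCompact (halfPlanes H)) {C : Set Plane} (hC : IsCompact C) (hCc : Convex ℝ C)
    (hCE : C ⊆ halfPlanes H) {X : Finset Plane} (hXC : (X : Set Plane) ⊆ C)
    (hXE : (X : Set Plane) ⊆ frontier (halfPlanes H))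
    (hXi : (interior (convexHull ℝ (X : Set Plane))).Nonempty) :
    ∃ n, ∃ P ∈ polygons n, (X : Set Plane) ⊆ P ∧ P ⊆ halfPlanes H ∧ volume P ≤ volume C ∧
      boundaryLength C ≤ boundaryLength P := by
  set E := halfPlanes H with hEdef
  have hEc := convex_halfPlanes H
  set N := 2 * H.card with hN
  have hint : ∀ {P : Set Plane}, Convex ℝ P → (X : Set Plane) ⊆ P → (interior P).Nonempty :=
    fun hc hXP => hXi.mono (interior_mono (convexHull_min hXP hc))
  have hmax : ∀ n, (polygonsBetween n X E (volume C)).Nonempty →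
      ∃ P ∈ polygonsBetween n X E (volume C), ∀ Q ∈ polygonsBetween n X E (volume C),
        boundaryLength Q ≤ boundaryLength P := by
    intro n hne
    obtain ⟨P, hP, hPmax⟩ := exists_max_polygonsBetween hE hEc hne 0 fun V₀ _ hX0 hi0 => by
      have := hint (convex_convexHull ℝ _) hX0
      rw [hi0] at this
      exact absurd this Set.not_nonempty_empty
    exact ⟨P, hP, fun Q hQ => (hPmax Q hQ).trans_eq (by simp)⟩
  -- A longest n-gon between X and E has its vertices on the boundary of E, at most two on each
  -- bounding line. So it is already an N-gon, whatever n is.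
  have hreduce : ∀ n, ∀ Q ∈ polygonsBetween n X E (volume C),
      ∃ P ∈ polygonsBetween N X E (volume C), boundaryLength Q ≤ boundaryLength P := by
    intro n Q hQ
    obtain ⟨P, hP, hPmax⟩ := hmax n ⟨Q, hQ⟩
    refine ⟨P, ⟨?_, hP.2⟩, hPmax Q hQ⟩
    obtain ⟨hcpt, hc, hne, V, -, hV⟩ := polygons_facts hP.1
    have hfr := extremePoints_subset_frontier hEc hXE hP (hint hc hP.2.1) hPmax
    refine ⟨V, ?_, card_le_of_subset_frontier_halfPlanes hH hc hV.le (hV.le.trans hfr), ?_⟩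
    · rw [← Finset.coe_nonempty, hV]
      exact hcpt.extremePoints_nonempty hne
    · refine Set.Subset.antisymm (subset_convexHull_of_extremePoints_subset hcpt hc
        V.finite_toSet.isCompact hV.ge) (convexHull_min ?_ hc)
      rw [hV]
      exact extremePoints_subset
  obtain ⟨z, hz⟩ := hint hCc hXC
  have happrox : ∀ t : ℝ, 1 < t → ∃ n, ∃ Q ∈ polygonsBetween n X E (volume C),
      boundaryLength C ≤ ENNReal.ofReal t * boundaryLength Q := by
    intro t ht
    obtain ⟨V, hXV, hVC, hzV, hCV⟩ := exists_polygon_between hC hCc hz ht hXC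
    have hVC' := convexHull_min hVC hCc
    have hXV' : (X : Set Plane) ⊆ convexHull ℝ (V : Set Plane) :=
      (Finset.coe_subset.2 hXV).trans (subset_convexHull ℝ _)
    have hVne : V.Nonempty := by
      rw [← Finset.coe_nonempty, ← convexHull_nonempty_iff (𝕜 := ℝ)]
      exact ⟨z, interior_subset hzV⟩
    refine ⟨V.card, _, ⟨⟨V, hVne, le_rfl, rfl⟩, hXV', hVC'.trans hCE, measure_mono hVC'⟩, ?_⟩
    rw [← boundaryLength_homothety _ z (by linarith)]
    exact boundaryLength_mono hC hCc ⟨z, hz⟩ ((V.finite_toSet.isCompact_convexHull ℝ).image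
      (AffineMap.homothety_continuous z t)) hCV
  obtain ⟨n₂, Q₂, hQ₂, -⟩ := happrox 2 (by norm_num)
  obtain ⟨P₂, hP₂, -⟩ := hreduce n₂ Q₂ hQ₂
  -- A single longest N-gon dominates all polygonal approximations of C; letting the ratio t tend to
  -- 1 compares it with C.
  obtain ⟨P, hP, hPmax⟩ := hmax N ⟨P₂, hP₂⟩
  refine ⟨N, P, hP.1, hP.2.1, hP.2.2.1, hP.2.2.2, le_of_forall_one_lt_le_ofReal_mul fun t ht => ?_⟩
  obtain ⟨n, Q, hQ, hCQ⟩ := happrox t ht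
  obtain ⟨P', hP', hQP⟩ := hreduce n Q hQ
  exact hCQ.trans (mul_le_mul_right (hQP.trans (hPmax P' hP')) _)

/-- A line through the interior of a compact convex set meets it in a segment whose end points are
separated by supporting lines. -/
lemma exists_chord {K : Set Plane} (hK : IsCompact K) (hKc : Convex ℝ K) {f : Plane →L[ℝ] ℝ}
    (hf : f ≠ 0) {c : ℝ} {z : Plane} (hz : z ∈ interior K) (hzc : f z = c) :
    ∃ a b, ∃ g g' : Plane →L[ℝ] ℝ, K ∩ {x | f x = c} = segment ℝ a b ∧ (∀ x ∈ K, g x ≤ g a) ∧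
      g b < g a ∧ (∀ x ∈ K, g' x ≤ g' b) ∧ g' a < g' b := by
  have hline : ∀ x ∈ K ∩ {x | f x = c}, f x = c := fun x hx => hx.2
  have hFc : Convex ℝ (K ∩ {x | f x = c}) := hKc.inter (convex_hyperplane f.isLinear c)
  obtain ⟨a, b, hab⟩ := exists_segment_of_interior_eq_empty
    (hK.inter_right (isClosed_eq f.continuous continuous_const)) hFc
    (interior_eq_empty_of_line hf hline) ⟨z, interior_subset hz, hzc⟩
  have hzab : z ∈ segment ℝ a b := hab ▸ ⟨interior_subset hz, hzc⟩
  have ha : a ∈ K ∩ {x | f x = c} := hab ▸ left_mem_segment ℝ a b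
  have hb : b ∈ K ∩ {x | f x = c} := hab ▸ right_mem_segment ℝ a b
  -- interior points of the chord can be moved along the line
  have hmove : ∀ y ∈ interior K, f y = c → ∀ u : Plane, f u = 0 → ∃ ε : ℝ, 0 < ε ∧
      y + ε • u ∈ segment ℝ a b := by
    intro y hy hyc u hu
    have hcont : Continuous fun ε : ℝ => y + ε • u := by fun_prop
    have hev : ∀ᶠ ε : ℝ in nhds 0, y + ε • u ∈ interior K :=
      hcont.continuousAt.eventually (isOpen_interior.mem_nhds (by simpa using hy))
    obtain ⟨ε, hε, hε0⟩ := ((hev.filter_mono nhdsWithin_le_nhds).and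
      (self_mem_nhdsWithin (s := Set.Ioi (0 : ℝ)))).exists
    refine ⟨ε, hε0, hab ▸ ⟨interior_subset hε, ?_⟩⟩
    rw [Set.mem_ofPred_eq, map_add, map_smul, hu, smul_zero, add_zero, hyc]
  have hne : a ≠ b := by
    rintro rfl
    rw [segment_same] at hzab hmove
    obtain rfl : z = a := hzab
    obtain ⟨u, hu0, hu⟩ : ∃ u : Plane, u ≠ 0 ∧ f u = 0 := by
      by_cases h0 : f (EuclideanSpace.single 0 1) = 0
      · exact ⟨_, by simp, h0⟩
      · refine ⟨!₂[-f (EuclideanSpace.single 1 1), f (EuclideanSpace.single 0 1)], fun h => h0 ?_, ?_⟩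
        · have := congrArg (fun y : Plane => y 1) h
          simpa using this
        · rw [continuousLinearMap_apply_plane]
          simp
          ring
    obtain ⟨ε, hε, he⟩ := hmove z hz hzc u hu
    have : ε • u = 0 := by simpa using he
    exact hu0 ((smul_eq_zero.1 this).resolve_left hε.ne')
  have hend : ∀ {a b : Plane}, a ≠ b → f a = c → f b = c →
      (∀ y ∈ interior K, f y = c → ∀ u : Plane, f u = 0 → ∃ ε : ℝ, 0 < ε ∧
        y + ε • u ∈ segment ℝ a b) → a ∉ interior K := by
    intro a b hne ha hb hmove hai
    obtain ⟨ε, hε, he⟩ := hmove a hai ha (a - b) (by rw [map_sub, ha, hb, sub_self])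
    rw [segment_eq_image'] at he
    obtain ⟨τ, hτ, he⟩ := he
    have : (τ + ε) • (b - a) = 0 := by
      have := add_left_cancel he
      rw [add_smul, this]
      module
    rcases smul_eq_zero.1 this with h | h
    · linarith [hτ.1]
    · exact hne (sub_eq_zero.1 h).symm
  obtain ⟨g, hg, hg'⟩ := exists_support hKc ⟨z, hz⟩ (hend hne ha.2 hb.2 hmove)
  obtain ⟨g₁, hg₁, hg₁'⟩ := exists_support hKc ⟨z, hz⟩ (hend hne.symm hb.2 ha.2
    (by rw [segment_symm]; exact hmove))
  obtain ⟨s, t, hs, ht, hst, e⟩ := hzab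
  refine ⟨a, b, g, g₁, hab, hg, lt_of_le_of_ne (hg b hb.1) fun h => ?_, hg₁,
    lt_of_le_of_ne (hg₁ a ha.1) fun h => ?_⟩
  · have := hg' z hz
    rw [← e, map_add, map_smul, map_smul, h, ← add_smul, hst, one_smul] at this
    exact lt_irrefl _ this
  · have := hg₁' z hz
    rw [← e, map_add, map_smul, map_smul, h, ← add_smul, hst, one_smul] at this
    exact lt_irrefl _ this

/-- Near an extreme point, a compact convex set can be cut off by a line. -/
lemma exists_slice {K : Set Plane} (hK : IsCompact K) (hKc : Convex ℝ K) {p : Plane}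
    (hp : p ∈ K.extremePoints ℝ) {r : ℝ} (hr : 0 < r) {q : Plane} (hq : q ∈ K) (hqr : r ≤ dist q p) :
    ∃ (f : Plane →L[ℝ] ℝ) (c : ℝ), c < f p ∧ f q < c ∧ K ∩ {x | c ≤ f x} ⊆ Metric.ball p r := by
  have hS : IsCompact (K \ Metric.ball p r) := hK.inter_right Metric.isOpen_ball.isClosed_compl
  have hpS : p ∉ convexHull ℝ (K \ Metric.ball p r) := fun h =>
    (mem_of_mem_extremePoints Set.sdiff_subset hKc hp h).2 (Metric.mem_ball_self hr)
  obtain ⟨f, c, hfc, hcp⟩ := geometric_hahn_banach_closed_point (convex_convexHull ℝ _)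
    (isCompact_convexHull hS).isClosed hpS
  refine ⟨f, c, hcp, hfc q (subset_convexHull ℝ _ ⟨hq, fun h => ?_⟩), fun x hx => ?_⟩
  · exact not_lt.2 hqr h
  · by_contra hcon
    exact not_le.2 (hfc x (subset_convexHull ℝ _ ⟨hx.1, hcon⟩)) hx.2

lemma exists_finset_extremePoints {K : Set Plane} {p : Plane}
    (hacc : p ∈ closure (K.extremePoints ℝ \ {p})) {U : Set Plane} (hU : IsOpen U) (hpU : p ∈ U)
    (n : ℕ) : ∃ X : Finset Plane, X.card = n ∧ (X : Set Plane) ⊆ K.extremePoints ℝ ∩ U := by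
  have hinf : ((K.extremePoints ℝ \ {p}) ∩ U).Infinite := fun hfin => by
    have hopen : IsOpen (U \ ((K.extremePoints ℝ \ {p}) ∩ U)) := hU.sdiff hfin.isClosed
    obtain ⟨x, hx, hx'⟩ := mem_closure_iff.1 hacc _ hopen ⟨hpU, fun h => h.1.2 rfl⟩
    exact hx.2 ⟨hx', hx.1⟩
  obtain ⟨X, hX, hXn⟩ := hinf.exists_subset_card_eq n
  exact ⟨X, hXn, fun x hx => ⟨(hX hx).1.1, (hX hx).2⟩⟩

/-- Near an accumulation point of extreme points the push is not available directly. A slice of K at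
p is first replaced, with no loss of length and no gain of area, by a polygon P that still contains
many extreme points of K on its boundary. This forces P to have many vertices, one of which can be
pushed without disturbing the gluing along the chord. -/
lemma exists_better_of_accumulation {K : Set Plane} (hK : IsCompact K) (hKc : Convex ℝ K)
    (hi : (interior K).Nonempty) (hKD : K ⊆ unitDisk) {p : Plane} (hp : p ∈ K.extremePoints ℝ)
    (hp1 : ‖p‖ < 1) (hacc : p ∈ closure (K.extremePoints ℝ \ {p})) :
    ∃ L, IsCompact L ∧ Convex ℝ L ∧ L ⊆ unitDisk ∧ volume L ≤ volume K ∧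
      boundaryLength K < boundaryLength L := by
  classical
  -- the slice
  obtain ⟨q, hq⟩ := closure_nonempty_iff.1 ⟨p, hacc⟩
  have hqp : 0 < dist q p := dist_pos.2 hq.2
  -- The first bound keeps the square of half-side r about p in the open disk, the second excludes q
  -- from the slice.
  set r := min ((1 - ‖p‖) / 4) (dist q p) with hr
  have hr0 : 0 < r := lt_min (by linarith) hqp
  have hr1 : r ≤ (1 - ‖p‖) / 4 := min_le_left _ _
  obtain ⟨f, c, hcp, hqc, hsub⟩ := exists_slice hK hKc hp hr0 hq.1.1 (min_le_right _ _)
  have hf : f ≠ 0 := by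
    rintro rfl
    simp only [zero_apply] at hcp hqc
    linarith
  obtain ⟨z, hz, hzc⟩ := exists_mem_interior_on_line hKc hi hq.1.1 hqc hp.1 hcp
  obtain ⟨a, b, g, g', hab, hg, hgba, hg', hgab⟩ := exists_chord hK hKc hf hz hzc
  have ha : a ∈ K ∩ {x | f x = c} := hab ▸ left_mem_segment ℝ a b
  have hb : b ∈ K ∩ {x | f x = c} := hab ▸ right_mem_segment ℝ a b
  have hfa : f a = c := ha.2
  have hfb : f b = c := hb.2
  set C := K ∩ {x | c ≤ f x} with hC
  have hCcpt : IsCompact C := hK.inter_right (isClosed_le continuous_const f.continuous)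
  have hCc : Convex ℝ C := hKc.inter (convex_halfSpace_ge f.isLinear c)
  -- the polygonal region
  obtain ⟨X, hXn, hX⟩ := exists_finset_extremePoints hacc
    (isOpen_lt continuous_const f.continuous : IsOpen {x | c < f x}) hcp 129
  have hsupp : ∀ x : Plane, ∃ h : Plane →L[ℝ] ℝ, x ∈ X → h ≠ 0 ∧ ∀ y ∈ K, h y ≤ h x := by
    intro x
    by_cases hx : x ∈ X
    · have hxi : x ∉ interior K := fun h =>
        Set.disjoint_left.1 (disjoint_interior_extremePoints K) h (hX hx).1
      obtain ⟨h, h1, h2⟩ := exists_support hKc hi hxi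
      refine ⟨h, fun _ => ⟨?_, h1⟩⟩
      rintro rfl
      simpa using h2 z hz
    · exact ⟨0, fun h => absurd h hx⟩
  choose h hh using hsupp
  set e0 : Plane →L[ℝ] ℝ := EuclideanSpace.proj 0 with he0
  set e1 : Plane →L[ℝ] ℝ := EuclideanSpace.proj 1 with he1
  -- The region is bounded by the line of the chord, supporting lines of K at its ends, the square
  -- about p, and supporting lines of K at the points of X. The lines at a and b prepare the gluing,
  -- those at X make `card_le_of_support` applicable.
  set H : Finset ((Plane →L[ℝ] ℝ) × ℝ) :=
    {(-f, -c), (g, g a), (g', g' b), (e0, e0 p + r), (-e0, -e0 p + r), (e1, e1 p + r),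
      (-e1, -e1 p + r)} ∪ X.image fun x => (h x, h x x) with hH
  have hHmem : ∀ {Q : (Plane →L[ℝ] ℝ) × ℝ → Prop}, (∀ s ∈ H, Q s) ↔ Q (-f, -c) ∧ Q (g, g a) ∧
      Q (g', g' b) ∧ Q (e0, e0 p + r) ∧ Q (-e0, -e0 p + r) ∧ Q (e1, e1 p + r) ∧
      Q (-e1, -e1 p + r) ∧ ∀ x ∈ X, Q (h x, h x x) := by
    intro Q
    simp only [hH, Finset.mem_union, Finset.mem_insert, Finset.mem_singleton, Finset.mem_image, or_imp, forall_and,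
      forall_eq, and_assoc, forall_exists_index, and_imp, forall_apply_eq_imp_iff₂]
  have hH0 : ∀ s ∈ H, s.1 ≠ 0 := by
    refine hHmem.2 ⟨neg_ne_zero.2 hf, ?_, ?_, ?_, ?_, ?_, ?_, fun x hx => (hh x hx).1⟩
    · rintro rfl
      simp at hgba
    · rintro rfl
      simp at hgab
    · intro h0
      simpa [he0] using DFunLike.congr_fun h0 (EuclideanSpace.single 0 1)
    · intro h0
      simpa [he0] using DFunLike.congr_fun h0 (EuclideanSpace.single 0 1)
    · intro h0
      simpa [he1] using DFunLike.congr_fun h0 (EuclideanSpace.single 1 1)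
    · intro h0
      simpa [he1] using DFunLike.congr_fun h0 (EuclideanSpace.single 1 1)
  have hEmem : ∀ y, y ∈ halfPlanes H ↔ c ≤ f y ∧ g y ≤ g a ∧ g' y ≤ g' b ∧ e0 y ≤ e0 p + r ∧
      e0 p - r ≤ e0 y ∧ e1 y ≤ e1 p + r ∧ e1 p - r ≤ e1 y ∧ ∀ x ∈ X, h x y ≤ h x x := by
    intro y
    rw [halfPlanes, Set.mem_ofPred_eq, hHmem]
    simp only [neg_apply, neg_le_neg_iff]
    rw [← sub_eq_neg_add r, ← sub_eq_neg_add r, neg_le_sub_iff_le_add, neg_le_sub_iff_le_add]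
    simp only [sub_le_iff_le_add]
    simp only [add_comm r]
  have hEball : halfPlanes H ⊆ Metric.ball (0 : Plane) 1 := by
    intro y hy
    obtain ⟨-, -, -, h1, h2, h3, h4, -⟩ := (hEmem y).1 hy
    have hd : ‖y - p‖ ≤ 2 * r := by
      rw [EuclideanSpace.norm_eq, Fin.sum_univ_two, Real.sqrt_le_left (by positivity)]
      simp only [Real.norm_eq_abs, sq_abs, PiLp.sub_apply]
      simp only [he0, he1, PiLp.proj_apply] at h1 h2 h3 h4
      nlinarith
    rw [mem_ball_zero_iff]
    have := norm_add_le (y - p) p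
    rw [sub_add_cancel] at this
    linarith
  have hEcpt : IsCompact (halfPlanes H) := isCompact_unitDisk.of_isClosed_subset
    (isClosed_halfPlanes H) (hEball.trans Metric.ball_subset_closedBall)
  have hCE : C ⊆ halfPlanes H := by
    intro y hy
    have hyr := hsub hy
    rw [mem_ball_iff_norm] at hyr
    have h0 : ∀ i, |y i - p i| ≤ r := fun i => (PiLp.norm_apply_le (y - p) i).trans hyr.le
    have h1 := abs_le.1 (h0 0)
    have h2 := abs_le.1 (h0 1)
    rw [hEmem]
    simp only [he0, he1, PiLp.proj_apply]
    exact ⟨hy.2, hg y hy.1, hg' y hy.1, by linarith, by linarith, by linarith, by linarith,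
      fun x hx => (hh x hx).2 y hy.1⟩
  have hXC : (X : Set Plane) ⊆ C := fun x hx => ⟨(hX hx).1.1, (show c < f x from (hX hx).2).le⟩
  have hX'C : ((insert a (insert b X) : Finset Plane) : Set Plane) ⊆ C := by
    rw [Finset.coe_insert, Finset.coe_insert]
    exact Set.insert_subset ⟨ha.1, hfa.ge⟩ (Set.insert_subset ⟨hb.1, hfb.ge⟩ hXC)
  have hX'E : ((insert a (insert b X) : Finset Plane) : Set Plane) ⊆ frontier (halfPlanes H) := by
    intro x hx
    refine (mem_frontier_halfPlanes hH0).2 ⟨hCE (hX'C hx), ?_⟩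
    rw [Finset.mem_coe, Finset.mem_insert, Finset.mem_insert] at hx
    rcases hx with rfl | rfl | hx
    · exact ⟨(g, g x), by simp [hH], rfl⟩
    · exact ⟨(g', g' x), by simp [hH], rfl⟩
    · exact ⟨(h x, h x x), Finset.mem_union_right _ (Finset.mem_image_of_mem _ hx), rfl⟩
  -- The many extreme points in X cannot be collinear.
  have hX'i : (interior (convexHull ℝ
      ((insert a (insert b X) : Finset Plane) : Set Plane))).Nonempty := by
    by_contra hcon
    obtain ⟨k, hk0, d, hk⟩ := exists_line_of_interior_eq_empty (convex_convexHull ℝ _)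
      (Set.not_nonempty_iff_eq_empty.1 hcon) (Set.Nonempty.convexHull ⟨a, by simp⟩)
    have := card_le_two_of_line hKc (fun x hx => (hX hx).1) hk0 (d := d) fun x hx =>
      hk x (subset_convexHull ℝ _ (by simp [hx]))
    omega
  obtain ⟨n, P, hPn, hXP, hPE, hPvol, hPlen⟩ :=
    exists_polygon_in_halfPlanes hH0 hEcpt hCcpt hCc hCE hX'C hX'E hX'i
  obtain ⟨hPcpt, hPc, -, V, -, hV⟩ := polygons_facts hPn
  have hPi : (interior P).Nonempty := hX'i.mono (interior_mono (convexHull_min hXP hPc))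
  have hXP' : (X : Set Plane) ⊆ P := fun x hx => hXP (by simp [Finset.mem_coe.1 hx])
  have haP : a ∈ P := hXP (by simp)
  have hbP : b ∈ P := hXP (by simp)
  -- a vertex to be pushed
  obtain ⟨v, hv, hfv, hgv, hgv'⟩ : ∃ v ∈ P.extremePoints ℝ, c < f v ∧ g v < g a ∧ g' v < g' b := by
    by_contra hcon
    push Not at hcon
    -- If every vertex were on one of the three lines of the gluing data, P would have at most 6
    -- vertices and X at most 2·2⁶ = 128 points; this is why X was given 129.
    have hcard := card_le_of_support hKc hPcpt hPc hV (fun x hx => (hX hx).1) hXP'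
      (fun x hx => (hh x hx).1) fun x hx y hy => ((hEmem y).1 (hPE hy)).2.2.2.2.2.2.2 x hx
    have hsubV : V ⊆ (V.filter fun x => f x = c) ∪ (V.filter fun x => g x = g a) ∪
        (V.filter fun x => g' x = g' b) := by
      intro x hx
      have hxP : x ∈ P.extremePoints ℝ := hV ▸ hx
      obtain ⟨h1, h2, h3, -⟩ := (hEmem x).1 (hPE hxP.1)
      simp only [Finset.mem_union, Finset.mem_filter, hx, true_and]
      by_contra hne
      push Not at hne
      exact not_le.2 (lt_of_le_of_ne h3 hne.2)
        (hcon x hxP (lt_of_le_of_ne h1 hne.1.1.symm) (lt_of_le_of_ne h2 hne.1.2))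
    have hg0 : g ≠ 0 := hH0 (g, g a) (by simp [hH])
    have hg0' : g' ≠ 0 := hH0 (g', g' b) (by simp [hH])
    have hfil : ∀ (k : Plane →L[ℝ] ℝ) (d : ℝ), k ≠ 0 → (V.filter fun x => k x = d).card ≤ 2 :=
      fun k d hk => card_le_two_of_line hPc
        ((Finset.coe_subset.2 (Finset.filter_subset _ _)).trans hV.le) hk
        fun x hx => (Finset.mem_filter.1 hx).2
    have hV6 : V.card ≤ 6 := by
      refine (Finset.card_le_card hsubV).trans ((Finset.card_union_le _ _).trans ?_)
      have := Finset.card_union_le (V.filter fun x => f x = c) (V.filter fun x => g x = g a)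
      have := hfil f c hf
      have := hfil g (g a) hg0
      have := hfil g' (g' b) hg0'
      omega
    have := Nat.pow_le_pow_right (n := 2) (by norm_num) hV6
    omega
  -- The neighbourhood keeps the pushed vertex beyond the chord, below both supporting lines and in
  -- the open disk, so the new polygon can replace the slice.
  obtain ⟨v', ⟨⟨⟨hfv', hgv1⟩, hgv2⟩, hv'D⟩, -, hlen, hvol⟩ := exists_push_polygon hPn hPi hv
    (U := {x | c < f x} ∩ {x | g x < g a} ∩ {x | g' x < g' b} ∩ Metric.ball 0 1)
    ((((isOpen_lt continuous_const f.continuous).inter (isOpen_lt g.continuous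
      continuous_const)).inter (isOpen_lt g'.continuous continuous_const)).inter
      Metric.isOpen_ball |>.mem_nhds ⟨⟨⟨hfv, hgv⟩, hgv'⟩, hEball (hPE hv.1)⟩)
  have hfv' : c < f v' := hfv'
  have hgv1 : g v' < g a := hgv1
  have hgv2 : g' v' < g' b := hgv2
  set W := P.extremePoints ℝ \ {v} with hW
  set P' := convexHull ℝ (insert v' W) with hP'
  have hfin : (P.extremePoints ℝ).Finite := hV ▸ V.finite_toSet
  have hWP : W ⊆ P := fun x hx => hx.1.1
  have hWP' : convexHull ℝ W ⊆ P' := convexHull_mono (Set.subset_insert _ _)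
  -- The ends of the chord may fail to be vertices of P, but v is off their supporting lines, so
  -- they are spanned by the vertices that stay.
  have haP' : a ∈ P' := hWP' (mem_convexHull_of_support hPcpt hPc hfin haP
    (fun y hy => ((hEmem y).1 (hPE hy)).2.1) hgv)
  have hbP' : b ∈ P' := hWP' (mem_convexHull_of_support hPcpt hPc hfin hbP
    (fun y hy => ((hEmem y).1 (hPE hy)).2.2.1) hgv')
  have hP'c : Convex ℝ P' := convex_convexHull ℝ _
  have hP'cpt : IsCompact P' := isCompact_convexHull ((hfin.subset Set.sdiff_subset).insert v').isCompact
  have hP'f : ∀ x ∈ P', c ≤ f x := convexHull_min (t := {x | c ≤ f x})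
    (Set.insert_subset hfv'.le fun x hx => ((hEmem x).1 (hPE (hWP hx))).1)
    (convex_halfSpace_ge f.isLinear c)
  have hP'g : ∀ x ∈ P', g x ≤ g a := convexHull_min (t := {x | g x ≤ g a})
    (Set.insert_subset hgv1.le fun x hx => ((hEmem x).1 (hPE (hWP hx))).2.1)
    (convex_halfSpace_le g.isLinear _)
  have hP'g' : ∀ x ∈ P', g' x ≤ g' b := convexHull_min (t := {x | g' x ≤ g' b})
    (Set.insert_subset hgv2.le fun x hx => ((hEmem x).1 (hPE (hWP hx))).2.2.1)
    (convex_halfSpace_le g'.isLinear _)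
  have hP'D : P' ⊆ unitDisk := convexHull_min (Set.insert_subset
    (Metric.ball_subset_closedBall hv'D) fun x hx =>
    Metric.ball_subset_closedBall (hEball (hPE (hWP hx)))) convex_unitDisk
  have habP' : segment ℝ a b ⊆ P' := hP'c.segment_subset haP' hbP'
  have hlowc : IsCompact (K ∩ {x | f x ≤ c}) :=
    hK.inter_right (isClosed_le f.continuous continuous_const)
  set L := (K ∩ {x | f x ≤ c}) ∪ P' with hL
  have hLc : Convex ℝ L := by
    refine convex_union_of_support hf (hKc.inter (convex_halfSpace_le f.isLinear c)) hP'c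
      (fun x hx => hx.2) hP'f hfa hfb ?_ habP' (g := g) (g' := g') ?_ hgba ?_ hgab
    · rw [← hab]
      exact fun x hx => ⟨hx.1, le_of_eq hx.2⟩
    · rintro x (hx | hx)
      exacts [hg x hx.1, hP'g x hx]
    · rintro x (hx | hx)
      exacts [hg' x hx.1, hP'g' x hx]
  have hLcpt : IsCompact L := hlowc.union hP'cpt
  have hKL : K ∩ {x | f x ≤ c} = L ∩ {x | f x ≤ c} := by
    apply Set.Subset.antisymm
    · exact fun x hx => ⟨Or.inl hx, hx.2⟩
    · rintro x ⟨hx | hx, hxc⟩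
      · exact hx
      · have : x ∈ segment ℝ a b := mem_segment_of_support hf hfa hfb hgba hgab
          (le_antisymm hxc (hP'f x hx)) (hP'g x hx) (hP'g' x hx)
        rw [← hab] at this
        exact ⟨this.1, hxc⟩
  have hLP' : L ∩ {x | c ≤ f x} = P' := by
    apply Set.Subset.antisymm
    · rintro x ⟨hx | hx, hxc⟩
      · exact habP' (hab ▸ ⟨hx.1, le_antisymm hx.2 hxc⟩)
      · exact hx
    · exact fun x hx => ⟨Or.inr hx, hP'f x hx⟩
  have hLi : (interior L).Nonempty := by
    have hqcl : q ∈ closure (interior K) := by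
      rw [hKc.closure_interior_eq_closure_of_nonempty_interior hi]
      exact subset_closure hq.1.1
    have hopen : IsOpen {x | f x < c} := isOpen_lt f.continuous continuous_const
    obtain ⟨y, hyc, hy⟩ := mem_closure_iff.1 hqcl _ hopen hqc
    exact ⟨y, interior_maximal (fun x hx => Or.inl ⟨interior_subset hx.2, (show f x < c from hx.1).le⟩)
      (hopen.inter isOpen_interior) ⟨hyc, hy⟩⟩
  refine ⟨L, hLcpt, hLc, Set.union_subset (Set.inter_subset_left.trans hKD) hP'D, ?_, ?_⟩
  · rw [volume_cut L hf c, volume_cut K hf c, ← hKL, hLP', hvol]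
    gcongr
  · refine boundaryLength_lt_of_cut hf hK hKc hi hLcpt hLc hLi hKL hab ⟨q, hq.1.1, hqc⟩
      ⟨p, hp.1, hcp⟩ ⟨v', Or.inr (subset_convexHull ℝ _ (Or.inl rfl)), hfv'⟩ ?_
    rw [hLP']
    exact hPlen.trans_lt hlen

/-- A compact convex subset of the disk with an extreme point in the open disk does not have
maximal perimeter. -/
theorem exists_better {K : Set Plane} (hK : IsCompact K) (hKc : Convex ℝ K)
    (hi : (interior K).Nonempty) (hKD : K ⊆ unitDisk) {v : Plane} (hv : v ∈ K.extremePoints ℝ)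
    (hv1 : ‖v‖ < 1) :
    ∃ L, IsCompact L ∧ Convex ℝ L ∧ L ⊆ unitDisk ∧ volume L ≤ volume K ∧
      boundaryLength K < boundaryLength L := by
  by_cases hiso : ∀ p ∈ K.extremePoints ℝ, ‖p‖ < 1 → p ∉ closure (K.extremePoints ℝ \ {p})
  · exact exists_better_of_isolated hK hKc hi hKD hiso hv hv1
  · push Not at hiso
    obtain ⟨p, hp, hp1, hacc⟩ := hiso
    exact exists_better_of_accumulation hK hKc hi hKD hp hp1 hacc

/-! ### Inscribed polygons -/

lemma sphere_subset_extremePoints : Metric.sphere (0 : Plane) 1 ⊆ unitDisk.extremePoints ℝ := by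
  rw [unitDisk, StrictConvexSpace.extremePoints_closedBall_eq_sphere]

lemma circlePoint_mem_sphere (t : ℝ) : circlePoint t ∈ Metric.sphere (0 : Plane) 1 := by
  rw [mem_sphere_zero_iff_norm, norm_circlePoint]

/-- Three points of the circle span a triangle. -/
lemma interior_convexHull_nonempty_of_sphere {V : Finset Plane}
    (hV : (V : Set Plane) ⊆ Metric.sphere 0 1) (h3 : 3 ≤ V.card) :
    (interior (convexHull ℝ (V : Set Plane))).Nonempty := by
  by_contra hcon
  have hne : V.Nonempty := Finset.card_pos.1 (by omega)
  obtain ⟨k, hk0, d, hk⟩ := exists_line_of_interior_eq_empty (convex_convexHull ℝ _)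
    (Set.not_nonempty_iff_eq_empty.1 hcon) hne.to_set.convexHull
  have := card_le_two_of_line convex_unitDisk (hV.trans sphere_subset_extremePoints) hk0 (d := d)
    fun x hx => hk x (subset_convexHull ℝ _ hx)
  omega

lemma sum_Iio_eq_sum_range {k : ℕ} (f : ℕ → ℝ) (i : Fin k) :
    ∑ j ∈ Finset.Iio i, f j = ∑ n ∈ Finset.range i, f n := by
  rw [← Nat.Iio_eq_range, ← Fin.map_valEmbedding_Iio, Finset.sum_map]
  rfl

section vertices
variable {k : ℕ} {τ : ℕ → ℝ}

/-- The gaps of a finite set of points of the circle, given by their increasing angles. -/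
lemma gaps_range_circlePoint (hτ : ∀ i < k, τ i < τ (i + 1)) (hk : τ k = τ 0 + 2 * Real.pi)
    (hk0 : 0 < k) :
    gaps (Set.range fun i : Fin k => circlePoint (τ i)) (τ 0) =
      Set.range fun i : Fin k => (τ i, τ (i + 1)) := by
  set F := Set.range fun i : Fin k => circlePoint (τ i) with hF
  have hmono : ∀ i j, i ≤ j → j ≤ k → τ i ≤ τ j := by
    intro i j hij
    induction j, hij using Nat.le_induction with
    | base => exact fun _ => le_rfl
    | succ j hij ih => exact fun hj => (ih (by omega)).trans (hτ j (by omega)).le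
  have hinj : ∀ s, τ 0 ≤ s → s < τ 0 + 2 * Real.pi → circlePoint s ∈ F → ∃ i : Fin k, s = τ i := by
    rintro s h1 h2 ⟨i, hi⟩
    refine ⟨i, circlePoint_injOn (τ 0) ⟨h1, h2⟩ ⟨hmono 0 i (Nat.zero_le _) i.2.le, ?_⟩ hi.symm⟩
    rw [← hk]
    exact (hτ i i.2).trans_le (hmono _ _ i.2 le_rfl)
  have hgap : ∀ i : Fin k, (τ i, τ (i + 1)) ∈ gaps F (τ 0) := by
    intro i
    refine ⟨hmono 0 i (Nat.zero_le _) i.2.le, hτ i i.2, hk ▸ hmono _ _ i.2 le_rfl, ⟨i, rfl⟩, ?_, ?_⟩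
    · rcases Nat.lt_or_ge (i + 1) k with h | h
      · exact ⟨⟨i + 1, h⟩, rfl⟩
      · have : (i : ℕ) + 1 = k := by omega
        simp only [this]
        rw [hk, circlePoint_add_two_pi]
        exact ⟨⟨0, hk0⟩, rfl⟩
    · rintro s ⟨h1, h2⟩ hs
      have h1' := hmono 0 i (Nat.zero_le _) i.2.le
      have h2' := hmono (i + 1) k i.2 le_rfl
      rw [hk] at h2'
      obtain ⟨j, rfl⟩ := hinj s (h1'.trans h1.le) (h2.trans_le h2') hs
      have hij : (i : ℕ) < j := by
        by_contra hcon
        exact not_lt.2 (hmono j i (by omega) i.2.le) h1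
      exact not_lt.2 (hmono (i + 1) j hij j.2.le) h2
  apply Set.Subset.antisymm
  · intro p hp
    have hlt : p.1 < τ 0 + 2 * Real.pi := hp.2.1.trans_le hp.2.2.1
    obtain ⟨i, hi⟩ := hinj p.1 hp.1 hlt hp.2.2.2.1
    refine ⟨i, ?_⟩
    by_contra hne
    rcases gaps_disjoint (hgap i) hp hne with h | h
    · have := hτ i i.2
      rw [hi] at h
      simp only at h
      linarith
    · have := hp.2.1
      rw [hi] at this
      simp only at h
      linarith
  · rintro _ ⟨i, rfl⟩
    exact hgap i

end vertices

/-- Cumulative angles, indexed by natural numbers so that the value at k closes the circle. -/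
lemma IsInscribedPolygon.exists_angles {k : ℕ} {θ : Fin k → ℝ} {P : Set Plane}
    (h : IsInscribedPolygon θ P) : ∃ τ : ℕ → ℝ, (∀ i : Fin k, τ (i + 1) - τ i = θ i) ∧
      τ k = τ 0 + 2 * Real.pi ∧
      P = convexHull ℝ (Set.range fun i : Fin k => circlePoint (τ i)) := by
  obtain ⟨-, -, hsum, φ, rfl⟩ := h
  set θ' : ℕ → ℝ := fun n => if h : n < k then θ ⟨n, h⟩ else 0 with hθ'
  have hθ : ∀ i : Fin k, θ' i = θ i := fun i => by simp [hθ']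
  refine ⟨fun n => φ + ∑ m ∈ Finset.range n, θ' m, fun i => ?_, ?_, ?_⟩
  · simp only [Finset.sum_range_succ, hθ]
    ring
  · simp only [Finset.range_zero, Finset.sum_empty, add_zero, Finset.sum_range, hθ, hsum]
  · congr 2
    ext1 i
    change circlePoint (φ + _) = circlePoint (φ + ∑ m ∈ Finset.range i, θ' m)
    rw [← sum_Iio_eq_sum_range]
    simp only [hθ]

/-- The gaps of the vertex set are the k arcs between consecutive vertices, so the polygon is the
disk without k caps, and `boundaryLength_cutDisk` computes length and area together. -/
lemma IsInscribedPolygon.facts {k : ℕ} {θ : Fin k → ℝ} {P : Set Plane}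
    (h : IsInscribedPolygon θ P) : P ∈ polygons k ∧ P ⊆ unitDisk ∧ (interior P).Nonempty ∧
      boundaryLength P = ENNReal.ofReal (2 * ∑ i, Real.sin (θ i / 2)) ∧
      volume P = ENNReal.ofReal ((∑ i, Real.sin (θ i)) / 2) := by
  classical
  obtain ⟨τ, hτθ, hτk, hP⟩ := h.exists_angles
  obtain ⟨hk3, hpos, hsum, -⟩ := h
  have hτ : ∀ i < k, τ i < τ (i + 1) := fun i hi => by
    have h1 := hτθ ⟨i, hi⟩
    have h2 := hpos ⟨i, hi⟩
    simp only at h1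
    linarith
  have hgaps := gaps_range_circlePoint hτ hτk (by omega)
  have hmono : ∀ i j, i ≤ j → j ≤ k → τ i ≤ τ j := by
    intro i j hij
    induction j, hij using Nat.le_induction with
    | base => exact fun _ => le_rfl
    | succ j hij ih => exact fun hj => (ih (by omega)).trans (hτ j (by omega)).le
  have hinj : Function.Injective fun i : Fin k => τ i := by
    have : StrictMono fun i : Fin k => τ i := fun i j hij =>
      (hτ i i.2).trans_le (hmono (i + 1) j hij j.2.le)
    exact this.injective
  set F := Set.range fun i : Fin k => circlePoint (τ i) with hF
  have hFs : F ⊆ Metric.sphere 0 1 := by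
    rintro _ ⟨i, rfl⟩
    exact circlePoint_mem_sphere _
  have hFfin : F.Finite := Set.finite_range _
  have hcp : Function.Injective fun i : Fin k => circlePoint (τ i) := by
    intro i j hij
    refine hinj (circlePoint_injOn (τ 0) ⟨hmono 0 i (Nat.zero_le _) i.2.le, ?_⟩
      ⟨hmono 0 j (Nat.zero_le _) j.2.le, ?_⟩ hij)
    · rw [← hτk]; exact (hτ i i.2).trans_le (hmono _ _ i.2 le_rfl)
    · rw [← hτk]; exact (hτ j j.2).trans_le (hmono _ _ j.2 le_rfl)
  set V : Finset Plane := Finset.univ.image fun i : Fin k => circlePoint (τ i) with hV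
  have hVF : (V : Set Plane) = F := by simp [hV, hF]
  have hVk : V.card = k := by rw [hV, Finset.card_image_of_injective _ hcp]; simp
  have hi : (interior (convexHull ℝ F)).Nonempty := by
    rw [← hVF]
    exact interior_convexHull_nonempty_of_sphere (hVF ▸ hFs) (by omega)
  set S : Finset (ℝ × ℝ) := Finset.univ.image fun i : Fin k => (τ i, τ (i + 1)) with hS
  have hSg : (S : Set (ℝ × ℝ)) = gaps F (τ 0) := by rw [hgaps]; simp [hS]
  have hsumS : ∀ f : ℝ → ℝ, ∑ p ∈ S, f (p.2 - p.1) = ∑ i, f (θ i) := fun f => by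
    rw [hS, Finset.sum_image]
    · exact Finset.sum_congr rfl fun i _ => by simp only [hτθ]
    · exact fun i _ j _ hij => hinj (Prod.ext_iff.1 hij).1
  have hφ : circlePoint (τ 0) ∈ F := ⟨⟨0, by omega⟩, rfl⟩
  have hcut := convexHull_eq_cutDisk hFs hFfin.isClosed (hFfin.isClosed_convexHull ℝ) hφ hSg
  obtain ⟨h1, h2⟩ := boundaryLength_cutDisk hFs hi S hSg.le
  rw [← hcut, hsumS] at h1 h2
  subst hP
  refine ⟨⟨V, Finset.card_pos.1 (by omega), hVk.le, by rw [hVF]⟩, ?_, hi, ?_, ?_⟩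
  · exact convexHull_min (hFs.trans Metric.sphere_subset_closedBall) convex_unitDisk
  · rw [h1]
    congr 1
    simp only [capExcess, Finset.sum_sub_distrib, hsum, Finset.mul_sum]
    ring
  · rw [h2]
    congr 1
    simp only [capArea, ← Finset.sum_div, Finset.sum_sub_distrib, hsum]
    ring

/-- A nondegenerate polygon with vertices on the circle is an inscribed polygon. -/
lemma exists_isInscribedPolygon {V : Finset Plane} (hV : (V : Set Plane) ⊆ Metric.sphere 0 1)
    (h3 : 3 ≤ V.card) :
    ∃ θ : Fin V.card → ℝ, IsInscribedPolygon θ (convexHull ℝ (V : Set Plane)) := by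
  classical
  obtain ⟨x₀, hx₀⟩ := Finset.card_pos.1 (show 0 < V.card by omega)
  have hnorm : ∀ x ∈ V, ‖x‖ = 1 := fun x hx => mem_sphere_zero_iff_norm.1 (hV hx)
  obtain ⟨φ, -, hφ⟩ := exists_circlePoint_eq (hnorm x₀ hx₀) 0
  have hex : ∀ x : Plane, ∃ t, x ∈ V → t ∈ Set.Ico φ (φ + 2 * Real.pi) ∧ circlePoint t = x := by
    intro x
    by_cases hx : x ∈ V
    · obtain ⟨t, ht, htx⟩ := exists_circlePoint_eq (hnorm x hx) φ
      exact ⟨t, fun _ => ⟨ht, htx⟩⟩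
    · exact ⟨0, fun h => absurd h hx⟩
  choose ang hang using hex
  have hanginj : Set.InjOn ang V := fun x hx y hy hxy => by
    rw [← (hang x hx).2, ← (hang y hy).2, hxy]
  set k := V.card with hk
  set T := V.image ang with hT
  have hTk : T.card = k := Finset.card_image_of_injOn hanginj
  set e := T.orderEmbOfFin hTk with he
  have heT : ∀ i, e i ∈ T := fun i => Finset.orderEmbOfFin_mem _ _ _
  have hTI : ∀ t ∈ T, t ∈ Set.Ico φ (φ + 2 * Real.pi) ∧ circlePoint t ∈ V := by
    intro t ht
    obtain ⟨x, hx, rfl⟩ := Finset.mem_image.1 ht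
    exact ⟨(hang x hx).1, by rw [(hang x hx).2]; exact hx⟩
  -- The default value φ + 2π is the actual angle at n = k, where the polygon closes.
  set τ : ℕ → ℝ := fun n => if h : n < k then e ⟨n, h⟩ else φ + 2 * Real.pi with hτ
  have hτe : ∀ i : Fin k, τ i = e i := fun i => by simp [hτ]
  have hτk : τ k = φ + 2 * Real.pi := by simp [hτ]
  have hτlt : ∀ i : Fin k, τ i < τ (i + 1) := by
    intro i
    rw [hτe]
    rcases Nat.lt_or_ge (i + 1) k with h | h
    · simp only [hτ, h, dif_pos]
      exact e.strictMono (Fin.mk_lt_mk.2 (Nat.lt_succ_self _) : i < ⟨i + 1, h⟩)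
    · simp only [hτ, not_lt.2 h, dif_neg, not_false_eq_true]
      exact (hTI _ (heT i)).1.2
  -- The circle is cut at the angle of the vertex x₀, which is therefore the smallest angle in the
  -- list.
  have hτ0 : τ 0 = φ := by
    have hφT : φ ∈ T := by
      refine Finset.mem_image.2 ⟨x₀, hx₀, circlePoint_injOn φ (hang x₀ hx₀).1
        ⟨le_rfl, by linarith [Real.pi_pos]⟩ ?_⟩
      rw [(hang x₀ hx₀).2, hφ]
    have hmem : φ ∈ Set.range e := by
      rw [he, Finset.range_orderEmbOfFin]
      exact hφT
    obtain ⟨i, hi⟩ := hmem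
    have h0 : (0 : ℕ) < k := by omega
    rw [show τ 0 = e ⟨0, h0⟩ from hτe ⟨0, h0⟩]
    refine le_antisymm ?_ (hTI _ (heT _)).1.1
    conv_rhs => rw [← hi]
    exact e.monotone (Fin.mk_le_mk.2 (Nat.zero_le _) : (⟨0, h0⟩ : Fin k) ≤ i)
  refine ⟨fun i => τ (i + 1) - τ i, h3, fun i => sub_pos.2 (hτlt i), ?_, φ, ?_⟩
  · rw [← Finset.sum_range fun n => τ (n + 1) - τ n, Finset.sum_range_sub, hτk, hτ0]
    ring
  · congr 1
    ext x
    constructor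
    · intro hx
      have : ang x ∈ Set.range e := by
        rw [he, Finset.range_orderEmbOfFin]
        exact Finset.mem_image_of_mem _ hx
      obtain ⟨i, hi⟩ := this
      refine ⟨i, ?_⟩
      simp only
      rw [sum_Iio_eq_sum_range fun n => τ (n + 1) - τ n, Finset.sum_range_sub, hτ0,
        add_sub_cancel, hτe, hi, (hang x hx).2]
    · rintro ⟨i, rfl⟩
      simp only
      rw [sum_Iio_eq_sum_range fun n => τ (n + 1) - τ n, Finset.sum_range_sub, hτ0,
        add_sub_cancel, hτe]
      exact (hTI _ (heT i)).2

/-- A closed subset of the circle is finite if finitely many gaps have total length `2 π`. -/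
lemma finite_of_gaps {F : Set Plane} {φ : ℝ} (hF : F ⊆ Metric.sphere 0 1) (hfin : Finite (gaps F φ))
    (hsum : ∑' p : gaps F φ, ((p : ℝ × ℝ).2 - (p : ℝ × ℝ).1) = 2 * Real.pi) : F.Finite := by
  classical
  have hgf : (gaps F φ).Finite := hfin
  set S := hgf.toFinset with hS
  have hSg : ∀ p, p ∈ S ↔ p ∈ gaps F φ := fun p => hgf.mem_toFinset
  have hsumS : ∑ p ∈ S, (p.2 - p.1) = 2 * Real.pi := by
    rw [← hsum, ← Finset.tsum_subtype' S fun p => p.2 - p.1]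
    have : (S : Set (ℝ × ℝ)) = gaps F φ := hgf.coe_toFinset
    rw [this]
  have hdisj : (S : Set (ℝ × ℝ)).PairwiseDisjoint fun p => Set.Ioo p.1 p.2 := by
    intro p hp q hq hpq
    rw [Function.onFun, Set.disjoint_left]
    intro x hx hx'
    rcases gaps_disjoint ((hSg p).1 hp) ((hSg q).1 hq) hpq with h | h
    · linarith [hx.2, hx'.1]
    · linarith [hx.1, hx'.2]
  set U := ⋃ p ∈ S, Set.Icc p.1 p.2 with hU
  have hUcl : IsClosed U := isClosed_biUnion_finset fun p _ => isClosed_Icc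
  -- An angle outside the closed gaps would have an open neighbourhood of positive measure outside
  -- them, while the gaps already fill the whole length 2π. Hence every point of F is at φ or at an
  -- end of a gap.
  have hcover : Set.Ioo φ (φ + 2 * Real.pi) ⊆ U := by
    by_contra hcon
    obtain ⟨x, hx, hxU⟩ := Set.not_subset.1 hcon
    have hO : IsOpen (Set.Ioo φ (φ + 2 * Real.pi) \ U) := isOpen_Ioo.sdiff hUcl
    have hpos : 0 < volume (Set.Ioo φ (φ + 2 * Real.pi) \ U) := hO.measure_pos volume ⟨x, hx, hxU⟩
    have h1 := measure_biUnion_finset (μ := volume) hdisj fun p _ => measurableSet_Ioo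
    simp only [Real.volume_Ioo] at h1
    rw [← ENNReal.ofReal_sum_of_nonneg fun p hp => sub_nonneg.2 ((hSg p).1 hp).2.1.le, hsumS] at h1
    have h2 : (⋃ p ∈ S, Set.Ioo p.1 p.2) ∪ (Set.Ioo φ (φ + 2 * Real.pi) \ U) ⊆
        Set.Ioo φ (φ + 2 * Real.pi) :=
      Set.union_subset (Set.iUnion₂_subset fun p hp =>
        Set.Ioo_subset_Ioo ((hSg p).1 hp).1 ((hSg p).1 hp).2.2.1) Set.sdiff_subset
    have h3 := measure_mono (μ := volume) h2
    rw [measure_union _ hO.measurableSet, h1, Real.volume_Ioo, add_sub_cancel_left] at h3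
    · exact absurd (ENNReal.le_sub_of_add_le_left ENNReal.ofReal_ne_top h3) (by
        rw [tsub_self]; exact not_le.2 hpos)
    · rw [Set.disjoint_left]
      intro y hy hy'
      simp only [Set.mem_iUnion] at hy
      obtain ⟨p, hp, hyp⟩ := hy
      exact hy'.2 (Set.mem_biUnion hp (Set.Ioo_subset_Icc_self hyp))
  refine ((((Set.finite_singleton φ).union (S.finite_toSet.image Prod.fst)).union
    (S.finite_toSet.image Prod.snd)).image circlePoint).subset fun x hx => ?_
  obtain ⟨t, ht, rfl⟩ := exists_circlePoint_eq (mem_sphere_zero_iff_norm.1 (hF hx)) φ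
  refine ⟨t, ?_, rfl⟩
  rcases ht.1.eq_or_lt with h | h
  · exact Or.inl (Or.inl h.symm)
  · have htU := hcover ⟨h, ht.2⟩
    simp only [hU, Set.mem_iUnion] at htU
    obtain ⟨p, hp, htp⟩ := htU
    rcases htp.1.eq_or_lt with h1 | h1
    · exact Or.inl (Or.inr ⟨p, hp, h1⟩)
    rcases htp.2.eq_or_lt with h2 | h2
    · exact Or.inr ⟨p, hp, h2.symm⟩
    · exact absurd hx (((hSg p).1 hp).2.2.2.2.2 t ⟨h1, h2⟩)

/-! ### Polygons and their central angles -/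

/-- A nondegenerate polygon whose vertices lie on the circle is an inscribed polygon. -/
lemma exists_isInscribedPolygon_of_extremePoints {n : ℕ} {P : Set Plane} (hP : P ∈ polygons n)
    (hi : (interior P).Nonempty) (h : P.extremePoints ℝ ⊆ Metric.sphere 0 1) :
    ∃ k ≤ n, ∃ θ : Fin k → ℝ, IsInscribedPolygon θ P := by
  classical
  obtain ⟨hPc, hPconv, hne, V, hVn, hV⟩ := polygons_facts hP
  have hPV : P = convexHull ℝ (V : Set Plane) :=
    (subset_convexHull_of_extremePoints_subset hPc hPconv V.finite_toSet.isCompact hV.ge).antisymm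
      (convexHull_min (hV ▸ extremePoints_subset) hPconv)
  rcases le_or_gt 3 V.card with h3 | h3
  · obtain ⟨θ, hθ⟩ := exists_isInscribedPolygon (hV ▸ h) h3
    rw [← hPV] at hθ
    exact ⟨_, hVn, θ, hθ⟩
  -- At most two points span at most a line, which contradicts the nonempty interior.
  · exfalso
    rw [hPV, interior_convexHull_nonempty_iff_affineSpan_eq_top] at hi
    have hV0 : V.Nonempty := by
      rw [hPV, convexHull_nonempty_iff (𝕜 := ℝ)] at hne
      exact hne
    have hcard : V.card = (V.card - 1) + 1 := (Nat.sub_add_cancel hV0.card_pos).symm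
    have hle := finrank_vectorSpan_image_finset_le ℝ (id : Plane → Plane) V hcard
    rw [Finset.image_id, ← direction_affineSpan, hi, AffineSubspace.direction_top, finrank_top,
      finrank_euclideanSpace_fin] at hle
    omega

lemma HasCentralAngles.facts {P : Set Plane} {Θ : Multiset ℝ} (h : HasCentralAngles P Θ) :
    P ∈ polygons Θ.card ∧ P ⊆ unitDisk ∧ (interior P).Nonempty ∧
      boundaryLength P = ENNReal.ofReal (2 * (Θ.map fun x => Real.sin (x / 2)).sum) ∧
      volume P = ENNReal.ofReal ((Θ.map Real.sin).sum / 2) := by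
  obtain ⟨k, θ, h, rfl⟩ := h
  obtain ⟨h1, h2, h3, h4, h5⟩ := h.facts
  simp only [Multiset.map_map, Multiset.card_map, Finset.card_val, Finset.card_univ,
    Fintype.card_fin]
  exact ⟨h1, h2, h3, h4, h5⟩

lemma exists_hasCentralAngles {Θ : Multiset ℝ} (h3 : 3 ≤ Θ.card) (hpos : ∀ x ∈ Θ, 0 < x)
    (hsum : Θ.sum = 2 * Real.pi) : ∃ P, HasCentralAngles P Θ := by
  obtain ⟨l, rfl⟩ := Quotient.exists_rep Θ
  change 3 ≤ (l : Multiset ℝ).card at h3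
  change (l : Multiset ℝ).sum = _ at hsum
  rw [Multiset.coe_card] at h3
  rw [Multiset.sum_coe] at hsum
  have hmap : Finset.univ.val.map l.get = (l : Multiset ℝ) := by
    simp [Fin.univ_def]
  refine ⟨_, l.length, l.get, ⟨h3, fun i => hpos _ (List.get_mem l i), ?_, 0, rfl⟩, hmap⟩
  rw [← hsum, ← Multiset.sum_coe, ← hmap]
  rfl

/-- Half of the perimeter of the inscribed polygon with central angles `Θ`. -/
noncomputable def halfPerimeter (Θ : Multiset ℝ) : ℝ := (Θ.map fun x => Real.sin (x / 2)).sum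

/-- The central angles `Θ` are optimal for polygons with at most `n` vertices and area at
most `A`. -/
structure OptimalAngles (n : ℕ) (A : ℝ) (Θ : Multiset ℝ) : Prop where
  three_le_card : 3 ≤ Θ.card
  card_le : Θ.card ≤ n
  pos : ∀ x ∈ Θ, 0 < x
  sum_eq : Θ.sum = 2 * Real.pi
  area_le : (Θ.map Real.sin).sum ≤ 2 * A
  two_lt : 2 < halfPerimeter Θ
  le : ∀ k ≤ n, 3 ≤ k → ∀ θ ∈ angleClass (Fin k) A, (∀ i, 0 < θ i) →
    ∑ i, Real.sin (θ i / 2) ≤ halfPerimeter Θ ∧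
      (∑ i, Real.sin (θ i / 2) = halfPerimeter Θ → Finset.univ.val.map θ = Θ)

lemma perimeter_le_of_interior_eq_empty {K : Set Plane} (hK : IsCompact K) (hKc : Convex ℝ K)
    (hi : interior K = ∅) (hD : K ⊆ unitDisk) : perimeter K ≤ ENNReal.ofReal 4 := by
  rw [perimeter, if_neg (Set.not_nonempty_iff_eq_empty.2 hi)]
  have h := boundaryLength_le_of_interior_eq_empty hK hKc hi hD
  calc 2 * Measure.hausdorffMeasure 1 (frontier K) ≤ 2 * ENNReal.ofReal (2 * 1) := by
        gcongr; exact h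
    _ = ENNReal.ofReal 4 := by
        rw [← ENNReal.ofReal_ofNat 2, ← ENNReal.ofReal_mul (by norm_num)]
        norm_num

lemma boundaryLength_le_perimeter (K : Set Plane) : boundaryLength K ≤ perimeter K := by
  rw [perimeter]
  split_ifs
  · exact le_rfl
  · exact le_mul_of_one_le_left zero_le (by norm_num)

lemma mem_polygonClass {n : ℕ} {A : ℝ} {P : Set Plane} :
    P ∈ polygonClass n A ↔ P ∈ polygonsBetween n ∅ unitDisk (ENNReal.ofReal A) :=
  ⟨fun h => ⟨h.1, Set.empty_subset _, h.2⟩, fun h => ⟨h.1, h.2.2⟩⟩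

namespace OptimalAngles
variable {n : ℕ} {A : ℝ} {Θ : Multiset ℝ}

lemma le_inscribed (h : OptimalAngles n A Θ) (hA : 0 < A) {P : Set Plane} (hP : P ∈ polygons n)
    (hv : volume P ≤ ENNReal.ofReal A) (hi : (interior P).Nonempty)
    (hs : P.extremePoints ℝ ⊆ Metric.sphere 0 1) :
    boundaryLength P ≤ ENNReal.ofReal (2 * halfPerimeter Θ) ∧
      (boundaryLength P = ENNReal.ofReal (2 * halfPerimeter Θ) → HasCentralAngles P Θ) := by
  obtain ⟨k, hk, θ, hθ⟩ := exists_isInscribedPolygon_of_extremePoints hP hi hs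
  obtain ⟨-, -, -, hb, hvol⟩ := hθ.facts
  rw [hvol, ENNReal.ofReal_le_ofReal_iff hA.le] at hv
  have hmem : θ ∈ angleClass (Fin k) A := ⟨fun i => (hθ.2.1 i).le, hθ.2.2.1, by linarith⟩
  obtain ⟨h1, h2⟩ := h.le k hk hθ.1 θ hmem hθ.2.1
  rw [hb]
  refine ⟨ENNReal.ofReal_le_ofReal (by linarith), fun heq => ⟨k, θ, hθ, h2 ?_⟩⟩
  have hS := h.two_lt
  have h0 : 0 < ENNReal.ofReal (2 * halfPerimeter Θ) := ENNReal.ofReal_pos.2 (by linarith)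
  rw [← heq, ENNReal.ofReal_pos] at h0
  rw [ENNReal.ofReal_eq_ofReal_iff h0.le (by linarith)] at heq
  linarith

lemma mem_polygonClass (h : OptimalAngles n A Θ) {P : Set Plane} (hP : HasCentralAngles P Θ) :
    P ∈ polygonClass n A ∧ perimeter P = ENNReal.ofReal (2 * halfPerimeter Θ) := by
  obtain ⟨h1, h2, h3, h4, h5⟩ := hP.facts
  refine ⟨⟨polygons_mono h.card_le h1, h2, ?_⟩, (perimeter_eq_boundaryLength h3).trans h4⟩
  rw [h5]
  exact ENNReal.ofReal_le_ofReal (by linarith [h.area_le])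

/-- Compactness provides a longest polygon up to the threshold 4, and the polygon with angles Θ
exceeds this threshold. So the longest one is nondegenerate, has its vertices on the circle, and is
compared with Θ by `le_inscribed`. In the case of equality Q is itself a longest polygon, and the
same argument determines its angles. -/
lemma le_polygon (h : OptimalAngles n A Θ) (hA : 0 < A) {Q : Set Plane}
    (hQ : Q ∈ polygonClass n A) :
    perimeter Q ≤ ENNReal.ofReal (2 * halfPerimeter Θ) ∧
      (perimeter Q = ENNReal.ofReal (2 * halfPerimeter Θ) → HasCentralAngles Q Θ) := by
  have h4 : ENNReal.ofReal 4 < ENNReal.ofReal (2 * halfPerimeter Θ) :=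
    (ENNReal.ofReal_lt_ofReal_iff (by linarith [h.two_lt])).2 (by linarith [h.two_lt])
  have hmaxi : ∀ P ∈ polygonsBetween n ∅ unitDisk (ENNReal.ofReal A),
      ENNReal.ofReal (2 * halfPerimeter Θ) ≤ boundaryLength P →
      (∀ Q ∈ polygonsBetween n ∅ unitDisk (ENNReal.ofReal A),
        boundaryLength Q ≤ boundaryLength P) →
      boundaryLength P ≤ ENNReal.ofReal (2 * halfPerimeter Θ) ∧ HasCentralAngles P Θ := by
    intro P hP hge hmax
    obtain ⟨hPc, hPconv, -, -⟩ := polygons_facts hP.1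
    have hi : (interior P).Nonempty := by
      by_contra hcon
      have := perimeter_le_of_interior_eq_empty hPc hPconv
        (Set.not_nonempty_iff_eq_empty.1 hcon) hP.2.2.1
      exact absurd (h4.trans_le (hge.trans ((boundaryLength_le_perimeter P).trans this)))
        (lt_irrefl _)
    have hs := extremePoints_subset_frontier convex_unitDisk (Set.empty_subset _) hP hi hmax
    rw [frontier_unitDisk] at hs
    obtain ⟨h1, h2⟩ := h.le_inscribed hA hP.1 hP.2.2.2 hi hs
    exact ⟨h1, h2 (h1.antisymm hge)⟩
  obtain ⟨P₀, hP₀⟩ := exists_hasCentralAngles h.three_le_card h.pos h.sum_eq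
  obtain ⟨hP₀c, hP₀p⟩ := h.mem_polygonClass hP₀
  rw [perimeter_eq_boundaryLength hP₀.facts.2.2.1] at hP₀p
  obtain ⟨P, hP, hPmax⟩ := exists_max_polygon_unitDisk
    (show 1 ≤ n by have := h.three_le_card; have := h.card_le; omega) (ENNReal.ofReal A)
  have hge : ENNReal.ofReal (2 * halfPerimeter Θ) ≤ boundaryLength P := by
    rw [← hP₀p] at h4 ⊢
    exact (le_max_iff.1 (hPmax P₀ (_root_.mem_polygonClass.1 hP₀c))).resolve_right (not_le.2 h4)
  have hbound : ∀ Q ∈ polygonsBetween n ∅ unitDisk (ENNReal.ofReal A),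
      boundaryLength Q ≤ ENNReal.ofReal (2 * halfPerimeter Θ) := by
    have hPm : ∀ Q ∈ polygonsBetween n ∅ unitDisk (ENNReal.ofReal A),
        boundaryLength Q ≤ boundaryLength P := fun Q hQ =>
      (hPmax Q hQ).trans (max_le le_rfl (h4.le.trans hge))
    exact fun Q hQ => (hPm Q hQ).trans (hmaxi P hP hge hPm).1
  obtain ⟨hQc, hQconv, -, -⟩ := polygons_facts hQ.1
  have hQ' := _root_.mem_polygonClass.1 hQ
  rcases Set.eq_empty_or_nonempty (interior Q) with hi | hi
  · have hle := perimeter_le_of_interior_eq_empty hQc hQconv hi hQ.2.1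
    exact ⟨hle.trans h4.le, fun heq => absurd (heq ▸ hle) (not_le.2 h4)⟩
  · rw [perimeter_eq_boundaryLength hi]
    refine ⟨hbound Q hQ', fun heq => (hmaxi Q hQ' heq.ge fun Q' hQ'' => ?_).2⟩
    rw [heq]
    exact hbound Q' hQ''

/-- The solutions of the polygonal problem are the polygons with optimal central angles. -/
theorem isPolygonMaximizer_iff (h : OptimalAngles n A Θ) (hA : 0 < A) (P : Set Plane) :
    IsPolygonMaximizer n A P ↔ HasCentralAngles P Θ := by
  constructor
  · intro hP
    obtain ⟨P₀, hP₀⟩ := exists_hasCentralAngles h.three_le_card h.pos h.sum_eq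
    obtain ⟨hP₀c, hP₀p⟩ := h.mem_polygonClass hP₀
    obtain ⟨h1, h2⟩ := h.le_polygon hA hP.1
    exact h2 (h1.antisymm (hP₀p ▸ hP.2 P₀ hP₀c))
  · intro hP
    obtain ⟨h1, h2⟩ := h.mem_polygonClass hP
    exact ⟨h1, fun Q hQ => h2 ▸ (h.le_polygon hA hQ).1⟩

theorem exists_isPolygonMaximizer (h : OptimalAngles n A Θ) (hA : 0 < A) :
    ∃ P, IsPolygonMaximizer n A P := by
  obtain ⟨P, hP⟩ := exists_hasCentralAngles h.three_le_card h.pos h.sum_eq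
  exact ⟨P, (h.isPolygonMaximizer_iff hA P).2 hP⟩

end OptimalAngles

/-! ### The optimal central angles -/

/-- Degenerate polygons have perimeter at most 4, so the optimum has to exceed 4. A triangle on a
diameter with a short side of angle ε does: the sum of its sin(·/2) is 1 + sin(ε/2) + cos(ε/2), and
its area is sin ε ≤ A. -/
lemma exists_angles_two_lt {A : ℝ} (hA : 0 < A) :
    ∃ θ ∈ angleClass (Fin 3) A, 2 < ∑ i, Real.sin (θ i / 2) := by
  set ε := min A 1 with hε
  have h0 : 0 < ε := lt_min hA one_pos
  have h1 : ε ≤ 1 := min_le_right _ _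
  have h2 : ε ≤ A := min_le_left _ _
  have hπ := Real.pi_gt_three
  refine ⟨![ε, Real.pi - ε, Real.pi], ⟨?_, ?_, ?_⟩, ?_⟩
  · intro i
    fin_cases i
    · exact h0.le
    · change 0 ≤ Real.pi - ε
      linarith
    · exact Real.pi_pos.le
  · simp only [Fin.sum_univ_three]
    change ε + (Real.pi - ε) + Real.pi = _
    ring
  · simp only [Fin.sum_univ_three]
    change Real.sin ε + Real.sin (Real.pi - ε) + Real.sin Real.pi ≤ _
    rw [Real.sin_pi_sub, Real.sin_pi]
    linarith [Real.sin_le h0.le]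
  · simp only [Fin.sum_univ_three]
    change 2 < Real.sin (ε / 2) + Real.sin ((Real.pi - ε) / 2) + Real.sin (Real.pi / 2)
    rw [show (Real.pi - ε) / 2 = Real.pi / 2 - ε / 2 by ring, Real.sin_pi_div_two_sub,
      Real.sin_pi_div_two]
    have hs : 0 < Real.sin (ε / 2) := Real.sin_pos_of_pos_of_lt_pi (by linarith) (by linarith)
    have hc : 0 < Real.cos (ε / 2) := Real.cos_pos_of_mem_Ioo ⟨by linarith, by linarith⟩
    have hsq := Real.sin_sq_add_cos_sq (ε / 2)
    nlinarith

section
variable {A θ₁ θ₂ : ℝ} {m : ℕ}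

lemma halfPerimeter_cons_replicate (hm : 3 ≤ m) :
    halfPerimeter (θ₁ ::ₘ Multiset.replicate (m - 1) θ₂) =
      Real.sin (θ₁ / 2) + ((m : ℝ) - 1) * Real.sin (θ₂ / 2) := by
  rw [halfPerimeter, Multiset.map_cons, Multiset.sum_cons, Multiset.map_replicate,
    Multiset.sum_replicate, nsmul_eq_mul, Nat.cast_sub (by omega), Nat.cast_one]

lemma smallAngle_le (hm : 3 ≤ m) (h1 : SmallAngleCondition A m θ₁)
    (h2 : θ₁ + ((m : ℝ) - 1) * θ₂ = 2 * Real.pi) : θ₁ ≤ θ₂ := by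
  have hm' : (3 : ℝ) ≤ m := by exact_mod_cast hm
  have hle := h1.2.1
  rw [le_div_iff₀ (by linarith)] at hle
  nlinarith

lemma sum_sin_cons_replicate (hm : 3 ≤ m) (h1 : SmallAngleCondition A m θ₁)
    (h2 : θ₁ + ((m : ℝ) - 1) * θ₂ = 2 * Real.pi) :
    ((θ₁ ::ₘ Multiset.replicate (m - 1) θ₂).map Real.sin).sum = 2 * A := by
  have hm' : (3 : ℝ) ≤ m := by exact_mod_cast hm
  have hθ₂ : θ₂ = (2 * Real.pi - θ₁) / ((m : ℝ) - 1) := by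
    rw [eq_div_iff (by linarith)]
    linarith
  rw [Multiset.map_cons, Multiset.sum_cons, Multiset.map_replicate,
    Multiset.sum_replicate, nsmul_eq_mul, Nat.cast_sub (by omega), Nat.cast_one, hθ₂]
  exact h1.2.2

lemma optimalAngles_cons_replicate (hA : 0 < A) (hm : 3 ≤ m) (hs : SideCountCondition A m)
    (h1 : SmallAngleCondition A m θ₁) (h2 : θ₁ + ((m : ℝ) - 1) * θ₂ = 2 * Real.pi) {n : ℕ}
    (hn : m ≤ n) : OptimalAngles n A (θ₁ ::ₘ Multiset.replicate (m - 1) θ₂) := by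
  have hcard : (θ₁ ::ₘ Multiset.replicate (m - 1) θ₂).card = m := by
    rw [Multiset.card_cons, Multiset.card_replicate]
    omega
  refine ⟨hm.trans hcard.ge, hcard.le.trans hn, fun x hx => ?_, ?_, ?_, ?_, fun k _ _ θ hθ hpos => ?_⟩
  · rcases Multiset.mem_cons.1 hx with rfl | hx
    · exact h1.1
    · rw [Multiset.eq_of_mem_replicate hx]
      exact h1.1.trans_le (smallAngle_le hm h1 h2)
  · rw [Multiset.sum_cons, Multiset.sum_replicate, nsmul_eq_mul, Nat.cast_sub (by omega),
      Nat.cast_one, h2]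
  · exact (sum_sin_cons_replicate hm h1 h2).le
  · obtain ⟨θ, hθ, hlt⟩ := exists_angles_two_lt hA
    rw [halfPerimeter_cons_replicate hm]
    exact hlt.trans_le (sum_sin_half_le hA hm hs h1 h2 hθ).1
  · rw [halfPerimeter_cons_replicate hm]
    obtain ⟨hle, heq⟩ := sum_sin_half_le hA hm hs h1 h2 hθ
    refine ⟨hle, fun h => ?_⟩
    rw [← heq h, Multiset.filter_eq_self.2]
    intro x hx
    obtain ⟨i, -, rfl⟩ := Multiset.mem_map.1 hx
    exact (hpos i).ne'

/-- Since n ≤ m − 1, the regular n-gon has area below A. It is optimal even without the area bound,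
so Jensen alone decides. -/
lemma optimalAngles_replicate (hA : 0 < A) (hs : SideCountCondition A m) {n : ℕ} (hn : 3 ≤ n)
    (hnm : n < m) : OptimalAngles n A (Multiset.replicate n (2 * Real.pi / n)) := by
  have hn' : (3 : ℝ) ≤ n := by exact_mod_cast hn
  have hmn : (n : ℝ) ≤ (m : ℝ) - 1 := by
    have : ((n + 1 : ℕ) : ℝ) ≤ m := by exact_mod_cast hnm
    push_cast at this
    linarith
  have hhalf : halfPerimeter (Multiset.replicate n (2 * Real.pi / n)) =
      n * Real.sin (Real.pi / n) := by
    rw [halfPerimeter, Multiset.map_replicate, Multiset.sum_replicate, nsmul_eq_mul]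
    congr 2
    ring
  refine ⟨by simpa using hn, by simp, fun x hx => ?_, ?_, ?_, ?_, fun k hk hk3 θ hθ hpos => ?_⟩
  · rw [Multiset.eq_of_mem_replicate hx]
    exact div_pos Real.two_pi_pos (by linarith)
  · rw [Multiset.sum_replicate, nsmul_eq_mul]
    field_simp
  · rw [Multiset.map_replicate, Multiset.sum_replicate, nsmul_eq_mul]
    exact (regular_area_mono (by linarith) hmn).trans hs.1.le
  · obtain ⟨θ, hθ, hlt⟩ := exists_angles_two_lt hA
    rw [hhalf]
    exact hlt.trans_le (sum_sin_half_le_regular hn (by norm_num) hn hθ.1 hθ.2.1).1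
  · rw [hhalf]
    exact sum_sin_half_le_regular hn (by omega) hk hθ.1 hθ.2.1

/-! ### The problem among all convex sets -/

/-- A polygon inside K whose t-fold enlargement contains K has area at most A and almost the length
of K. Its number of vertices is not controlled, hence the hypothesis for all n ≥ m. -/
lemma boundaryLength_le_of_optimalAngles {Θ : Multiset ℝ} (hA : 0 < A)
    (h : ∀ n, m ≤ n → OptimalAngles n A Θ) {K : Set Plane} (hK : IsCompact K) (hKc : Convex ℝ K)
    (hD : K ⊆ unitDisk) (hv : volume K ≤ ENNReal.ofReal A) :
    boundaryLength K ≤ ENNReal.ofReal (2 * halfPerimeter Θ) := by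
  classical
  rcases Set.eq_empty_or_nonempty (interior K) with hi | ⟨p, hp⟩
  · refine ((boundaryLength_le_perimeter K).trans
      (perimeter_le_of_interior_eq_empty hK hKc hi hD)).trans (ENNReal.ofReal_le_ofReal ?_)
    linarith [(h m le_rfl).two_lt]
  · refine le_of_forall_one_lt_le_ofReal_mul fun t ht => ?_
    obtain ⟨V, -, hVK, hpV, hsub⟩ := exists_polygon_between hK hKc hp ht (X := ∅) (by simp)
    have hVsub : convexHull ℝ (V : Set Plane) ⊆ K := convexHull_min hVK hKc
    have hVc := isCompact_convexHull V.finite_toSet.isCompact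
    have hmem : convexHull ℝ (V : Set Plane) ∈ polygonClass (max m V.card) A :=
      ⟨⟨V, (convexHull_nonempty_iff (𝕜 := ℝ)).1 ⟨p, interior_subset hpV⟩, le_max_right _ _, rfl⟩,
        hVsub.trans hD, (measure_mono hVsub).trans hv⟩
    calc boundaryLength K ≤ boundaryLength (AffineMap.homothety p t '' convexHull ℝ (V : Set Plane)) :=
          boundaryLength_mono hK hKc ⟨p, hp⟩
            (hVc.image (AffineMap.homothety_continuous p t)) hsub
      _ = ENNReal.ofReal t * boundaryLength (convexHull ℝ (V : Set Plane)) :=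
          boundaryLength_homothety _ _ (by linarith)
      _ ≤ ENNReal.ofReal t * ENNReal.ofReal (2 * halfPerimeter Θ) := by
          gcongr
          exact (boundaryLength_le_perimeter _).trans ((h _ (le_max_left _ _)).le_polygon hA hmem).1

/-- A compact convex set of maximal boundary length is an inscribed polygon. -/
lemma hasCentralAngles_of_boundaryLength_eq (hA : 0 < A) (hAπ : A < Real.pi) (hm : 3 ≤ m)
    (hs : SideCountCondition A m) (h1 : SmallAngleCondition A m θ₁)
    (h2 : θ₁ + ((m : ℝ) - 1) * θ₂ = 2 * Real.pi) {K : Set Plane} (hK : IsCompact K)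
    (hKc : Convex ℝ K) (hi : (interior K).Nonempty) (hD : K ⊆ unitDisk)
    (hv : volume K ≤ ENNReal.ofReal A)
    (heq : boundaryLength K =
      ENNReal.ofReal (2 * halfPerimeter (θ₁ ::ₘ Multiset.replicate (m - 1) θ₂))) :
    HasCentralAngles K (θ₁ ::ₘ Multiset.replicate (m - 1) θ₂) := by
  have hopt : ∀ n, m ≤ n → OptimalAngles n A (θ₁ ::ₘ Multiset.replicate (m - 1) θ₂) :=
    fun n hn => optimalAngles_cons_replicate hA hm hs h1 h2 hn
  set Θ := θ₁ ::ₘ Multiset.replicate (m - 1) θ₂ with hΘ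
  -- An extreme point in the open disk would allow a longer competitor of no larger area, against
  -- the upper bound.
  have hext : K.extremePoints ℝ ⊆ Metric.sphere 0 1 := by
    intro v hvK
    have hle : ‖v‖ ≤ 1 := mem_closedBall_zero_iff.1 (hD hvK.1)
    rw [mem_sphere_zero_iff_norm]
    by_contra hne
    obtain ⟨L, hL, hLc, hLD, hLv, hlt⟩ := exists_better hK hKc hi hD hvK (lt_of_le_of_ne hle hne)
    have := boundaryLength_le_of_optimalAngles hA hopt hL hLc hLD (hLv.trans hv)
    rw [heq] at hlt
    exact absurd hlt (not_lt.2 this)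
  set F := closure (K.extremePoints ℝ) with hF
  have hFs : F ⊆ Metric.sphere 0 1 := closure_minimal hext Metric.isClosed_sphere
  have hFc : IsClosed F := isClosed_closure
  have hFK : F ⊆ K := closure_minimal extremePoints_subset hK.isClosed
  have hFcpt : IsCompact F := hK.of_isClosed_subset hFc hFK
  have hKF : K = convexHull ℝ F :=
    (subset_convexHull_of_extremePoints_subset hK hKc hFcpt subset_closure).antisymm
      (convexHull_min hFK hKc)
  have hFne : F.Nonempty := by
    rw [← convexHull_nonempty_iff (𝕜 := ℝ), ← hKF]
    exact hi.mono interior_subset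
  obtain ⟨x₀, hx₀⟩ := hFne
  obtain ⟨φ, -, hφ⟩ := exists_circlePoint_eq (mem_sphere_zero_iff_norm.1 (hFs hx₀)) 0
  obtain ⟨hlen, hvol⟩ := boundaryLength_le_of_subset_sphere hFs hFc (hKF ▸ hK.isClosed)
    (hφ ▸ hx₀ : circlePoint φ ∈ F) (hKF ▸ hi)
  rw [← hKF, heq] at hlen
  rw [← hKF] at hvol
  have hpos : 0 < 2 * halfPerimeter Θ := by linarith [(hopt m le_rfl).two_lt]
  have hper := ENNReal.ofReal_le_ofReal_iff'.1 hlen |>.resolve_right (not_le.2 hpos)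
  rw [hΘ, halfPerimeter_cons_replicate hm] at hper
  have harea := (ENNReal.ofReal_le_ofReal_iff hA.le).1 (hvol.trans hv)
  -- Only the inequalities for length and area in terms of the gaps enter. Once F is finite, K is a
  -- polygon, and the polygonal equality case finishes.
  obtain ⟨hfin, htot⟩ := finite_of_le_two_pi_sub_tsum hA hAπ hm hs h1 h2
    (g := fun p : gaps F φ => (p : ℝ × ℝ).2 - (p : ℝ × ℝ).1) (fun p => sub_pos.2 p.2.2.1)
    summable_gaps.1 summable_gaps.2 (by linarith) hper
  have hFfin := finite_of_gaps hFs hfin htot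
  have hpoly : K ∈ polygonClass (max m hFfin.toFinset.card) A :=
    ⟨⟨hFfin.toFinset, by simpa using ⟨x₀, hx₀⟩, le_max_right _ _, by simpa using hKF⟩, hD, hv⟩
  refine ((hopt _ (le_max_left _ _)).le_polygon hA hpoly).2 ?_
  rw [perimeter_eq_boundaryLength hi, heq]

lemma interior_nonempty_of_mem_convexClass (hA : 0 < A) {Ω : Set Plane} (h : Ω ∈ convexClass A) :
    (interior Ω).Nonempty := by
  obtain ⟨hc, -, hv⟩ := h
  by_contra hcon
  have hpos : 0 < volume Ω := hv ▸ ENNReal.ofReal_pos.2 hA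
  obtain ⟨f, hf, c, hfc⟩ := exists_line_of_interior_eq_empty hc
    (Set.not_nonempty_iff_eq_empty.1 hcon) (nonempty_of_measure_ne_zero hpos.ne')
  exact hpos.not_ge ((measure_mono hfc).trans (volume_line hf c).le)

/-- A convex set with interior points has a null boundary and the same interior as its closure; this
reduces the problem to compact sets. -/
lemma closure_facts {Ω : Set Plane} (hc : Convex ℝ Ω) (hD : Ω ⊆ unitDisk)
    (hi : (interior Ω).Nonempty) :
    IsCompact (closure Ω) ∧ Convex ℝ (closure Ω) ∧ closure Ω ⊆ unitDisk ∧
      (interior (closure Ω)).Nonempty ∧ volume (closure Ω) = volume Ω ∧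
      boundaryLength (closure Ω) = perimeter Ω := by
  have hcl : closure Ω ⊆ unitDisk := closure_minimal hD isCompact_unitDisk.isClosed
  refine ⟨isCompact_unitDisk.of_isClosed_subset isClosed_closure hcl, hc.closure, hcl,
    hi.mono (interior_mono subset_closure), ?_, ?_⟩
  · refine (measure_mono_ae ?_).antisymm (measure_mono subset_closure)
    have h0 : volume (frontier Ω) = 0 := hc.addHaar_frontier volume
    filter_upwards [measure_eq_zero_iff_ae_notMem.1 h0] with x hx hxc
    exact interior_subset (not_not.1 fun h => hx ⟨hxc, h⟩)
  · rw [perimeter_eq_boundaryLength hi, boundaryLength, boundaryLength, frontier, closure_closure,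
      hc.interior_closure_eq_interior_of_nonempty_interior hi, frontier]

/-- The solutions of the problem among all convex sets. -/
lemma isConvexMaximizer_iff (hA : 0 < A) (hAπ : A < Real.pi) (hm : 3 ≤ m)
    (hs : SideCountCondition A m) (h1 : SmallAngleCondition A m θ₁)
    (h2 : θ₁ + ((m : ℝ) - 1) * θ₂ = 2 * Real.pi) (Ω : Set Plane) :
    IsConvexMaximizer A Ω ↔ Convex ℝ Ω ∧
      HasCentralAngles (closure Ω) (θ₁ ::ₘ Multiset.replicate (m - 1) θ₂) := by
  have hopt : ∀ n, m ≤ n → OptimalAngles n A (θ₁ ::ₘ Multiset.replicate (m - 1) θ₂) :=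
    fun n hn => optimalAngles_cons_replicate hA hm hs h1 h2 hn
  -- The bound holds for all areas up to A, and the polygon with the optimal angles has area exactly
  -- A. So prescribing the area gives the same maximum as bounding it.
  have hle : ∀ Ω ∈ convexClass A, perimeter Ω ≤
      ENNReal.ofReal (2 * halfPerimeter (θ₁ ::ₘ Multiset.replicate (m - 1) θ₂)) := by
    intro Ω hΩ
    obtain ⟨h1, h2, h3, -, h4, h5⟩ :=
      closure_facts hΩ.1 hΩ.2.1 (interior_nonempty_of_mem_convexClass hA hΩ)
    rw [← h5]
    exact boundaryLength_le_of_optimalAngles hA hopt h1 h2 h3 (h4.trans hΩ.2.2).le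
  have hmem : ∀ Ω, Convex ℝ Ω →
      HasCentralAngles (closure Ω) (θ₁ ::ₘ Multiset.replicate (m - 1) θ₂) →
      Ω ∈ convexClass A ∧ perimeter Ω =
        ENNReal.ofReal (2 * halfPerimeter (θ₁ ::ₘ Multiset.replicate (m - 1) θ₂)) := by
    intro Ω hc hΩ
    obtain ⟨-, hD, hi, hb, hv⟩ := hΩ.facts
    have hne : (interior Ω).Nonempty := by
      by_contra hcon
      obtain ⟨f, hf, c, hfc⟩ := exists_line_of_interior_eq_empty hc
        (Set.not_nonempty_iff_eq_empty.1 hcon) (closure_nonempty_iff.1 (hi.mono interior_subset))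
      have hcl : closure Ω ⊆ {x | f x = c} :=
        closure_minimal hfc (isClosed_eq f.continuous continuous_const)
      rw [interior_eq_empty_of_line hf hcl] at hi
      exact Set.not_nonempty_empty hi
    have hΩD := subset_closure.trans hD
    obtain ⟨-, -, -, -, h4, h5⟩ := closure_facts hc hΩD hne
    refine ⟨⟨hc, hΩD, ?_⟩, h5.symm.trans hb⟩
    rw [← h4, hv, sum_sin_cons_replicate hm h1 h2, mul_div_cancel_left₀ _ two_ne_zero]
  constructor
  · rintro ⟨hΩ, hmax⟩
    have hne := interior_nonempty_of_mem_convexClass hA hΩ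
    obtain ⟨g1, g2, g3, g4, g5, g6⟩ := closure_facts hΩ.1 hΩ.2.1 hne
    obtain ⟨P, hP⟩ := exists_hasCentralAngles (hopt m le_rfl).three_le_card (hopt m le_rfl).pos
      (hopt m le_rfl).sum_eq
    obtain ⟨hPc, hPconv, -⟩ := polygons_facts hP.facts.1
    obtain ⟨p1, p2⟩ := hmem P hPconv (by rwa [hPc.isClosed.closure_eq])
    refine ⟨hΩ.1, hasCentralAngles_of_boundaryLength_eq hA hAπ hm hs h1 h2 g1 g2 g4 g3
      (g5.trans hΩ.2.2).le ?_⟩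
    rw [g6]
    exact (hle Ω hΩ).antisymm (p2 ▸ hmax P p1)
  · rintro ⟨hc, hΩ⟩
    obtain ⟨p1, p2⟩ := hmem Ω hc hΩ
    exact ⟨p1, fun Ω' hΩ' => p2 ▸ hle Ω' hΩ'⟩

end

theorem mainTheorem1 (A : ℝ) (hA : 0 < A) (hAπ : A < Real.pi) :
    -- the polygonal problem: for each `n` there are solutions, and they are determined by `n`
    -- and `A` up to the order of the sides (and the position in the disk)
    (∀ n : ℕ, 3 ≤ n → ∃ Θ : Multiset ℝ,
      (∃ P, IsPolygonMaximizer n A P) ∧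
      (∀ P, IsPolygonMaximizer n A P ↔ HasCentralAngles P Θ)) ∧
    -- the number `m` of sides
    ∃ m : ℕ, 3 ≤ m ∧ SideCountCondition A m ∧
      (∀ k : ℕ, 2 ≤ k → SideCountCondition A k → k = m) ∧
      -- the central angles `0 < θ₁ ≤ θ₂ = … = θₘ`
      ∃ θ₁ θ₂ : ℝ, SmallAngleCondition A m θ₁ ∧
        (∀ t : ℝ, SmallAngleCondition A m t → t = θ₁) ∧
        θ₁ + ((m : ℝ) - 1) * θ₂ = 2 * Real.pi ∧ θ₁ ≤ θ₂ ∧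
        -- for `n ≥ m` the solutions of the polygonal problem do not change
        (∀ n : ℕ, m ≤ n → ∀ P, IsPolygonMaximizer n A P ↔
          HasCentralAngles P (θ₁ ::ₘ Multiset.replicate (m - 1) θ₂)) ∧
        -- the problem among all convex sets has solutions, and they are the same polygons
        (∃ Ω, IsConvexMaximizer A Ω ∧
          HasCentralAngles Ω (θ₁ ::ₘ Multiset.replicate (m - 1) θ₂)) ∧
        (∀ Ω, IsConvexMaximizer A Ω ↔ Convex ℝ Ω ∧
          HasCentralAngles (closure Ω) (θ₁ ::ₘ Multiset.replicate (m - 1) θ₂)) := by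
  obtain ⟨m, hm, hs⟩ := exists_sideCountCondition hA hAπ
  obtain ⟨θ₁, h1⟩ := exists_smallAngleCondition hm hs
  have hm' : (3 : ℝ) ≤ m := by exact_mod_cast hm
  obtain ⟨θ₂, h2⟩ : ∃ θ₂, θ₁ + ((m : ℝ) - 1) * θ₂ = 2 * Real.pi :=
    ⟨(2 * Real.pi - θ₁) / ((m : ℝ) - 1), by
      rw [mul_div_cancel₀ _ (by linarith), add_sub_cancel]⟩
  have hopt : ∀ n, m ≤ n → OptimalAngles n A (θ₁ ::ₘ Multiset.replicate (m - 1) θ₂) :=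
    fun n hn => optimalAngles_cons_replicate hA hm hs h1 h2 hn
  refine ⟨fun n hn => ?_, m, hm, hs, fun k hk hsk => sideCountCondition_unique hk (by omega) hsk hs,
    θ₁, θ₂, h1, fun t ht => smallAngleCondition_unique hm ht h1, h2, smallAngle_le hm h1 h2,
    fun n hn P => (hopt n hn).isPolygonMaximizer_iff hA P, ?_,
    isConvexMaximizer_iff hA hAπ hm hs h1 h2⟩
  -- For n ≥ m the angles are θ₁, θ₂, …, θ₂; for n < m they are those of the regular n-gon.
  · rcases le_or_gt m n with h | h
    · exact ⟨_, (hopt n h).exists_isPolygonMaximizer hA, (hopt n h).isPolygonMaximizer_iff hA⟩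
    · have hr := optimalAngles_replicate hA hs hn h
      exact ⟨_, hr.exists_isPolygonMaximizer hA, hr.isPolygonMaximizer_iff hA⟩
  · obtain ⟨P, hP⟩ := exists_hasCentralAngles (hopt m le_rfl).three_le_card (hopt m le_rfl).pos
      (hopt m le_rfl).sum_eq
    obtain ⟨hPc, hPconv, -⟩ := polygons_facts hP.facts.1
    exact ⟨P, (isConvexMaximizer_iff hA hAπ hm hs h1 h2 P).2
      ⟨hPconv, by rwa [hPc.isClosed.closure_eq]⟩, hP⟩
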